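/- Let $H$ be a complex Hilbert space, $n=2l$, and let $A(\lambda)=A_0+\lambda A_1+\dots+\lambda^nA_n$ be an operator pencil with bounded coefficients. Write $T^I=(T-T^*)/(2i)$, and let $V_0$ be the block tridiagonal operator in $H^{l+1}$ with diagonal blocks $2A_0^I,2A_2^I,\dots,2A_{2l}^I$ and with the blocks $A_1^I,A_3^I,\dots,A_{2l-1}^I$ both directly above and directly below the diagonal. *Definitions.* A chain of eigen- and associated vectors of $A(\lambda)$ at $c\in\mathbb C$ is a sequence $y^0\ne0,y^1,\dots,y^p$ in $H$ with $\sum_{r=0}^{s}\frac1{r!}A^{(r)}(c)y^{s-r}=0$ for $0\le s\le p$. Its Keldysh derived vectors of length $m$ are the vectors of $H^m$ with components $$(\tilde y^{h})_r=\frac{d^r}{dt^r}\Big[e^{ct}\Big(y^h+\frac{t}{1!}y^{h-1}+\dots+\frac{t^h}{h!}y^0\Big)\Big]_{t=0},\qquad 0\le r\le m-1 .$$ The discrete spectrum $\sigma_d(A)$ is the set of isolated eigenvalues of finite algebraic multiplicity (finite-dimensional kernel and bounded chain lengths, $A(\lambda)$ boundedly invertible in a punctured neighbourhood) at which $A(\lambda)^{-1}$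 has a pole. A canonical system at $c\in\sigma_d(A)$ is a finite family of chains $y_k^0,\dots,y_k^{p_k}$ at $c$, $1\le k\le N$, $p_1\ge\dots\ge p_N$, such that $y_1^0,\dots,y_N^0$ is a basis of $\operatorname{Ker}A(c)$ and $\sum_k(p_k+1)$ is maximal. Its adjoint system $z_k^0,\dots,z_k^{p_k}$ is determined by the requirement that the principal part of $A(\lambda)^{-1}$ at $c$ be $$\sum_{k=1}^{N}\sum_{h=0}^{p_k}\frac{(\cdot,z_k^h)y_k^0+(\cdot,z_k^{h-1})y_k^1+\dots+(\cdot,z_k^0)y_k^h}{(\lambda-c)^{p_k+1-h}} .$$ For real $c$, the canonical system is regular, with sign characteristics $\varepsilon_k$, if $\varepsilon_k=0$ whenever $p_k$ is odd, while for each even $p_k$ one has $\varepsilon_k=\pm1$ and, with Keldysh derived vectors of length $n$, $\tilde z_k^{\,p_k/2}=\varepsilon_k\tilde y_k^{\,p_k/2}+\tilde w$ for some $\tilde w$ in the span of all $\tilde y_j^{\,h}$ with $1\le j\le N$ and $0\le h\le[(p_j-1)/2]$ (no such $h$ if $p_j=0$). Choose a canonical system at every $c\in\sigma_d(A)$, a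 regular one with sign characteristics $\varepsilon_k$ if $c$ is real. Let $E^{\pm}$ consist of all chosen vectors $y_k^h$ ($0\le h\le p_k$) at the points $c$ with $\pm\operatorname{Im}c>0$, together with the vectors $y_k^h$, $0\le h\le[(p_k\pm\varepsilon_k)/2]$, at the real points $c$. Let $\xi^{\pm}$ be the system of the Keldysh derived vectors of length $l$ in $H^l$ of the elements of $E^{\pm}$. **Theorem.** Suppose that $A(\lambda)$ is linearly dissipative in the sense that $V_0\le0$, and that $0$ does not belong to the closure of the numerical range $\{(A_0u,u):\|u\|=1\}$ of $A_0$. Then, for every such choice of canonical systems, each of the systems $\xi^+$ and $\xi^-$ is minimal in $H^l$, that is, it has a biorthogonal system in $H^l$. -/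

import Mathlib

noncomputable section

namespace OperatorPencil

open Filter Topology

variable {H : Type*} [NormedAddCommGroup H] [InnerProductSpace ℂ H]

/-- The operator pencil `A(μ) = A₀ + μ A₁ + ⋯ + μⁿ Aₙ` of order `n` with bounded coefficients. -/
def pencil {n : ℕ} (A : Fin (n + 1) → (H →L[ℂ] H)) (μ : ℂ) : H →L[ℂ] H :=
  ∑ j : Fin (n + 1), μ ^ (j : ℕ) • A j

/-- `y⁰, …, yᵖ` is a chain of eigen- and associated vectors (EAV) of `A(μ)` at `c`: `y⁰ ≠ 0` and
`A(c) yˢ + A'(c) yˢ⁻¹ / 1! + ⋯ + A⁽ˢ⁾(c) y⁰ / s! = 0` for `s = 0, …, p`.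
The values `y h` with `h > p` play no role. -/
def IsEAVChain {n : ℕ} (A : Fin (n + 1) → (H →L[ℂ] H)) (c : ℂ) (p : ℕ) (y : ℕ → H) : Prop :=
  y 0 ≠ 0 ∧ ∀ s ≤ p, ∑ r ∈ Finset.range (s + 1),
    ((r.factorial : ℂ)⁻¹ • iteratedDeriv r (pencil A) c) (y (s - r)) = 0

/-- The discrete spectrum: isolated eigenvalues of finite algebraic multiplicity (finite-dimensional
kernel, bounded chain lengths) at which the resolvent `A(μ)⁻¹` has a pole. -/
def discreteSpectrum {n : ℕ} (A : Fin (n + 1) → (H →L[ℂ] H)) : Set ℂ :=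
  {c | (pencil A c).ker ≠ ⊥ ∧
    FiniteDimensional ℂ (pencil A c).ker ∧
    (∃ m : ℕ, ∀ (p : ℕ) (y : ℕ → H), IsEAVChain A c p y → p ≤ m) ∧
    (∀ᶠ μ in 𝓝[≠] c, IsUnit (pencil A μ)) ∧
    MeromorphicAt (fun μ => Ring.inverse (pencil A μ)) c}

variable (H) in
/-- A finite family of finite sequences `y_k⁰, …, y_k^{p_k}`, `k = 1, …, N`; the values `y k h` with
`h > p k` play no role. -/
structure ChainSystem where
  N : ℕ
  p : Fin N → ℕ
  y : Fin N → ℕ → H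

/-- Chains of EAV at `c` whose eigenvectors form a basis of `Ker A(c)`. -/
def IsKernelChainSystem {n : ℕ} (A : Fin (n + 1) → (H →L[ℂ] H)) (c : ℂ)
    (Y : ChainSystem H) : Prop :=
  (∀ k, IsEAVChain A c (Y.p k) (Y.y k)) ∧
  LinearIndependent ℂ (fun k => Y.y k 0) ∧
  Submodule.span ℂ (Set.range fun k => Y.y k 0) = (pencil A c).ker

/-- Canonical system of EAV at `c`: chains over a basis of `Ker A(c)`, with the maximal possible
total number of vectors, ordered so that `p₁ ≥ p₂ ≥ ⋯`. -/
def IsCanonical {n : ℕ} (A : Fin (n + 1) → (H →L[ℂ] H)) (c : ℂ) (Y : ChainSystem H) : Prop :=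
  IsKernelChainSystem A c Y ∧ Antitone Y.p ∧
  ∀ Y' : ChainSystem H, IsKernelChainSystem A c Y' → ∑ k, (Y'.p k + 1) ≤ ∑ k, (Y.p k + 1)

/-- The operator function
`∑ₖ ∑_{h ≤ pₖ} (μ - c)^{-(pₖ + 1 - h)} [(·, z_k^h) y_k⁰ + (·, z_k^{h-1}) y_k¹ + ⋯ + (·, z_k⁰) y_k^h]`;
here `InnerProductSpace.rankOne ℂ u v` is the operator `(·, v) u`. -/
def principalPart (c : ℂ) (Y : ChainSystem H) (z : Fin Y.N → ℕ → H) (μ : ℂ) : H →L[ℂ] H :=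
  ∑ k, ∑ h ∈ Finset.range (Y.p k + 1), ((μ - c) ^ (Y.p k + 1 - h))⁻¹ •
    ∑ i ∈ Finset.range (h + 1), InnerProductSpace.rankOne ℂ (Y.y k i) (z k (h - i))

/-- `z` is the adjoint system of the canonical system `Y` at `c`: the principal part of `A(μ)⁻¹` at
`c` is `principalPart c Y z`. This determines `z_k^h`, `h ≤ p_k`, uniquely. -/
def IsAdjointSystem {n : ℕ} (A : Fin (n + 1) → (H →L[ℂ] H)) (c : ℂ)
    (Y : ChainSystem H) (z : Fin Y.N → ℕ → H) : Prop :=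
  ∃ g : ℂ → (H →L[ℂ] H), AnalyticAt ℂ g c ∧
    ∀ᶠ μ in 𝓝[≠] c, Ring.inverse (pencil A μ) = principalPart c Y z μ + g μ

/-- The Keldysh derived vector of length `m` of `y^h` in the chain `y⁰, y¹, …` at `c`: its `r`-th
component, `r = 0, …, m - 1`, is the `r`-th derivative at `t = 0` of
`exp (c t) (y^h + t y^{h-1} / 1! + ⋯ + t^h y⁰ / h!)`. -/
def keldysh (m : ℕ) (c : ℂ) (y : ℕ → H) (h : ℕ) : PiLp 2 (fun _ : Fin m => H) :=
  WithLp.toLp 2 fun r => iteratedDeriv (r : ℕ)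
    (fun t : ℂ => Complex.exp (c * t) •
      ∑ q ∈ Finset.range (h + 1), (t ^ q / (q.factorial : ℂ)) • y (h - q)) 0

/-- Regular canonical system at a real eigenvalue `c` with sign characteristics `ε`. For a chain of
even length (`p_k` odd) `ε_k = 0`. For a chain of odd length (`p_k` even) `ε_k = ±1`, and the
Keldysh derived vectors of length `n` of the middle elements of the chain and of the adjoint chain
satisfy `z̃ = ε_k ỹ + w̃`, where `w̃` lies in the span of all `ỹ_j^h` with `h ≤ [(p_j - 1) / 2]`
(no `h` if `p_j = 0`). -/
def IsRegular {n : ℕ} (A : Fin (n + 1) → (H →L[ℂ] H)) (c : ℂ)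
    (Y : ChainSystem H) (ε : Fin Y.N → ℤ) : Prop :=
  IsCanonical A c Y ∧ ∃ z : Fin Y.N → ℕ → H, IsAdjointSystem A c Y z ∧
    ∀ k, (Odd (Y.p k) → ε k = 0) ∧
      (Even (Y.p k) → (ε k = 1 ∨ ε k = -1) ∧
        keldysh n c (z k) (Y.p k / 2) - (ε k : ℂ) • keldysh n c (Y.y k) (Y.p k / 2) ∈
          Submodule.span ℂ {v | ∃ (j : Fin Y.N) (h : ℕ), 2 * h + 1 ≤ Y.p j ∧
            v = keldysh n c (Y.y j) h})

section Halves

variable {n : ℕ} {A : Fin (n + 1) → (H →L[ℂ] H)}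

/-- The indices `(c, k, h)` of the vectors `y_k^h` of the half `E⁺`; integer division by `2`
rounds down. -/
def EPlus (Y : discreteSpectrum A → ChainSystem H) (ε : ∀ c, Fin (Y c).N → ℤ) :
    Set (Σ c : discreteSpectrum A, Fin (Y c).N × ℕ) :=
  {i | (0 < (i.1 : ℂ).im ∧ i.2.2 ≤ (Y i.1).p i.2.1) ∨
    ((i.1 : ℂ).im = 0 ∧ (i.2.2 : ℤ) ≤ (((Y i.1).p i.2.1 : ℤ) + ε i.1 i.2.1) / 2)}

/-- The indices `(c, k, h)` of the vectors `y_k^h` of the half `E⁻`. -/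
def EMinus (Y : discreteSpectrum A → ChainSystem H) (ε : ∀ c, Fin (Y c).N → ℤ) :
    Set (Σ c : discreteSpectrum A, Fin (Y c).N × ℕ) :=
  {i | ((i.1 : ℂ).im < 0 ∧ i.2.2 ≤ (Y i.1).p i.2.1) ∨
    ((i.1 : ℂ).im = 0 ∧ (i.2.2 : ℤ) ≤ (((Y i.1).p i.2.1 : ℤ) - ε i.1 i.2.1) / 2)}

/-- The Keldysh derived vectors of length `m` of the vectors of `E⁺`. -/
def xiPlus (m : ℕ) (Y : discreteSpectrum A → ChainSystem H) (ε : ∀ c, Fin (Y c).N → ℤ)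
    (i : EPlus Y ε) : PiLp 2 (fun _ : Fin m => H) :=
  keldysh m (i.1.1 : ℂ) ((Y i.1.1).y i.1.2.1) i.1.2.2

/-- The Keldysh derived vectors of length `m` of the vectors of `E⁻`. -/
def xiMinus (m : ℕ) (Y : discreteSpectrum A → ChainSystem H) (ε : ∀ c, Fin (Y c).N → ℤ)
    (i : EMinus Y ε) : PiLp 2 (fun _ : Fin m => H) :=
  keldysh m (i.1.1 : ℂ) ((Y i.1.1).y i.1.2.1) i.1.2.2

end Halves

open Classical in
/-- A system of vectors of a Hilbert space is minimal if it has a biorthogonal system. -/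
def IsMinimalSystem {ι K : Type*} [NormedAddCommGroup K] [InnerProductSpace ℂ K]
    (v : ι → K) : Prop :=
  ∃ z : ι → K, ∀ i j, inner ℂ (z j) (v i) = if i = j then (1 : ℂ) else 0

/-- The numerical range `{(T u, u) : ‖u‖ = 1}`. -/
def numericalRange (T : H →L[ℂ] H) : Set ℂ :=
  {a | ∃ u : H, ‖u‖ = 1 ∧ a = inner ℂ u (T u)}

/-- The block tridiagonal operator matrix `V₀` of order `l + 1` of a pencil of order `2l`: its
diagonal blocks are `2 A_{2i}^I` and its blocks in the positions `(i, i + 1)` and `(i + 1, i)` are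
`A_{2i+1}^I`, where `T^I = (T - T*) / (2i)` is `imaginaryPart T`. -/
def V0 [CompleteSpace H] {l : ℕ} (A : Fin (2 * l + 1) → (H →L[ℂ] H)) :
    Matrix (Fin (l + 1)) (Fin (l + 1)) (H →L[ℂ] H) := fun i j =>
  let T : H →L[ℂ] H := imaginaryPart (A ⟨(i : ℕ) + (j : ℕ), by omega⟩)
  if i = j then (2 : ℂ) • T
  else if (i : ℕ) + 1 = j ∨ (j : ℕ) + 1 = i then T
  else 0

/-- The pencil is linearly dissipative with `V₀ ≤ 0`, that is, `(V₀ x, x) ≤ 0` on `H^{l+1}`. -/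
def IsLinearlyDissipative [CompleteSpace H] {l : ℕ} (A : Fin (2 * l + 1) → (H →L[ℂ] H)) : Prop :=
  ∀ x : Fin (l + 1) → H, (∑ i, ∑ j, inner ℂ (x i) (V0 A i j (x j))).re ≤ 0

end OperatorPencil

end

open Finset Filter Topology

namespace OperatorPencil

section Jets

variable {H : Type*} [NormedAddCommGroup H] [InnerProductSpace ℂ H]

/-- The left shift on sequences. -/
def shift : (ℕ → H) →ₗ[ℂ] (ℕ → H) := LinearMap.funLeft ℂ H Nat.succ

@[simp] lemma shift_apply (v : ℕ → H) (k : ℕ) : shift v k = v (k + 1) := rfl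

lemma shift_pow_apply (n : ℕ) (v : ℕ → H) (k : ℕ) : (shift ^ n) v k = v (k + n) := by
  induction n generalizing k with
  | zero => simp
  | succ n ih =>
    rw [pow_succ', Module.End.mul_apply, shift_apply, ih]
    congr 1; omega

/-- The sequence of all derivatives at `0` of `exp (c t) (y^h + t y^{h-1} / 1! + ⋯ + t^h y⁰ / h!)`. -/
def jet (c : ℂ) (y : ℕ → H) (h : ℕ) : ℕ → H := fun k =>
  ∑ q ∈ range (h + 1), ((k.choose q : ℂ) * c ^ (k - q)) • y (h - q)

lemma jet_zero_right (c : ℂ) (y : ℕ → H) (h : ℕ) : jet c y h 0 = y h := by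
  simp [jet, sum_range_succ']

lemma shift_jet_zero (c : ℂ) (y : ℕ → H) : shift (jet c y 0) = c • jet c y 0 := by
  ext k
  simp [jet, pow_succ', mul_smul]

lemma shift_jet_succ (c : ℂ) (y : ℕ → H) (h : ℕ) :
    shift (jet c y (h + 1)) = c • jet c y (h + 1) + jet c y h := by
  ext k
  simp only [jet, shift_apply, Pi.add_apply, Pi.smul_apply]
  rw [sum_range_succ' _ (h + 1), sum_range_succ' _ (h + 1), smul_add, smul_sum, add_right_comm,
    ← sum_add_distrib]
  congr 1
  · refine sum_congr rfl fun q _ => ?_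
    rw [smul_smul, show h + 1 - (q + 1) = h - q by omega, ← add_smul]
    congr 1
    rw [Nat.choose_succ_succ, show k + 1 - (q + 1) = k - q by omega]
    rcases Nat.lt_or_ge k (q + 1) with hk | hk
    · simp [Nat.choose_eq_zero_of_lt hk]
    · rw [show k - q = k - (q + 1) + 1 by omega]
      push_cast
      ring
  · simp [smul_smul, pow_succ']

/-- The function `exp (c t) (y^h + t y^{h-1} / 1! + ⋯ + t^h y⁰ / h!)`. -/
noncomputable def expPoly (c : ℂ) (y : ℕ → H) (h : ℕ) (t : ℂ) : H :=
  Complex.exp (c * t) • ∑ q ∈ range (h + 1), (t ^ q / (q.factorial : ℂ)) • y (h - q)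

lemma expPoly_at_zero (c : ℂ) (y : ℕ → H) (h : ℕ) : expPoly c y h 0 = y h := by
  simp [expPoly, sum_range_succ']

lemma hasDerivAt_expPoly_zero (c : ℂ) (y : ℕ → H) (t : ℂ) :
    HasDerivAt (expPoly c y 0) (c • expPoly c y 0 t) t := by
  have := (((hasDerivAt_id t).const_mul c).cexp).smul_const (y 0)
  have e : expPoly c y 0 = fun t => Complex.exp (c * id t) • y 0 := by
    ext t; simp [expPoly]
  rw [e]
  refine this.congr_deriv ?_
  simp [smul_smul, mul_comm]

lemma hasDerivAt_expPoly_succ (c : ℂ) (y : ℕ → H) (h : ℕ) (t : ℂ) :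
    HasDerivAt (expPoly c y (h + 1)) (c • expPoly c y (h + 1) t + expPoly c y h t) t := by
  have h1 : HasDerivAt (fun t : ℂ => ∑ q ∈ range (h + 1 + 1),
      (t ^ q / (q.factorial : ℂ)) • y (h + 1 - q))
      (∑ q ∈ range (h + 1), (t ^ q / (q.factorial : ℂ)) • y (h - q)) t := by
    have h2 : HasDerivAt (fun t : ℂ => ∑ q ∈ range (h + 1 + 1),
      (t ^ q / (q.factorial : ℂ)) • y (h + 1 - q))
      (∑ q ∈ range (h + 1 + 1), ((q * t ^ (q - 1)) / (q.factorial : ℂ)) • y (h + 1 - q)) t := by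
      refine HasDerivAt.fun_sum fun q _ => ?_
      exact ((hasDerivAt_pow q t).div_const _).smul_const _
    refine h2.congr_deriv ?_
    rw [sum_range_succ']
    simp only [Nat.cast_zero, zero_mul, zero_div, zero_smul, add_zero]
    refine sum_congr rfl fun q _ => ?_
    rw [show h + 1 - (q + 1) = h - q by omega, Nat.factorial_succ]
    congr 1
    have : (q : ℂ) + 1 ≠ 0 := by exact_mod_cast Nat.succ_ne_zero q
    have : (q.factorial : ℂ) ≠ 0 := by exact_mod_cast q.factorial_ne_zero
    push_cast
    field_simp
  have h3 := (((hasDerivAt_id t).const_mul c).cexp).smul h1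
  refine h3.congr_deriv ?_
  rw [add_comm, mul_comm, mul_one, mul_smul]
  rfl

lemma contDiff_expPoly (c : ℂ) (y : ℕ → H) (h : ℕ) : ContDiff ℂ ⊤ (expPoly c y h) := by
  refine ContDiff.smul (by fun_prop) (ContDiff.sum fun q _ => ContDiff.smul ?_ contDiff_const)
  exact (contDiff_id.pow q).div_const _

lemma iteratedDeriv_expPoly (c : ℂ) (y : ℕ → H) (r : ℕ) : ∀ h,
    iteratedDeriv r (expPoly c y h) 0 = jet c y h r := by
  induction r with
  | zero => intro h; simp [jet_zero_right, expPoly_at_zero]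
  | succ r ih =>
    intro h
    rw [iteratedDeriv_succ']
    rcases h with _ | h
    · have : deriv (expPoly c y 0) = c • expPoly c y 0 := by
        ext t; exact (hasDerivAt_expPoly_zero c y t).deriv
      rw [this, iteratedDeriv_const_smul_field, ih, ← Pi.smul_apply, ← shift_jet_zero, shift_apply]
    · have : deriv (expPoly c y (h + 1)) = c • expPoly c y (h + 1) + expPoly c y h := by
        ext t; exact (hasDerivAt_expPoly_succ c y h t).deriv
      rw [this, iteratedDeriv_add, iteratedDeriv_const_smul_field, ih, ih,
        ← shift_apply (jet c y (h + 1)), shift_jet_succ]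
      · rfl
      · exact ((contDiff_expPoly _ _ _).const_smul c).contDiffAt.of_le le_top
      · exact (contDiff_expPoly _ _ _).contDiffAt.of_le le_top

lemma keldysh_apply (m : ℕ) (c : ℂ) (y : ℕ → H) (h : ℕ) (r : Fin m) :
    keldysh m c y h r = jet c y h r :=
  iteratedDeriv_expPoly c y r h

/-- The coefficients of a pencil of order `n`, extended by zero. -/
def coeffs {n : ℕ} (A : Fin (n + 1) → (H →L[ℂ] H)) (j : ℕ) : H →L[ℂ] H :=
  if h : j < n + 1 then A ⟨j, h⟩ else 0

lemma coeffs_fin {n : ℕ} (A : Fin (n + 1) → (H →L[ℂ] H)) (j : Fin (n + 1)) :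
    coeffs A j = A j := by rw [coeffs, dif_pos j.isLt]

lemma coeffs_of_lt {n : ℕ} (A : Fin (n + 1) → (H →L[ℂ] H)) {j : ℕ} (h : n < j) :
    coeffs A j = 0 := by simp [coeffs]; omega

lemma pencil_eq {n : ℕ} (A : Fin (n + 1) → (H →L[ℂ] H)) (μ : ℂ) :
    pencil A μ = ∑ j ∈ range (n + 1), μ ^ j • coeffs A j := by
  rw [pencil, sum_range]
  simp [coeffs_fin]

lemma iteratedDeriv_pencil {n : ℕ} (A : Fin (n + 1) → (H →L[ℂ] H)) (r : ℕ) (c : ℂ) :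
    (r.factorial : ℂ)⁻¹ • iteratedDeriv r (pencil A) c =
      ∑ j ∈ range (n + 1), ((j.choose r : ℂ) * c ^ (j - r)) • coeffs A j := by
  have h1 : ∀ c, iteratedDeriv r (pencil A) c =
      ∑ j ∈ range (n + 1), ((j.descFactorial r : ℂ) * c ^ (j - r)) • coeffs A j := by
    induction r with
    | zero => intro c; simp [pencil_eq]
    | succ r ih =>
      intro c
      rw [iteratedDeriv_succ, funext ih]
      have : HasDerivAt (fun c : ℂ => ∑ j ∈ range (n + 1),
          ((j.descFactorial r : ℂ) * c ^ (j - r)) • coeffs A j)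
          (∑ j ∈ range (n + 1), ((j.descFactorial r : ℂ) * (((j - r : ℕ) : ℂ) *
            c ^ (j - r - 1))) • coeffs A j) c := by
        refine HasDerivAt.fun_sum fun j _ => ?_
        exact ((hasDerivAt_pow (j - r) c).const_mul (j.descFactorial r : ℂ)).smul_const (coeffs A j)
      rw [this.deriv]
      refine sum_congr rfl fun j _ => ?_
      rw [Nat.descFactorial_succ, Nat.sub_sub]
      push_cast
      congr 1; ring
  rw [h1, smul_sum]
  refine sum_congr rfl fun j _ => ?_
  rw [smul_smul, Nat.descFactorial_eq_factorial_mul_choose]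
  have : (r.factorial : ℂ) ≠ 0 := by exact_mod_cast r.factorial_ne_zero
  congr 1
  push_cast
  field_simp

/-- The sequences `v` with `∑ⱼ Bⱼ v_{j + k} = 0` for all `k`. -/
def sol (n : ℕ) (B : ℕ → (H →L[ℂ] H)) : Submodule ℂ (ℕ → H) where
  carrier := {v | ∀ k, ∑ j ∈ range (n + 1), B j (v (j + k)) = 0}
  add_mem' {v w} hv hw k := by simp [sum_add_distrib, hv k, hw k]
  zero_mem' k := by simp
  smul_mem' a v hv k := by simp [← smul_sum, hv k]

lemma IsEAVChain.jet_mem_sol {n : ℕ} {A : Fin (n + 1) → (H →L[ℂ] H)} {c : ℂ} {p : ℕ} {y : ℕ → H}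
    (hy : IsEAVChain A c p y) {h : ℕ} (hh : h ≤ p) : jet c y h ∈ sol n (coeffs A) := by
  have key : ∀ h ≤ p, ∑ j ∈ range (n + 1), coeffs A j (jet c y h j) = 0 := by
    intro h hh
    rw [← hy.2 h hh]
    simp only [iteratedDeriv_pencil, jet, map_sum, _root_.sum_apply, _root_.smul_apply, map_smul]
    rw [sum_comm]
  intro k
  induction k generalizing h with
  | zero => exact key h hh
  | succ k ih =>
    have e : ∀ j, jet c y h (j + (k + 1)) = shift (jet c y h) (j + k) := fun j => rfl
    simp only [e]
    rcases h with _ | h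
    · simp only [shift_jet_zero, Pi.smul_apply, map_smul, ← smul_sum, ih hh, smul_zero]
    · simp only [shift_jet_succ, Pi.add_apply, Pi.smul_apply, map_add, map_smul, sum_add_distrib,
        ← smul_sum, ih hh, ih (Nat.le_of_succ_le hh), smul_zero, add_zero]

end Jets

section Forms

variable {H : Type*} [NormedAddCommGroup H] [InnerProductSpace ℂ H]

/-- The Heaviside function with value `1 / 2` at `0`. -/
noncomputable def heav (d : ℤ) : ℂ := if 0 < d then 1 else if d = 0 then 1 / 2 else 0

lemma heav_pos {d : ℤ} (h : 0 < d) : heav d = 1 := by simp [heav, h]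
lemma heav_neg {d : ℤ} (h : d < 0) : heav d = 0 := by simp [heav, h.not_gt, h.ne]
lemma heav_zero : heav 0 = 1 / 2 := by simp [heav]

lemma conj_heav (d : ℤ) : (starRingEnd ℂ) (heav d) = heav d := by
  unfold heav; split_ifs <;> simp [map_ofNat]

lemma heav_add_heav_neg (d : ℤ) : heav d + heav (-d) = 1 := by
  rcases lt_trichotomy d 0 with h | rfl | h
  · rw [heav_neg h, heav_pos (by omega)]; simp
  · norm_num [heav_zero]
  · rw [heav_pos h, heav_neg (by omega)]; simp

/-- The weights of the tridiagonal form: `1` at `0`, `1 / 2` at `±1`, and `0` elsewhere. -/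
noncomputable def tri (d : ℤ) : ℂ := heav (d + 1) - heav (d - 1)

lemma tri_zero : tri 0 = 1 := by simp [tri, heav]
lemma tri_one : tri 1 = 1 / 2 := by norm_num [tri, heav]
lemma tri_neg_one : tri (-1) = 1 / 2 := by norm_num [tri, heav]
lemma tri_of_one_lt {d : ℤ} (h : 1 < |d|) : tri d = 0 := by
  rcases lt_abs.1 h with h | h
  · simp [tri, heav_pos (show 0 < d + 1 by omega), heav_pos (show 0 < d - 1 by omega)]
  · simp [tri, heav_neg (show d + 1 < 0 by omega), heav_neg (show d - 1 < 0 by omega)]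

lemma conj_tri (d : ℤ) : (starRingEnd ℂ) (tri d) = tri d := by simp [tri, conj_heav]

lemma tri_neg (d : ℤ) : tri (-d) = tri d := by
  have h1 := heav_add_heav_neg (d + 1)
  have h2 := heav_add_heav_neg (d - 1)
  rw [show -(d + 1) = -d - 1 by ring] at h1
  rw [show -(d - 1) = -d + 1 by ring] at h2
  unfold tri
  linear_combination h2 - h1

/-- Summation by parts on the square `{0, …, M - 1}²`. -/
lemma sum_heav_mul_sub (M : ℕ) (g : ℕ → ℕ → ℂ) (hg : ∀ a b, M < a + b → g a b = 0) :
    ∑ a ∈ range M, ∑ b ∈ range M, heav (a - b) * (g (a + 1) b - g a (b + 1)) =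
      ∑ a ∈ range (M + 1), g a 0 -
        ∑ a ∈ range (M + 1), ∑ b ∈ range (M + 1), tri (a - b) * g a b := by
  have h1 : ∑ a ∈ range (M + 1), ∑ b ∈ range (M + 1), heav (a - b - 1) * g a b =
      ∑ a ∈ range M, ∑ b ∈ range M, heav (a - b) * g (a + 1) b := by
    rw [sum_range_succ']
    have : ∑ b ∈ range (M + 1), heav (((0 : ℕ) : ℤ) - b - 1) * g 0 b = 0 :=
      sum_eq_zero fun b _ => by rw [heav_neg (by push_cast; omega), zero_mul]
    rw [this, add_zero]
    refine sum_congr rfl fun a _ => ?_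
    rw [sum_range_succ, hg (a + 1) M (by omega), mul_zero, add_zero]
    refine sum_congr rfl fun b _ => ?_
    congr 2; push_cast; ring
  have h2 : ∑ a ∈ range (M + 1), ∑ b ∈ range (M + 1), heav (a - b + 1) * g a b =
      ∑ a ∈ range (M + 1), g a 0 +
        ∑ a ∈ range M, ∑ b ∈ range M, heav (a - b) * g a (b + 1) := by
    have h3 : ∀ a : ℕ, ∑ b ∈ range (M + 1), heav (a - b + 1) * g a b =
        g a 0 + ∑ b ∈ range M, heav (a - b) * g a (b + 1) := by
      intro a
      rw [sum_range_succ', heav_pos (by push_cast; omega), one_mul, add_comm]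
      congr 1
      refine sum_congr rfl fun b _ => ?_
      congr 2; push_cast; ring
    simp only [h3, sum_add_distrib]
    congr 1
    rw [sum_range_succ, add_eq_left]
    exact sum_eq_zero fun b _ => by rw [hg M (b + 1) (by omega), mul_zero]
  simp only [tri, sub_mul, sum_sub_distrib, mul_sub, h1, h2]
  ring

/-- The sesquilinear form on sequences with the matrix `κ` of order `M`. -/
noncomputable def wform (M : ℕ) (κ : ℕ → ℕ → (H →L[ℂ] H)) :
    (ℕ → H) →ₗ⋆[ℂ] (ℕ → H) →ₗ[ℂ] ℂ :=
  LinearMap.mk₂'ₛₗ (starRingEnd ℂ) (RingHom.id ℂ)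
    (fun w v => ∑ a ∈ range M, ∑ b ∈ range M, inner ℂ (w b) (κ a b (v a)))
    (fun w w' v => by simp [sum_add_distrib])
    (fun s w v => by simp [mul_sum, mul_comm])
    (fun w v v' => by simp [sum_add_distrib])
    (fun s w v => by simp [mul_sum])

lemma wform_apply (M : ℕ) (κ : ℕ → ℕ → (H →L[ℂ] H)) (w v : ℕ → H) :
    wform M κ w v = ∑ a ∈ range M, ∑ b ∈ range M, inner ℂ (w b) (κ a b (v a)) := rfl

variable [CompleteSpace H]

open ContinuousLinearMap (adjoint)

lemma conj_wform (M : ℕ) {κ : ℕ → ℕ → (H →L[ℂ] H)} (hκ : ∀ a b, adjoint (κ a b) = κ b a)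
    (w v : ℕ → H) : (starRingEnd ℂ) (wform M κ w v) = wform M κ v w := by
  simp only [wform_apply, map_sum, inner_conj_symm]
  rw [sum_comm]
  refine sum_congr rfl fun a _ => sum_congr rfl fun b _ => ?_
  rw [← ContinuousLinearMap.adjoint_inner_right, hκ]

/-- The boundary form of the pencil. -/
noncomputable def bform (M : ℕ) (B : ℕ → (H →L[ℂ] H)) : (ℕ → H) →ₗ⋆[ℂ] (ℕ → H) →ₗ[ℂ] ℂ :=
  wform M fun a b => heav (a - b) • B (a + b + 1) + heav (b - a) • adjoint (B (a + b + 1))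

/-- The dissipation form of the pencil. -/
noncomputable def dform (M : ℕ) (B : ℕ → (H →L[ℂ] H)) : (ℕ → H) →ₗ⋆[ℂ] (ℕ → H) →ₗ[ℂ] ℂ :=
  wform (M + 1) fun a b => tri (a - b) • (imaginaryPart (B (a + b)) : H →L[ℂ] H)

lemma conj_bform (M : ℕ) (B : ℕ → (H →L[ℂ] H)) (w v : ℕ → H) :
    (starRingEnd ℂ) (bform M B w v) = bform M B v w := by
  refine conj_wform M (fun a b => ?_) w v
  rw [map_add, LinearIsometryEquiv.map_smulₛₗ, LinearIsometryEquiv.map_smulₛₗ, conj_heav, conj_heav,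
    ContinuousLinearMap.adjoint_adjoint, add_comm b a]
  exact add_comm _ _

lemma conj_dform (M : ℕ) (B : ℕ → (H →L[ℂ] H)) (w v : ℕ → H) :
    (starRingEnd ℂ) (dform M B w v) = dform M B v w := by
  refine conj_wform (M + 1) (fun a b => ?_) w v
  rw [LinearIsometryEquiv.map_smulₛₗ, conj_tri, add_comm b a, ← tri_neg, neg_sub]
  congr 1
  exact (imaginaryPart (B (a + b))).2

lemma sub_adjoint_eq (T : H →L[ℂ] H) (x : H) :
    T x - adjoint T x = (2 * Complex.I) • (imaginaryPart T : H →L[ℂ] H) x := by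
  have : (imaginaryPart T : H →L[ℂ] H) x = -Complex.I • ((2 : ℝ)⁻¹ • (T x - adjoint T x)) := by
    rw [imaginaryPart_apply_coe]; rfl
  rw [this, smul_smul]
  have h2 : ∀ z : H, (2 : ℝ)⁻¹ • z = (2⁻¹ : ℂ) • z := by
    intro z; rw [← Complex.coe_smul]; norm_num
  rw [h2, smul_smul]
  have : 2 * Complex.I * -Complex.I * 2⁻¹ = 1 := by
    linear_combination -Complex.I_sq
  rw [this, one_smul]

lemma bform_shift_sub {M : ℕ} {B : ℕ → (H →L[ℂ] H)} (hB : ∀ j, M < j → B j = 0) {w v : ℕ → H}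
    (hw : w ∈ sol M B) (hv : v ∈ sol M B) :
    bform M B w (shift v) - bform M B (shift w) v = -(2 * Complex.I) * dform M B w v := by
  have h1 := sum_heav_mul_sub M (fun a b => inner ℂ (w b) (B (a + b) (v a)))
    (fun a b hab => by simp [hB _ hab])
  have h2 := sum_heav_mul_sub M (fun b a => inner ℂ (w b) (adjoint (B (a + b)) (v a)))
    (fun a b hab => by simp [hB (b + a) (by omega)])
  have e1 : ∑ a ∈ range (M + 1), inner ℂ (w 0) (B (a + 0) (v a)) = 0 := by
    rw [← inner_sum]
    have := hv 0
    simp only [add_zero] at this ⊢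
    rw [this, inner_zero_right]
  have e2 : ∑ a ∈ range (M + 1), inner ℂ (w a) (adjoint (B (0 + a)) (v 0)) = 0 := by
    simp only [ContinuousLinearMap.adjoint_inner_right, zero_add]
    rw [← sum_inner]
    have := hw 0
    simp only [add_zero] at this
    rw [this, inner_zero_left]
  rw [e1] at h1
  rw [e2] at h2
  rw [sum_comm, sum_comm (s := range (M + 1))] at h2
  have key : dform M B w v * (2 * Complex.I) =
      ∑ a ∈ range (M + 1), ∑ b ∈ range (M + 1), tri (a - b) * inner ℂ (w b) (B (a + b) (v a)) -
      ∑ a ∈ range (M + 1), ∑ b ∈ range (M + 1), tri (b - a) *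
        inner ℂ (w b) (adjoint (B (a + b)) (v a)) := by
    rw [dform, wform_apply, sum_mul, ← sum_sub_distrib]
    refine sum_congr rfl fun a _ => ?_
    rw [sum_mul, ← sum_sub_distrib]
    refine sum_congr rfl fun b _ => ?_
    rw [← tri_neg (b - a), neg_sub, ← mul_sub, ← inner_sub_right, sub_adjoint_eq, inner_smul_right,
      _root_.smul_apply, inner_smul_right]
    ring
  have e3 : bform M B w (shift v) - bform M B (shift w) v =
      ∑ a ∈ range M, ∑ b ∈ range M, heav (a - b) * (inner ℂ (w b) (B (a + 1 + b) (v (a + 1))) -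
        inner ℂ (w (b + 1)) (B (a + (b + 1)) (v a))) -
      ∑ a ∈ range M, ∑ b ∈ range M, heav (b - a) *
        (inner ℂ (w (b + 1)) (adjoint (B (a + (b + 1))) (v a)) -
          inner ℂ (w b) (adjoint (B (a + 1 + b)) (v (a + 1)))) := by
    rw [bform, wform_apply, wform_apply, ← sum_sub_distrib, ← sum_sub_distrib]
    refine sum_congr rfl fun a _ => ?_
    rw [← sum_sub_distrib, ← sum_sub_distrib]
    refine sum_congr rfl fun b _ => ?_
    simp only [_root_.add_apply, _root_.smul_apply, inner_add_right, inner_smul_right, shift_apply]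
    rw [show a + 1 + b = a + b + 1 by omega, show a + (b + 1) = a + b + 1 by omega]
    ring
  linear_combination e3 + h1 - h2 + key

/-- A hermitian form that is nonpositive on the diagonal vanishes on its isotropic vectors. -/
lemma eq_zero_of_isotropic {E : Type*} [AddCommGroup E] [Module ℂ E] {V : E →ₗ⋆[ℂ] E →ₗ[ℂ] ℂ}
    (hc : ∀ w v, (starRingEnd ℂ) (V w v) = V v w) (hV : ∀ v, (V v v).re ≤ 0) {v : E}
    (hv : V v v = 0) (w : E) : V w v = 0 := by
  set x := V w v with hx
  by_contra hne
  have hpos : 0 < Complex.normSq x := Complex.normSq_pos.2 hne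
  have key : ∀ t : ℝ, 2 * t * Complex.normSq x + t ^ 2 * Complex.normSq x * (V w w).re ≤ 0 := by
    intro t
    have h := hV (v + ((t : ℂ) * x) • w)
    have e : V (v + ((t : ℂ) * x) • w) (v + ((t : ℂ) * x) • w) =
        ((2 * t * Complex.normSq x : ℝ) : ℂ) + ((t ^ 2 * Complex.normSq x : ℝ) : ℂ) * V w w := by
      have e2 : V v w = (starRingEnd ℂ) x := by rw [hx, hc]
      simp only [map_add, LinearMap.add_apply, LinearMap.map_smulₛₗ, LinearMap.smul_apply, hv, e2,
        ← hx, smul_eq_mul, RingHom.id_apply, map_mul, Complex.conj_ofReal]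
      push_cast
      rw [Complex.normSq_eq_conj_mul_self]
      ring
    rw [e, Complex.add_re, Complex.re_ofReal_mul, Complex.ofReal_re] at h
    exact h
  have h1 := key (1 / (1 + |(V w w).re|))
  have ha : 0 < 1 + |(V w w).re| := by positivity
  set b := 1 + |(V w w).re| with hb
  have h2 : -b ≤ (V w w).re := by linarith [neg_abs_le (V w w).re]
  have h3 : 0 < 2 * (1 / b) * Complex.normSq x + (1 / b) ^ 2 * Complex.normSq x * (V w w).re := by
    have : (1 / b) ^ 2 * Complex.normSq x * (-b) ≤
        (1 / b) ^ 2 * Complex.normSq x * (V w w).re :=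
      mul_le_mul_of_nonneg_left h2 (by positivity)
    have e : (1 / b) ^ 2 * Complex.normSq x * (-b) = -(1 / b * Complex.normSq x) := by
      field_simp
    have : 0 < 1 / b * Complex.normSq x := by positivity
    linarith
  linarith

lemma dform_re_nonpos {l : ℕ} {A : Fin (2 * l + 1) → (H →L[ℂ] H)} (hV : IsLinearlyDissipative A)
    (v : ℕ → H) : (dform (2 * l) (coeffs A) v v).re ≤ 0 := by
  have h := hV (fun i => v i)
  have e : ∑ i : Fin (l + 1), ∑ j : Fin (l + 1), inner ℂ (v i) (V0 A i j (v j)) =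
      2 * dform (2 * l) (coeffs A) v v := by
    have e1 : dform (2 * l) (coeffs A) v v = ∑ a ∈ range (l + 1), ∑ b ∈ range (l + 1),
        inner ℂ (v b) ((tri (a - b) • (imaginaryPart (coeffs A (a + b)) : H →L[ℂ] H)) (v a)) := by
      have hz : ∀ a b : ℕ, l < a ∨ l < b → inner ℂ (v b)
          ((tri (a - b) • (imaginaryPart (coeffs A (a + b)) : H →L[ℂ] H)) (v a)) = 0 := by
        intro a b hab
        rcases Nat.lt_or_ge (2 * l) (a + b) with h | h
        · simp [coeffs_of_lt A h]
        · rw [tri_of_one_lt]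
          · simp
          · rw [lt_abs]; omega
      rw [dform, wform_apply]
      symm
      refine sum_subset_zero_on_sdiff (range_mono (by omega)) ?_ ?_
      · intro a ha
        simp only [Finset.mem_sdiff, mem_range, not_lt] at ha
        exact sum_eq_zero fun b _ => hz a b (Or.inl (by omega))
      · intro a _
        refine sum_subset_zero_on_sdiff (range_mono (by omega)) ?_ (fun _ _ => rfl)
        intro b hb
        simp only [Finset.mem_sdiff, mem_range, not_lt] at hb
        exact hz a b (Or.inr (by omega))
    rw [e1]
    conv_rhs => rw [sum_comm, sum_range, mul_sum]
    refine sum_congr rfl fun i _ => ?_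
    rw [sum_range, mul_sum]
    refine sum_congr rfl fun j _ => ?_
    have e2 : coeffs A ((j : ℕ) + i) = A ⟨(i : ℕ) + j, by omega⟩ := by
      rw [coeffs, dif_pos (by omega)]; congr 2; omega
    rw [e2, _root_.smul_apply, inner_smul_right]
    simp only [V0]
    split_ifs with h1 h2
    · subst h1; simp [tri_zero]
    · rcases h2 with h2 | h2
      · rw [show ((j : ℕ) : ℤ) - (i : ℕ) = 1 by omega, tri_one]; ring
      · rw [show ((j : ℕ) : ℤ) - (i : ℕ) = -1 by omega, tri_neg_one]; ring
    · rw [tri_of_one_lt]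
      · simp
      · rw [lt_abs]
        have : (i : ℕ) ≠ j := fun h => h1 (Fin.ext h)
        omega
  rw [e] at h
  simp only [Complex.mul_re, Complex.re_ofNat, Complex.im_ofNat, zero_mul, sub_zero] at h
  linarith

end Forms

section NullVectors

variable {H : Type*} [NormedAddCommGroup H] [InnerProductSpace ℂ H]

/-- `e` is a Jordan chain of the shift at `c`. -/
structure IsJordan (c : ℂ) (e : ℕ → ℕ → H) : Prop where
  zero : shift (e 0) = c • e 0
  succ : ∀ h, shift (e (h + 1)) = c • e (h + 1) + e h

lemma isJordan_jet (c : ℂ) (y : ℕ → H) : IsJordan c (jet c y) :=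
  ⟨shift_jet_zero c y, shift_jet_succ c y⟩

variable [CompleteSpace H] {M : ℕ} {B : ℕ → (H →L[ℂ] H)}

open ContinuousLinearMap (adjoint)

/-- The vectors in the kernel of the dissipation form. -/
def IsNull (M : ℕ) (B : ℕ → (H →L[ℂ] H)) (w : ℕ → H) : Prop := ∀ v, dform M B v w = 0

lemma bform_shift_eq (hB : ∀ j, M < j → B j = 0) {w v : ℕ → H} (hw : w ∈ sol M B)
    (hv : v ∈ sol M B) (hn : IsNull M B w) : bform M B w (shift v) = bform M B (shift w) v := by
  have h := bform_shift_sub hB hw hv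
  rw [← conj_dform, hn, map_zero, mul_zero] at h
  exact sub_eq_zero.1 h

lemma bform_eq_zero_of_add_lt (hB : ∀ j, M < j → B j = 0) {c : ℂ} (hc : c.im = 0)
    {e f : ℕ → ℕ → H} (he : IsJordan c e) (hf : IsJordan c f) {p : ℕ}
    (hes : ∀ i ≤ p, e i ∈ sol M B) {g : ℕ} (hfs : ∀ i ≤ g, f i ∈ sol M B)
    (hfn : ∀ i ≤ g, IsNull M B (f i)) {h : ℕ} (hp : h + g + 1 ≤ p) :
    bform M B (f g) (e h) = 0 := by
  have hcc : (starRingEnd ℂ) c = c := Complex.conj_eq_iff_im.2 hc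
  induction g generalizing h with
  | zero =>
    have h1 := bform_shift_eq hB (hfs 0 le_rfl) (hes (h + 1) (by omega)) (hfn 0 le_rfl)
    rw [he.succ, hf.zero] at h1
    simpa [hcc] using h1
  | succ g ih =>
    have h1 := bform_shift_eq hB (hfs (g + 1) le_rfl) (hes (h + 1) (by omega)) (hfn (g + 1) le_rfl)
    have h2 := ih (fun i hi => hfs i (by omega)) (fun i hi => hfn i (by omega))
      (h := h + 1) (by omega)
    rw [he.succ, hf.succ] at h1
    simpa [hcc, h2] using h1

lemma isNull_of_two_mul_le (hB : ∀ j, M < j → B j = 0) (hV : ∀ v, (dform M B v v).re ≤ 0) {c : ℂ}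
    (hc : c.im = 0) {e : ℕ → ℕ → H} (he : IsJordan c e) {p : ℕ} (hes : ∀ i ≤ p, e i ∈ sol M B)
    {h : ℕ} (hh : 2 * h ≤ p) : IsNull M B (e h) := by
  have hcc : (starRingEnd ℂ) c = c := Complex.conj_eq_iff_im.2 hc
  induction h using Nat.strong_induction_on with
  | _ h ih =>
    refine eq_zero_of_isotropic (conj_dform M B) hV ?_
    have h1 := bform_shift_sub hB (hes h (by omega)) (hes h (by omega))
    have h2 : bform M B (e h) (shift (e h)) - bform M B (shift (e h)) (e h) = 0 := by
      rcases h with _ | h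
      · rw [he.zero]; simp [hcc]
      · have h3 : bform M B (e h) (e (h + 1)) = 0 :=
          bform_eq_zero_of_add_lt hB hc he he hes (fun i hi => hes i (by omega))
            (fun i hi => ih i (by omega) (by omega)) (by omega)
        have h4 : bform M B (e (h + 1)) (e h) = 0 := by rw [← conj_bform, h3, map_zero]
        rw [he.succ]; simp [hcc, h3, h4]
    rw [h2] at h1
    simpa using h1.symm

lemma bform_eq_zero_of_ne (hB : ∀ j, M < j → B j = 0) {c c' : ℂ} (hc : c.im = 0) (hne : c' ≠ c)
    {e f : ℕ → ℕ → H} (he : IsJordan c' e) (hf : IsJordan c f) {h g : ℕ}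
    (hes : ∀ i ≤ h, e i ∈ sol M B) (hfs : ∀ i ≤ g, f i ∈ sol M B)
    (hfn : ∀ i ≤ g, IsNull M B (f i)) : bform M B (f g) (e h) = 0 := by
  have hcc : (starRingEnd ℂ) c = c := Complex.conj_eq_iff_im.2 hc
  have key : ∀ x : ℂ, c' * x = c * x → x = 0 := by
    intro x hx
    rw [← sub_eq_zero, ← sub_mul] at hx
    exact (mul_eq_zero.1 hx).resolve_left (sub_ne_zero.2 hne)
  induction g generalizing h with
  | zero =>
    induction h with
    | zero =>
      have h1 := bform_shift_eq hB (hfs 0 le_rfl) (hes 0 le_rfl) (hfn 0 le_rfl)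
      rw [he.zero, hf.zero] at h1
      exact key _ (by simpa [hcc] using h1)
    | succ h ih =>
      have h1 := bform_shift_eq hB (hfs 0 le_rfl) (hes (h + 1) le_rfl) (hfn 0 le_rfl)
      have h2 := ih (fun i hi => hes i (by omega))
      rw [he.succ, hf.zero] at h1
      exact key _ (by simpa [hcc, h2] using h1)
  | succ g ihg =>
    have h2 := @ihg h hes (fun i hi => hfs i (by omega)) (fun i hi => hfn i (by omega))
    induction h with
    | zero =>
      have h1 := bform_shift_eq hB (hfs (g + 1) le_rfl) (hes 0 le_rfl) (hfn (g + 1) le_rfl)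
      rw [he.zero, hf.succ] at h1
      exact key _ (by simpa [hcc, h2] using h1)
    | succ h ih =>
      have h1 := bform_shift_eq hB (hfs (g + 1) le_rfl) (hes (h + 1) le_rfl) (hfn (g + 1) le_rfl)
      have h3 := ih (fun i hi => hes i (by omega)) (@ihg h (fun i hi => hes i (by omega))
        (fun i hi => hfs i (by omega)) (fun i hi => hfn i (by omega)))
      rw [he.succ, hf.succ] at h1
      exact key _ (by simpa [hcc, h2, h3] using h1)

lemma isNull_add {w w' : ℕ → H} (h : IsNull M B w) (h' : IsNull M B w') : IsNull M B (w + w') :=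
  fun v => by rw [map_add, h, h', add_zero]

lemma isNull_smul {w : ℕ → H} (s : ℂ) (h : IsNull M B w) : IsNull M B (s • w) :=
  fun v => by rw [map_smul, h, smul_zero]

lemma isNull_shift_pow {c : ℂ} {e : ℕ → ℕ → H} (he : IsJordan c e) (k : ℕ) {h : ℕ}
    (hn : ∀ i ≤ h, IsNull M B (e i)) : IsNull M B ((shift ^ k) (e h)) := by
  induction k generalizing h with
  | zero => exact hn h le_rfl
  | succ k ih =>
    rw [pow_succ, Module.End.mul_apply]
    rcases h with _ | h
    · rw [he.zero, map_smul]; exact isNull_smul _ (ih hn)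
    · rw [he.succ, map_add, map_smul]
      exact isNull_add (isNull_smul _ (ih hn)) (ih fun i hi => hn i (by omega))

/-- The pairing of the solutions for a pencil with the solutions for the adjoint pencil. -/
noncomputable def pairing (M : ℕ) (B : ℕ → (H →L[ℂ] H)) : (ℕ → H) →ₗ⋆[ℂ] (ℕ → H) →ₗ[ℂ] ℂ :=
  wform M fun a b => B (a + b + 1)

lemma dform_single (a : ℕ) (ha : a ≤ M) (w : ℕ → H) (x : H) :
    dform M B w (Pi.single a x) = ∑ b ∈ range (M + 1), tri (b - a) *
      inner ℂ (w b) ((imaginaryPart (B (a + b)) : H →L[ℂ] H) x) := by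
  rw [dform, wform_apply, sum_eq_single a]
  · refine sum_congr rfl fun b _ => ?_
    rw [Pi.single_eq_same, _root_.smul_apply, inner_smul_right, ← tri_neg, neg_sub]
  · intro b _ hb
    simp [Pi.single_eq_of_ne hb]
  · intro h; simp at h; omega

lemma sum_heav_imaginaryPart_eq_zero (hB : ∀ j, M < j → B j = 0) {w : ℕ → H}
    (hn : ∀ k, IsNull M B ((shift ^ k) w)) (a : ℕ) (x : H) :
    ∑ b ∈ range M, heav (b - a) *
      inner ℂ (w b) ((imaginaryPart (B (a + b + 1)) : H →L[ℂ] H) x) = 0 := by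
  obtain ⟨d, hd⟩ : ∃ d, M ≤ a + d := ⟨M, by omega⟩
  induction d generalizing a w with
  | zero =>
    refine sum_eq_zero fun b _ => ?_
    rw [hB _ (by omega)]; simp
  | succ d ih =>
    rcases Nat.lt_or_ge a M with ha | ha
    swap
    · exact ih hn a (by omega)
    have h1 := dform_single (M := M) (B := B) (a + 1) ha w x
    rw [← conj_dform, show w = (shift ^ 0) w from rfl, hn, map_zero] at h1
    have h2 := ih (w := shift w) (fun k => by
      rw [← Module.End.mul_apply, ← pow_succ]; exact hn (k + 1)) (a + 1) (by omega)
    have h3 : ∑ b ∈ range (M + 1), heav (b - a - 2) *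
        inner ℂ (w b) ((imaginaryPart (B (a + b + 1)) : H →L[ℂ] H) x) = 0 := by
      rw [sum_range_succ', heav_neg (by push_cast; omega), zero_mul, add_zero, ← h2]
      refine sum_congr rfl fun b _ => ?_
      rw [shift_apply, show a + (b + 1) + 1 = a + 1 + b + 1 by omega]
      congr 2; push_cast; ring
    have h4 : ∑ b ∈ range (M + 1), heav (b - a) *
        inner ℂ (w b) ((imaginaryPart (B (a + b + 1)) : H →L[ℂ] H) x) = 0 := by
      have : ∑ b ∈ range (M + 1), heav (b - a) *
          inner ℂ (w b) ((imaginaryPart (B (a + b + 1)) : H →L[ℂ] H) x) =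
          ∑ b ∈ range (M + 1), tri (b - (a + 1 : ℕ)) *
            inner ℂ (w b) ((imaginaryPart (B (a + 1 + b)) : H →L[ℂ] H) x) +
          ∑ b ∈ range (M + 1), heav (b - a - 2) *
            inner ℂ (w b) ((imaginaryPart (B (a + b + 1)) : H →L[ℂ] H) x) := by
        rw [← sum_add_distrib]
        refine sum_congr rfl fun b _ => ?_
        rw [show a + 1 + b = a + b + 1 by omega, ← add_mul, tri]
        congr 1
        rw [show (b : ℤ) - (a + 1 : ℕ) + 1 = b - a by push_cast; ring,
          show (b : ℤ) - (a + 1 : ℕ) - 1 = b - a - 2 by push_cast; ring]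
        ring
      rw [this, h3, add_zero]
      exact h1.symm
    rw [sum_range_succ, hB (a + M + 1) (by omega)] at h4
    simpa using h4

lemma bform_eq_pairing (hB : ∀ j, M < j → B j = 0) {w : ℕ → H}
    (hn : ∀ k, IsNull M B ((shift ^ k) w)) (v : ℕ → H) : bform M B w v = pairing M B w v := by
  rw [bform, pairing, wform_apply, wform_apply]
  refine sum_congr rfl fun a _ => ?_
  have h := sum_heav_imaginaryPart_eq_zero hB hn a (v a)
  rw [← sub_eq_zero, ← sum_sub_distrib]
  have : ∀ b : ℕ, inner ℂ (w b) ((heav (a - b) • B (a + b + 1) +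
      heav (b - a) • adjoint (B (a + b + 1))) (v a)) - inner ℂ (w b) (B (a + b + 1) (v a)) =
      -(2 * Complex.I) * (heav (b - a) *
        inner ℂ (w b) ((imaginaryPart (B (a + b + 1)) : H →L[ℂ] H) (v a))) := by
    intro b
    have h1 := heav_add_heav_neg ((b : ℤ) - a)
    rw [neg_sub] at h1
    have h2 := congrArg (inner ℂ (w b)) (sub_adjoint_eq (B (a + b + 1)) (v a))
    rw [inner_sub_right, inner_smul_right] at h2
    simp only [_root_.add_apply, _root_.smul_apply, inner_add_right, inner_smul_right]
    linear_combination (inner ℂ (w b) (B (a + b + 1) (v a))) * h1 - heav (b - a) * h2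
  simp only [this]
  rw [← mul_sum, h, mul_zero]

end NullVectors

section Decay

variable {H : Type*} [NormedAddCommGroup H] [InnerProductSpace ℂ H]

lemma expPoly_shift {c : ℂ} {e : ℕ → ℕ → H} (he : IsJordan c e) (h : ℕ) (t : ℂ) (k : ℕ) :
    HasDerivAt (expPoly c (fun i => e i k) h) (expPoly c (fun i => e i (k + 1)) h t) t := by
  rcases h with _ | h
  · refine (hasDerivAt_expPoly_zero c _ t).congr_deriv ?_
    have := congrFun he.zero k
    rw [shift_apply, Pi.smul_apply] at this
    simp [expPoly, this, smul_smul, mul_comm]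
  · refine (hasDerivAt_expPoly_succ c _ h t).congr_deriv ?_
    have h0 := congrFun he.zero k
    have h1 := fun i => congrFun (he.succ i) k
    simp only [shift_apply, Pi.smul_apply, Pi.add_apply] at h0 h1
    have e1 : ∑ q ∈ range (h + 1 + 1), (t ^ q / (q.factorial : ℂ)) • e (h + 1 - q) (k + 1) =
        c • ∑ q ∈ range (h + 1 + 1), (t ^ q / (q.factorial : ℂ)) • e (h + 1 - q) k +
        ∑ q ∈ range (h + 1), (t ^ q / (q.factorial : ℂ)) • e (h - q) k := by
      rw [sum_range_succ, sum_range_succ _ (h + 1), smul_add, smul_sum, add_right_comm,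
        ← sum_add_distrib]
      congr 1
      · refine sum_congr rfl fun q hq => ?_
        rw [mem_range] at hq
        rw [show h + 1 - q = h - q + 1 by omega, h1, smul_add, smul_smul, smul_smul, mul_comm c]
      · rw [Nat.sub_self, h0, smul_smul, smul_smul, mul_comm c]
    simp only [expPoly]
    rw [e1, smul_add, smul_smul, smul_smul, mul_comm c]

/-- The vector `v` is the initial value of a path in `Z` that tends to zero at infinity and moves
along the flow `exp (i σ t S)` of the shift `S`. -/
def Decays (σ : ℝ) (Z : Submodule ℂ (ℕ → H)) (v : ℕ → H) : Prop :=
  ∃ w : ℝ → ℕ → H, w 0 = v ∧ (∀ t, w t ∈ Z) ∧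
    (∀ k t, HasDerivAt (fun s => w s k) ((σ * Complex.I) • w t (k + 1)) t) ∧
    ∀ k, Tendsto (fun t => w t k) atTop (𝓝 0)

/-- The submodule of the initial values of decaying paths. -/
def decaying (σ : ℝ) (Z : Submodule ℂ (ℕ → H)) : Submodule ℂ (ℕ → H) where
  carrier := {v | Decays σ Z v}
  zero_mem' := ⟨fun _ => 0, rfl, fun _ => Z.zero_mem, fun k t => by
    simpa using hasDerivAt_const t (0 : H), fun k => tendsto_const_nhds⟩
  add_mem' := by
    rintro _ _ ⟨w, rfl, hw, hd, ht⟩ ⟨w', rfl, hw', hd', ht'⟩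
    refine ⟨fun t => w t + w' t, rfl, fun t => Z.add_mem (hw t) (hw' t), fun k t => ?_, fun k => ?_⟩
    · refine ((hd k t).add (hd' k t)).congr_deriv ?_
      simp
    · simpa using (ht k).add (ht' k)
  smul_mem' := by
    rintro s _ ⟨w, rfl, hw, hd, ht⟩
    refine ⟨fun t => s • w t, rfl, fun t => Z.smul_mem _ (hw t), fun k t => ?_, fun k => ?_⟩
    · refine ((hd k t).const_smul s).congr_deriv ?_
      simp only [Pi.smul_apply]
      rw [smul_comm]
    · simpa using (ht k).const_smul s

lemma tendsto_exp_mul_pow {z : ℂ} (hz : z.re < 0) (a : ℂ) (q : ℕ) :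
    Tendsto (fun t : ℝ => Complex.exp (z * t) * (a * t) ^ q) atTop (𝓝 0) := by
  rw [tendsto_zero_iff_norm_tendsto_zero]
  have h := (Real.tendsto_pow_mul_exp_neg_atTop_nhds_zero q).comp
    (tendsto_id.const_mul_atTop (neg_pos.2 hz))
  have h2 := h.const_mul ((‖a‖ / (-z.re)) ^ q)
  rw [mul_zero] at h2
  refine h2.congr' ?_
  filter_upwards [eventually_ge_atTop 0] with t ht
  simp only [Function.comp, id, norm_mul, norm_pow, Complex.norm_exp, Complex.mul_re,
    Complex.ofReal_re, Complex.ofReal_im, mul_zero, sub_zero, Complex.norm_real, Real.norm_eq_abs,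
    abs_of_nonneg ht, neg_mul, neg_neg]
  have : -z.re ≠ 0 := (neg_pos.2 hz).ne'
  rw [← neg_mul, mul_pow (-z.re), mul_pow ‖a‖, div_pow]
  field_simp

lemma IsJordan.mem_decaying {c : ℂ} {e : ℕ → ℕ → H} (he : IsJordan c e) {σ : ℝ}
    (hσ : 0 < σ * c.im) {Z : Submodule ℂ (ℕ → H)} {h : ℕ} (hZ : ∀ i ≤ h, e i ∈ Z) :
    e h ∈ decaying σ Z := by
  refine ⟨fun t k => expPoly c (fun i => e i k) h (σ * Complex.I * t), ?_, ?_, ?_, ?_⟩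
  · ext k; simp [expPoly_at_zero]
  · intro t
    have : (fun k => expPoly c (fun i => e i k) h (σ * Complex.I * t)) =
        Complex.exp (c * (σ * Complex.I * t)) • ∑ q ∈ range (h + 1),
          ((σ * Complex.I * t) ^ q / (q.factorial : ℂ)) • e (h - q) := by
      ext k; simp [expPoly]
    beta_reduce
    rw [this]
    exact Z.smul_mem _ (Z.sum_mem fun q _ => Z.smul_mem _ (hZ _ (Nat.sub_le _ _)))
  · intro k t
    have h1 : HasDerivAt (fun t : ℝ => (σ * Complex.I * t : ℂ)) (σ * Complex.I) t := by
      simpa using (Complex.ofRealCLM.hasDerivAt (x := t)).const_mul (σ * Complex.I)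
    exact (expPoly_shift he h (σ * Complex.I * t) k).scomp t h1
  · intro k
    have h1 : ∀ q ∈ range (h + 1), Tendsto (fun t : ℝ => (Complex.exp (c * (σ * Complex.I) * t) *
        (σ * Complex.I * t) ^ q) • ((q.factorial : ℂ)⁻¹ • e (h - q) k)) atTop (𝓝 0) := by
      intro q _
      have := (tendsto_exp_mul_pow (z := c * (σ * Complex.I))
        (by simp; linarith) (σ * Complex.I) q).smul_const ((q.factorial : ℂ)⁻¹ • e (h - q) k)
      simpa using this
    have h2 := tendsto_finsetSum _ h1
    rw [sum_const_zero] at h2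
    refine h2.congr fun t => ?_
    simp only [expPoly, smul_sum, smul_smul, div_eq_mul_inv]
    refine sum_congr rfl fun q _ => ?_
    congr 1; ring_nf

lemma hasDerivAt_wform (M : ℕ) (κ : ℕ → ℕ → (H →L[ℂ] H)) {w w' : ℝ → ℕ → H} {t : ℝ}
    (hw : ∀ k, HasDerivAt (fun s => w s k) (w' t k) t) :
    HasDerivAt (fun s => wform M κ (w s) (w s)) (wform M κ (w t) (w' t) + wform M κ (w' t) (w t))
      t := by
  simp only [wform_apply]
  rw [← sum_add_distrib]
  refine HasDerivAt.fun_sum fun a _ => ?_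
  rw [← sum_add_distrib]
  refine HasDerivAt.fun_sum fun b _ => ?_
  exact (hw b).inner ℂ (((κ a b).restrictScalars ℝ).hasFDerivAt.comp_hasDerivAt t (hw a))

lemma tendsto_wform (M : ℕ) (κ : ℕ → ℕ → (H →L[ℂ] H)) {w : ℝ → ℕ → H} {f : Filter ℝ}
    (hw : ∀ k, Tendsto (fun s => w s k) f (𝓝 0)) :
    Tendsto (fun s => wform M κ (w s) (w s)) f (𝓝 0) := by
  simp only [wform_apply]
  have : ∀ a ∈ range M, Tendsto (fun s => ∑ b ∈ range M, inner ℂ (w s b) (κ a b (w s a))) f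
      (𝓝 0) := by
    intro a _
    have : ∀ b ∈ range M, Tendsto (fun s => inner ℂ (w s b) (κ a b (w s a))) f (𝓝 0) := by
      intro b _
      simpa using (hw b).inner (𝕜 := ℂ) (((κ a b).continuous.tendsto 0).comp (hw a))
    simpa using tendsto_finsetSum _ this
  simpa using tendsto_finsetSum _ this

variable [CompleteSpace H] {M : ℕ} {B : ℕ → (H →L[ℂ] H)}

lemma bform_nonneg_of_decaying (hB : ∀ j, M < j → B j = 0)
    (hV : ∀ v, (dform M B v v).re ≤ 0) {σ : ℝ} {v : ℕ → H}
    (hv : v ∈ decaying σ (sol M B)) : 0 ≤ σ * (bform M B v v).re := by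
  have key : ∀ v ∈ sol M B, bform M B v ((σ * Complex.I) • shift v) +
      bform M B ((σ * Complex.I) • shift v) v = ((2 * σ : ℝ) : ℂ) * dform M B v v := by
    intro v hv
    have h := bform_shift_sub hB hv hv
    simp only [map_smul, LinearMap.map_smulₛₗ, LinearMap.smul_apply, map_mul, Complex.conj_ofReal,
      Complex.conj_I, smul_eq_mul]
    push_cast
    linear_combination (σ * Complex.I) * h - 2 * σ * dform M B v v * Complex.I_sq
  obtain ⟨w, rfl, hw, hd, ht⟩ := hv
  have hre : ∀ (t : ℝ), HasDerivAt (fun s => σ * (bform M B (w s) (w s)).re)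
      (σ * (2 * σ * (dform M B (w t) (w t)).re)) t := by
    intro t
    have := hasDerivAt_wform M (fun a b => heav (a - b) • B (a + b + 1) +
      heav (b - a) • ContinuousLinearMap.adjoint (B (a + b + 1))) (w := w)
      (w' := fun t => (σ * Complex.I) • shift (w t)) (t := t) (fun k => hd k t)
    have h2 := (Complex.reCLM.hasFDerivAt.comp_hasDerivAt t this).const_mul σ
    refine h2.congr_deriv ?_
    rw [Complex.reCLM_apply]
    erw [key _ (hw t)]
    rw [Complex.re_ofReal_mul]
  have hanti : Antitone fun s => σ * (bform M B (w s) (w s)).re := by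
    refine antitone_of_deriv_nonpos (fun t => (hre t).differentiableAt) fun t => ?_
    rw [(hre t).deriv]
    nlinarith [hV (w t), mul_self_nonneg σ]
  refine hanti.le_of_tendsto ?_ 0
  have h1 := (Complex.continuous_re.tendsto 0).comp (tendsto_wform M (fun a b =>
    heav (a - b) • B (a + b + 1) +
      heav (b - a) • ContinuousLinearMap.adjoint (B (a + b + 1))) ht)
  have h2 := h1.const_mul σ
  rw [Complex.zero_re, mul_zero] at h2
  exact h2

end Decay

section NumericalRange

variable {H : Type*} [NormedAddCommGroup H] [InnerProductSpace ℂ H]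

open ComplexConjugate in
/-- The Toeplitz–Hausdorff theorem. -/
lemma convex_numericalRange (T : H →L[ℂ] H) : Convex ℝ (numericalRange T) := by
  rw [convex_iff_segment_subset]
  rintro p ⟨u, hu, hp⟩ q ⟨v, hv, hq⟩
  rw [segment_eq_image']
  rintro _ ⟨s, hs, rfl⟩
  rcases eq_or_ne p q with rfl | hpq
  · exact ⟨u, hu, by simpa using hp⟩
  have hqp : q - p ≠ 0 := sub_ne_zero.2 hpq.symm
  set f : H → H → ℂ := fun x y => (inner ℂ x (T y) - p * inner ℂ x y) / (q - p) with hf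
  obtain ⟨α, hα, him⟩ : ∃ α : ℂ, conj α * α = 1 ∧ (conj α * f u v + α * f v u).im = 0 := by
    set d := f v u - conj (f u v) with hd
    have key : ∀ α : ℂ, (α * d).im = 0 → (conj α * f u v + α * f v u).im = 0 := by
      intro α h
      rw [hd] at h
      simp only [Complex.mul_im, Complex.sub_im, Complex.sub_re, Complex.conj_im,
        Complex.conj_re, Complex.add_im] at h ⊢
      linarith
    rcases eq_or_ne d 0 with h0 | h0
    · exact ⟨1, by simp, key 1 (by simp [h0])⟩
    · have hn : (‖d‖ : ℂ) ≠ 0 := by simpa using h0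
      have hdd : conj d * d = (‖d‖ : ℂ) ^ 2 := by rw [mul_comm, Complex.mul_conj']
      refine ⟨conj d / ‖d‖, ?_, key _ ?_⟩
      · simp only [map_div₀, Complex.conj_conj, Complex.conj_ofReal]
        field_simp
        rw [mul_comm, hdd]
      · rw [div_mul_eq_mul_div, hdd, sq, mul_div_assoc, div_self hn, mul_one, Complex.ofReal_im]
  obtain ⟨r, hr⟩ : ∃ r : ℝ, conj α * f u v + α * f v u = r :=
    ⟨_, (Complex.ext rfl (by simpa using him))⟩
  set w : ℝ → H := fun t => ((1 - t : ℝ) : ℂ) • α • u + (t : ℂ) • v with hw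
  have huu : inner ℂ u u = 1 := by rw [inner_self_eq_norm_sq_to_K, hu]; simp
  have hvv : inner ℂ v v = 1 := by rw [inner_self_eq_norm_sq_to_K, hv]; simp
  have hfw : ∀ t, f (w t) (w t) = ((t ^ 2 + t * (1 - t) * r : ℝ) : ℂ) := by
    intro t
    have e : f (w t) (w t) = (1 - t : ℝ) ^ 2 * (conj α * α) * f u u + t ^ 2 * f v v +
        t * (1 - t : ℝ) * (conj α * f u v + α * f v u) := by
      simp only [hw, hf, map_add, map_smul, inner_add_left, inner_add_right, inner_smul_left,
        inner_smul_right, Complex.conj_ofReal]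
      ring
    have e1 : f u u = 0 := by simp only [hf, ← hp, huu]; simp
    have e2 : f v v = 1 := by simp only [hf, ← hq, hvv, mul_one, div_self hqp]
    rw [e, e1, e2, hr]
    push_cast
    ring
  have hα1 : ‖α‖ = 1 := by
    have : ‖conj α * α‖ = 1 := by rw [hα]; simp
    rw [norm_mul, RCLike.norm_conj] at this
    nlinarith [norm_nonneg α]
  have hw0 : ∀ t, w t ≠ 0 := by
    intro t h
    rcases eq_or_ne t 0 with rfl | ht
    · have h2 : ‖w 0‖ = 1 := by simp [hw, norm_smul, hα1, hu]
      rw [h] at h2; simp at h2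
    · have htc : (t : ℂ) ≠ 0 := by exact_mod_cast ht
      obtain ⟨β, hβ⟩ : ∃ β : ℂ, v = β • u := by
        refine ⟨-((t : ℂ)⁻¹ * ((1 - t : ℝ) * α)), ?_⟩
        have : (t : ℂ) • v = -(((1 - t : ℝ) : ℂ) • α • u) := by
          rw [eq_neg_iff_add_eq_zero, add_comm]; exact h
        rw [neg_smul, mul_smul, mul_smul, ← smul_neg, ← this, smul_smul, inv_mul_cancel₀ htc,
          one_smul]
      have hb : conj β * β = 1 := by
        have := hvv
        rw [hβ, inner_smul_left, inner_smul_right, huu] at this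
        simpa using this
      apply hpq
      rw [hq, hβ, map_smul, inner_smul_left, inner_smul_right, ← mul_assoc, hb, one_mul, hp]
  have hwc : Continuous w := by
    simp only [hw]; fun_prop
  have hφ : Continuous fun t : ℝ => (t ^ 2 + t * (1 - t) * r) / ‖w t‖ ^ 2 := by
    refine Continuous.div (by fun_prop) (by fun_prop) fun t => ?_
    exact pow_ne_zero _ (norm_ne_zero_iff.2 (hw0 t))
  have hiv := intermediate_value_Icc zero_le_one hφ.continuousOn
  have hw1 : w 1 = v := by simp [hw]
  obtain ⟨t, _, ht⟩ := hiv (show s ∈ _ by simpa [hw1, hv] using hs)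
  have hn : (‖w t‖ : ℂ) ≠ 0 := by simpa using hw0 t
  refine ⟨((‖w t‖⁻¹ : ℝ) : ℂ) • w t, ?_, ?_⟩
  · rw [norm_smul, Complex.norm_real, norm_inv, norm_norm, inv_mul_cancel₀]
    exact norm_ne_zero_iff.2 (hw0 t)
  · have h1 : inner ℂ (w t) (T (w t)) = p * ‖w t‖ ^ 2 + (q - p) * (s * ‖w t‖ ^ 2) := by
      have h2 : (inner ℂ (w t) (T (w t)) - p * inner ℂ (w t) (w t)) / (q - p) =
        ((t ^ 2 + t * (1 - t) * r : ℝ) : ℂ) := hfw t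
      rw [div_eq_iff hqp, inner_self_eq_norm_sq_to_K] at h2
      have h3 : t ^ 2 + t * (1 - t) * r = s * ‖w t‖ ^ 2 := by
        rw [← ht]; field_simp [norm_ne_zero_iff.2 (hw0 t)]
      rw [h3] at h2
      push_cast at h2
      have h4 : ((‖w t‖ : ℝ) : ℂ) = RCLike.ofReal ‖w t‖ := rfl
      rw [← h4] at h2
      linear_combination h2
    rw [map_smul, inner_smul_left, inner_smul_right, h1, Complex.conj_ofReal]
    push_cast
    field_simp
    rw [Complex.real_smul]
    ring

open ComplexConjugate in
/-- An operator with nonpositive imaginary part whose numerical range has a positive distance from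
`0` becomes uniformly accretive after a rotation by an angle from `[0, π]`. -/
lemma exists_rotation_accretive (T : H →L[ℂ] H) (hT : ∀ u, (inner ℂ u (T u)).im ≤ 0)
    (h0 : (0 : ℂ) ∉ closure (numericalRange T)) :
    ∃ θ : ℝ, 0 ≤ θ ∧ θ ≤ Real.pi ∧ ∃ δ : ℝ, 0 < δ ∧
      ∀ u, δ * ‖u‖ ^ 2 ≤ (Complex.exp (θ * Complex.I) * inner ℂ u (T u)).re := by
  rcases subsingleton_or_nontrivial H with hH | hH
  · exact ⟨0, le_rfl, Real.pi_pos.le, 1, one_pos, fun u => by simp [Subsingleton.elim u 0]⟩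
  obtain ⟨u₀, hu₀⟩ := exists_norm_eq H (zero_le_one' ℝ)
  have hne : (closure (numericalRange T)).Nonempty :=
    ⟨_, subset_closure ⟨u₀, hu₀, rfl⟩⟩
  have hcv : Convex ℝ (closure (numericalRange T)) := (convex_numericalRange T).closure
  obtain ⟨a, ha, hmin⟩ := exists_norm_eq_iInf_of_complete_convex hne
    isClosed_closure.isComplete hcv 0
  have hinner := (norm_eq_iInf_iff_real_inner_le_zero hcv ha).1 hmin
  have ha0 : a ≠ 0 := fun h => h0 (h ▸ ha)
  have him : a.im ≤ 0 := by
    have : closure (numericalRange T) ⊆ {z : ℂ | z.im ≤ 0} := by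
      refine closure_minimal ?_ (isClosed_le Complex.continuous_im continuous_const)
      rintro _ ⟨u, _, rfl⟩
      exact hT u
    exact this ha
  have hna : 0 < ‖a‖ := norm_pos_iff.2 ha0
  refine ⟨(conj a).arg, ?_, Complex.arg_le_pi _, ‖a‖, hna, fun u => ?_⟩
  · rw [Complex.arg_nonneg_iff]; simpa using him
  have hexp : (‖a‖ : ℂ) * Complex.exp ((conj a).arg * Complex.I) = conj a := by
    have := Complex.norm_mul_exp_arg_mul_I (conj a)
    rwa [RCLike.norm_conj] at this
  rcases eq_or_ne u 0 with rfl | hu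
  · simp
  have hnu : 0 < ‖u‖ := norm_pos_iff.2 hu
  have hmem : inner ℂ (((‖u‖⁻¹ : ℝ) : ℂ) • u) (T (((‖u‖⁻¹ : ℝ) : ℂ) • u)) ∈
      closure (numericalRange T) := by
    refine subset_closure ⟨_, ?_, rfl⟩
    rw [norm_smul, Complex.norm_real, norm_inv, norm_norm, inv_mul_cancel₀ hnu.ne']
  have h1 := hinner _ hmem
  rw [map_smul, inner_smul_left, inner_smul_right, Complex.conj_ofReal, ← mul_assoc,
    ← Complex.ofReal_mul] at h1
  have h2 : ‖a‖ ^ 2 ≤ (‖u‖⁻¹ * ‖u‖⁻¹) * (conj a * inner ℂ u (T u)).re := by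
    rw [zero_sub, inner_neg_left, inner_sub_right, real_inner_self_eq_norm_sq, Complex.inner] at h1
    have : (conj a * (((‖u‖⁻¹ * ‖u‖⁻¹ : ℝ) : ℂ) * inner ℂ u (T u))).re =
      (‖u‖⁻¹ * ‖u‖⁻¹) * (conj a * inner ℂ u (T u)).re := by
      rw [mul_left_comm, Complex.re_ofReal_mul]
    rw [mul_comm (conj a)] at this
    linarith
  rw [← hexp, mul_assoc (‖a‖ : ℂ), Complex.re_ofReal_mul] at h2
  have h3 : ‖a‖ * (‖a‖ * ‖u‖ ^ 2) ≤
      ‖a‖ * (Complex.exp ((conj a).arg * Complex.I) * inner ℂ u (T u)).re := by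
    calc ‖a‖ * (‖a‖ * ‖u‖ ^ 2) = ‖a‖ ^ 2 * ‖u‖ ^ 2 := by ring
      _ ≤ _ := mul_le_mul_of_nonneg_right h2 (sq_nonneg ‖u‖)
      _ = _ := by field_simp
  exact le_of_mul_le_mul_left h3 hna

/-- The `2 l`-th roots of `- i e^{-iθ}` in the lower half-plane. -/
lemma exists_roots {l : ℕ} {θ : ℝ} (h0 : 0 ≤ θ) (hπ : θ ≤ Real.pi) :
    ∃ ω : Fin l → ℂ, Function.Injective ω ∧ (∀ k, (ω k).im < 0) ∧
      ∀ k, ω k ^ (2 * l) = -Complex.I * Complex.exp (-(θ * Complex.I)) := by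
  set α : Fin l → ℝ := fun k => ((Real.pi / 2 + θ) + 2 * Real.pi * k) / (2 * l) with hα
  have hpi := Real.pi_pos
  have hl : ∀ k : Fin l, (0 : ℝ) < 2 * l := fun k => by
    have : 0 < l := k.pos
    positivity
  have hα0 : ∀ k, 0 < α k := fun k => div_pos (by positivity) (hl k)
  have hα1 : ∀ k, α k < Real.pi := fun k => by
    rw [hα]
    simp only
    rw [div_lt_iff₀ (hl k)]
    have : ((k : ℕ) : ℝ) + 1 ≤ l := by exact_mod_cast k.isLt
    nlinarith
  refine ⟨fun k => Complex.exp (-(α k : ℂ) * Complex.I), ?_, ?_, ?_⟩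
  · intro j k h
    have h1 := congrArg Complex.re h
    simp only [Complex.exp_re, Complex.mul_re, Complex.neg_re, Complex.ofReal_re, Complex.I_re,
      mul_zero, Complex.neg_im, Complex.ofReal_im, Complex.I_im, neg_zero, sub_zero,
      Real.exp_zero, one_mul, Complex.mul_im, mul_one, add_zero, Real.cos_neg] at h1
    have h2 := Real.injOn_cos ⟨(hα0 j).le, (hα1 j).le⟩ ⟨(hα0 k).le, (hα1 k).le⟩ h1
    rw [hα] at h2
    simp only at h2
    rw [div_left_inj' (hl j).ne', add_right_inj, mul_right_inj' (by positivity)] at h2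
    exact Fin.ext (by exact_mod_cast h2)
  · intro k
    have := Real.sin_pos_of_pos_of_lt_pi (hα0 k) (hα1 k)
    simpa [Complex.exp_im] using this
  · intro k
    have hl' : (2 * l : ℂ) ≠ 0 := by exact_mod_cast (hl k).ne'
    rw [← Complex.exp_nat_mul]
    have : ((2 * l : ℕ) : ℂ) * (-(α k : ℂ) * Complex.I) =
        -(Real.pi / 2 * Complex.I) + (-(θ * Complex.I) + -((k : ℕ) * (2 * Real.pi * Complex.I))) := by
      rw [hα]
      have hl2 : (l : ℂ) ≠ 0 := by simpa using hl'
      push_cast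
      field_simp
      ring
    rw [this, Complex.exp_add, Complex.exp_add, Complex.exp_neg ((k : ℕ) * _),
      Complex.exp_nat_mul_two_pi_mul_I, Complex.exp_neg, Complex.exp_pi_div_two_mul_I]
    simp

end NumericalRange

section Model

variable {H : Type*} [NormedAddCommGroup H] [InnerProductSpace ℂ H]

lemma norm_sum_smul_sq_le {ι : Type*} (s : Finset ι) (c : ι → ℂ) (x : ι → H) :
    ‖∑ i ∈ s, c i • x i‖ ^ 2 ≤ (∑ i ∈ s, ‖c i‖ ^ 2) * ∑ i ∈ s, ‖x i‖ ^ 2 := by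
  have h1 : ‖∑ i ∈ s, c i • x i‖ ≤ ∑ i ∈ s, ‖c i‖ * ‖x i‖ :=
    (norm_sum_le _ _).trans_eq (by simp [norm_smul])
  exact (pow_le_pow_left₀ (norm_nonneg _) h1 2).trans (sum_mul_sq_le_sq_mul_sq s _ _)

lemma exists_sum_norm_sq_le {l : ℕ} (W : Matrix (Fin l) (Fin l) ℂ) (hW : IsUnit W.det) :
    ∃ C : ℝ, 0 < C ∧ ∀ g : Fin l → H,
      ∑ k, ‖g k‖ ^ 2 ≤ C * ∑ n, ‖∑ k, W n k • g k‖ ^ 2 := by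
  refine ⟨(∑ k, ∑ n, ‖W⁻¹ k n‖ ^ 2) + 1, by positivity, fun g => ?_⟩
  have hg : ∀ k, g k = ∑ n, W⁻¹ k n • ∑ k, W n k • g k := by
    intro k
    simp only [smul_sum, smul_smul]
    rw [sum_comm]
    simp only [← sum_smul, ← Matrix.mul_apply, Matrix.nonsing_inv_mul W hW, Matrix.one_apply,
      ite_smul, one_smul, zero_smul, sum_ite_eq, mem_univ, if_true]
  have h0 : 0 ≤ ∑ n, ‖∑ k, W n k • g k‖ ^ 2 := by positivity
  calc ∑ k, ‖g k‖ ^ 2 ≤ ∑ k, (∑ n, ‖W⁻¹ k n‖ ^ 2) * ∑ n, ‖∑ k, W n k • g k‖ ^ 2 :=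
        sum_le_sum fun k _ => by
          conv_lhs => rw [hg k]
          exact norm_sum_smul_sq_le _ _ _
    _ = (∑ k, ∑ n, ‖W⁻¹ k n‖ ^ 2) * ∑ n, ‖∑ k, W n k • g k‖ ^ 2 := by rw [sum_mul]
    _ ≤ _ := mul_le_mul_of_nonneg_right (by linarith) h0

/-- The form with the Cauchy matrix of points of the lower half-plane and with a block `T`. -/
noncomputable def cauchyForm {l : ℕ} (ω : Fin l → ℂ) (T : H →L[ℂ] H) (g : Fin l → H) : ℂ :=
  ∑ k, ∑ m, -Complex.I / (ω k - (starRingEnd ℂ) (ω m)) * inner ℂ (g m) (T (g k))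

open ComplexConjugate in
lemma le_cauchyForm_re {l : ℕ} {ω : Fin l → ℂ} (hω : ∀ k, (ω k).im < 0) {T : H →L[ℂ] H} {δ : ℝ}
    (hδ : 0 ≤ δ) (hT : ∀ u, δ * ‖u‖ ^ 2 ≤ (inner ℂ u (T u)).re) (g : Fin l → H) (N : ℕ) :
    2 * δ * ∑ n ∈ range N, ‖∑ k, (((ω k + Complex.I) / (ω k - Complex.I)) ^ n *
      (ω k - Complex.I)⁻¹) • g k‖ ^ 2 ≤ (cauchyForm ω T g).re := by
  set a : Fin l → ℂ := fun k => (ω k + Complex.I) / (ω k - Complex.I) with ha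
  set y : Fin l → H := fun k => (ω k - Complex.I)⁻¹ • g k with hy
  have hne : ∀ k, ω k - Complex.I ≠ 0 := fun k h => by
    have := congrArg Complex.im h
    simp at this
    linarith [hω k]
  have ha1 : ∀ k, ‖a k‖ < 1 := by
    intro k
    rw [ha]
    simp only
    rw [norm_div, div_lt_one (norm_pos_iff.2 (hne k)), ← sq_lt_sq₀ (norm_nonneg _) (norm_nonneg _),
      Complex.sq_norm, Complex.sq_norm, Complex.normSq_apply, Complex.normSq_apply]
    simp only [Complex.add_re, Complex.add_im, Complex.sub_re, Complex.sub_im, Complex.I_re,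
      Complex.I_im]
    nlinarith [hω k]
  have haa : ∀ k m, ‖a k * conj (a m)‖ < 1 := fun k m => by
    rw [norm_mul, RCLike.norm_conj]
    exact mul_lt_one_of_nonneg_of_lt_one_left (norm_nonneg _) (ha1 k) (ha1 m).le
  have hq : ∀ k m, 1 - a k * conj (a m) ≠ 0 := fun k m h => by
    have := haa k m
    rw [← sub_eq_zero.1 h] at this
    simp at this
  set hh : ℕ → ℂ := fun n => ∑ k, ∑ m, (a k * conj (a m)) ^ n / (1 - a k * conj (a m)) *
    inner ℂ (y m) (T (y k)) with hhh
  have h0 : cauchyForm ω T g = 2 * hh 0 := by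
    rw [cauchyForm, hhh]
    simp only [mul_sum]
    refine sum_congr rfl fun k _ => sum_congr rfl fun m _ => ?_
    have hc : conj (ω m) + Complex.I ≠ 0 := by
      have := (map_ne_zero (starRingEnd ℂ)).2 (hne m)
      simpa using this
    have hd : ω k - conj (ω m) ≠ 0 := fun h => by
      have := congrArg Complex.im h
      simp at this
      linarith [hω k, hω m]
    have e : 1 - a k * conj (a m) = 2 * Complex.I * (ω k - conj (ω m)) /
        ((ω k - Complex.I) * (conj (ω m) + Complex.I)) := by
      rw [ha]
      simp only [map_div₀, map_add, map_sub, Complex.conj_I, sub_neg_eq_add]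
      field_simp [hne k]
      ring
    simp only [hy, map_smul, inner_smul_left, inner_smul_right, pow_zero, map_inv₀, map_sub,
      Complex.conj_I, sub_neg_eq_add]
    rw [e]
    have hI := Complex.I_ne_zero
    field_simp [hne k]
    linear_combination -inner ℂ (g m) (T (g k)) * Complex.I_sq
  have hrec : ∀ n, hh n = hh (n + 1) + inner ℂ (∑ k, a k ^ n • y k) (T (∑ k, a k ^ n • y k)) := by
    intro n
    simp only [hhh, map_sum, sum_inner, inner_sum, map_smul, inner_smul_left, inner_smul_right,
      ← sum_add_distrib]
    refine sum_congr rfl fun k _ => ?_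
    rw [mul_sum, ← sum_add_distrib]
    refine sum_congr rfl fun m _ => ?_
    have := hq k m
    simp only [map_pow]
    field_simp
    ring_nf
  have hsum : ∀ N, δ * ∑ n ∈ range N, ‖∑ k, a k ^ n • y k‖ ^ 2 + (hh N).re ≤ (hh 0).re := by
    intro N
    induction N with
    | zero => simp
    | succ N ih =>
      rw [hrec N, Complex.add_re] at ih
      rw [sum_range_succ, mul_add]
      linarith [hT (∑ k, a k ^ N • y k)]
  have hlim : Tendsto (fun n => (hh n).re) atTop (𝓝 0) := by
    have : Tendsto hh atTop (𝓝 0) := by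
      have h1 : ∀ k ∈ (univ : Finset (Fin l)), Tendsto (fun n => ∑ m,
          (a k * conj (a m)) ^ n / (1 - a k * conj (a m)) * inner ℂ (y m) (T (y k))) atTop
          (𝓝 0) := by
        intro k _
        have h2 : ∀ m ∈ (univ : Finset (Fin l)), Tendsto (fun n =>
            (a k * conj (a m)) ^ n / (1 - a k * conj (a m)) * inner ℂ (y m) (T (y k))) atTop
            (𝓝 0) := by
          intro m _
          have := ((tendsto_pow_atTop_nhds_zero_of_norm_lt_one (haa k m)).div_const
            (1 - a k * conj (a m))).mul_const (inner ℂ (y m) (T (y k)))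
          simpa using this
        simpa using tendsto_finsetSum _ h2
      simpa using tendsto_finsetSum _ h1
    exact (Complex.continuous_re.tendsto 0).comp this
  have hfin : δ * ∑ n ∈ range N, ‖∑ k, a k ^ n • y k‖ ^ 2 ≤ (hh 0).re := by
    refine ge_of_tendsto (f := fun N' => (hh 0).re - (hh N').re) (x := atTop) ?_ ?_
    · simpa using hlim.const_sub (hh 0).re
    · filter_upwards [eventually_ge_atTop N] with N' hN
      have h1 := hsum N'
      have h2 : ∑ n ∈ range N, ‖∑ k, a k ^ n • y k‖ ^ 2 ≤
          ∑ n ∈ range N', ‖∑ k, a k ^ n • y k‖ ^ 2 :=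
        sum_le_sum_of_subset_of_nonneg (range_mono hN) fun _ _ _ => by positivity
      linarith [mul_le_mul_of_nonneg_left h2 hδ]
  rw [h0, Complex.mul_re, Complex.re_ofNat, Complex.im_ofNat, zero_mul, sub_zero]
  simp only [mul_smul]
  linarith

/-- The leading part of the boundary form is positive definite on the model solutions. -/
lemma exists_model_bound {l : ℕ} {ω : Fin l → ℂ} (hinj : Function.Injective ω)
    (hω : ∀ k, (ω k).im < 0) {θ : ℝ}
    (hroot : ∀ k, ω k ^ (2 * l) = -Complex.I * Complex.exp (-(θ * Complex.I)))
    {T : H →L[ℂ] H} (hT : ∀ u, (inner ℂ u (T u)).im ≤ 0) {δ : ℝ} (hδ : 0 < δ)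
    (hθ : ∀ u, δ * ‖u‖ ^ 2 ≤ (Complex.exp (θ * Complex.I) * inner ℂ u (T u)).re) :
    ∃ c : ℝ, 0 < c ∧ ∀ g : Fin l → H, c * ∑ k, ‖g k‖ ^ 2 ≤
      (∑ a ∈ range l, inner ℂ (∑ m, ω m ^ (l + a) • g m)
        (T (∑ k, ω k ^ (l - 1 - a) • g k))).re := by
  have hne : ∀ k, ω k - Complex.I ≠ 0 := fun k h => by
    have := congrArg Complex.im h
    simp at this
    linarith [hω k]
  set W : Matrix (Fin l) (Fin l) ℂ := fun n k =>
    ((ω k + Complex.I) / (ω k - Complex.I)) ^ (n : ℕ) * (ω k - Complex.I)⁻¹ with hWdef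
  have hW : IsUnit W.det := by
    have e : W = (Matrix.vandermonde fun k => (ω k + Complex.I) / (ω k - Complex.I)).transpose *
        Matrix.diagonal fun k => (ω k - Complex.I)⁻¹ := by
      ext n k
      rw [Matrix.mul_diagonal, Matrix.transpose_apply, Matrix.vandermonde_apply]
    rw [e, Matrix.det_mul, Matrix.det_transpose, Matrix.det_diagonal, isUnit_iff_ne_zero]
    refine mul_ne_zero (Matrix.det_vandermonde_ne_zero_iff.2 ?_)
      (prod_ne_zero_iff.2 fun k _ => inv_ne_zero (hne k))
    intro j k hjk
    simp only at hjk
    rw [div_eq_div_iff (hne j) (hne k)] at hjk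
    apply hinj
    have : (2 * Complex.I) * (ω j - ω k) = 0 := by linear_combination -hjk
    have h2 := (mul_eq_zero.1 this).resolve_left (by simp)
    exact sub_eq_zero.1 h2
  obtain ⟨C, hC, hCg⟩ := exists_sum_norm_sq_le (H := H) W hW
  refine ⟨2 * δ / C, by positivity, fun g => ?_⟩
  have hsplit : ∑ a ∈ range l, inner ℂ (∑ m, ω m ^ (l + a) • g m)
      (T (∑ k, ω k ^ (l - 1 - a) • g k)) =
      cauchyForm ω (Complex.I • T) (fun k => ω k ^ l • g k) +
        cauchyForm ω (Complex.exp (θ * Complex.I) • T) g := by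
    simp only [cauchyForm, map_sum, sum_inner, inner_sum, map_smul, inner_smul_left,
      inner_smul_right, ← sum_add_distrib, _root_.smul_apply]
    rw [sum_comm]
    refine sum_congr rfl fun k _ => ?_
    simp only [mul_sum]
    rw [sum_comm]
    refine sum_congr rfl fun m _ => ?_
    have hd : ω k - (starRingEnd ℂ) (ω m) ≠ 0 := fun h => by
      have := congrArg Complex.im h
      simp at this
      linarith [hω k, hω m]
    have hgeom := (Commute.all ((starRingEnd ℂ) (ω m)) (ω k)).geom_sum₂_mul l
    have hr : (starRingEnd ℂ) (ω m) ^ l * (starRingEnd ℂ) (ω m) ^ l =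
        Complex.I * Complex.exp (θ * Complex.I) := by
      rw [← pow_add, ← two_mul, ← map_pow, hroot, map_mul, ← Complex.exp_conj]
      simp
    have e : ∑ x ∈ range l, ω k ^ (l - 1 - x) * ((starRingEnd ℂ) (ω m ^ (l + x)) *
        inner ℂ (g m) (T (g k))) = ((starRingEnd ℂ) (ω m) ^ l * inner ℂ (g m) (T (g k))) *
        ∑ x ∈ range l, (starRingEnd ℂ) (ω m) ^ x * ω k ^ (l - 1 - x) := by
      rw [mul_sum]
      refine sum_congr rfl fun x _ => ?_
      rw [map_pow, pow_add]; ring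
    rw [e]
    have hg2 : ∑ x ∈ range l, (starRingEnd ℂ) (ω m) ^ x * ω k ^ (l - 1 - x) =
        (ω k ^ l - (starRingEnd ℂ) (ω m) ^ l) / (ω k - (starRingEnd ℂ) (ω m)) := by
      rw [eq_div_iff hd]; linear_combination -hgeom
    rw [hg2, map_pow]
    generalize Complex.exp (θ * Complex.I) = E at hr
    field_simp
    linear_combination inner ℂ (g m) (T (g k)) *
      (-hr + Complex.I_sq * (starRingEnd ℂ) (ω m) ^ l * ω k ^ l)
  rw [hsplit, Complex.add_re]
  have h1 := le_cauchyForm_re hω (T := Complex.I • T) le_rfl (fun u => by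
    rw [_root_.smul_apply, inner_smul_right, Complex.I_mul_re]
    linarith [hT u]) (fun k => ω k ^ l • g k) 0
  have h2 := le_cauchyForm_re hω (T := Complex.exp (θ * Complex.I) • T) hδ.le (fun u => by
    rw [_root_.smul_apply, inner_smul_right]
    exact hθ u) g l
  rw [sum_range] at h2
  have h3 := hCg g
  have h4 : 2 * δ / C * ∑ k, ‖g k‖ ^ 2 ≤ 2 * δ * ∑ n, ‖∑ k, W n k • g k‖ ^ 2 := by
    rw [div_mul_eq_mul_div, div_le_iff₀ hC, mul_assoc (2 * δ), mul_comm (∑ n, _) C]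
    exact mul_le_mul_of_nonneg_left h3 (by positivity)
  simp only [range_zero, sum_empty, mul_zero] at h1
  linarith

end Model

section DataBound

variable {H : Type*} [NormedAddCommGroup H] [InnerProductSpace ℂ H]

open Polynomial in
lemma aeval_shift_apply (P : ℂ[X]) (u : ℕ → H) (a : ℕ) :
    (aeval shift P) u a = ∑ i ∈ range (P.natDegree + 1), P.coeff i • u (a + i) := by
  rw [aeval_eq_sum_range, LinearMap.sum_apply, Finset.sum_apply]
  simp [shift_pow_apply]

open Polynomial in
/-- A solution of a recurrence with zero initial data is estimated by the right-hand side. -/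
lemma exists_recurrence_bound {P : ℂ[X]} (hP : P.Monic) :
    ∃ C : ℝ, 0 ≤ C ∧ ∀ d : ℕ → H, (∀ m < P.natDegree, d m = 0) →
      ∀ m < 2 * P.natDegree, ‖d m‖ ≤ C * ∑ a ∈ range P.natDegree, ‖(aeval shift P) d a‖ := by
  set l := P.natDegree with hl
  set K : ℝ := ∑ i ∈ range l, ‖P.coeff i‖ with hK
  have hK0 : 0 ≤ K := by positivity
  refine ⟨(1 + K) ^ (2 * l), by positivity, fun d hd => ?_⟩
  set X := ∑ a ∈ range l, ‖(aeval shift P) d a‖ with hX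
  have hX0 : 0 ≤ X := by positivity
  have key : ∀ m < 2 * l, ‖d m‖ ≤ (1 + K) ^ m * X := by
    intro m
    induction m using Nat.strong_induction_on with
    | _ m ih =>
      intro hm
      rcases Nat.lt_or_ge m l with h | h
      · rw [hd m h, norm_zero]; positivity
      obtain ⟨a, rfl⟩ := Nat.exists_eq_add_of_le' h
      have h1 := aeval_shift_apply P d a
      rw [sum_range_succ, ← hl, show P.coeff l = 1 from hP, one_smul] at h1
      have h2 : d (a + l) = (aeval shift P) d a - ∑ i ∈ range l, P.coeff i • d (a + i) := by
        rw [h1]; abel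
      have h3 : ‖(aeval shift P) d a‖ ≤ X :=
        single_le_sum (f := fun a => ‖(aeval shift P) d a‖) (fun _ _ => norm_nonneg _)
          (mem_range.2 (by omega))
      have h4 : ‖∑ i ∈ range l, P.coeff i • d (a + i)‖ ≤ K * ((1 + K) ^ (a + l - 1) * X) := by
        rw [hK, sum_mul]
        refine norm_sum_le_of_le _ fun i hi => ?_
        rw [mem_range] at hi
        rw [norm_smul]
        refine mul_le_mul_of_nonneg_left ((ih (a + i) (by omega) (by omega)).trans ?_)
          (norm_nonneg _)
        exact mul_le_mul_of_nonneg_right (pow_le_pow_right₀ (by linarith) (by omega)) hX0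
      have h5 : X ≤ (1 + K) ^ (a + l - 1) * X :=
        le_mul_of_one_le_left hX0 (one_le_pow₀ (by linarith))
      have h6 : (1 + K) ^ (a + l) = (1 + K) * (1 + K) ^ (a + l - 1) := by
        rw [← pow_succ']; congr 1; omega
      rw [h2, h6]
      refine (norm_sub_le _ _).trans ?_
      linarith
  intro m hm
  exact (key m hm).trans (mul_le_mul_of_nonneg_right
    (pow_le_pow_right₀ (by linarith) hm.le) hX0)

lemma exists_interpolation {l : ℕ} {ω : Fin l → ℂ} (hinj : Function.Injective ω) (u : ℕ → H) :
    ∃ g : Fin l → H, ∀ m < l, ∑ k, ω k ^ m • g k = u m := by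
  set W := (Matrix.vandermonde ω).transpose with hW
  have hdet : IsUnit W.det := by
    rw [hW, Matrix.det_transpose, isUnit_iff_ne_zero]
    exact Matrix.det_vandermonde_ne_zero_iff.2 hinj
  refine ⟨fun k => ∑ n : Fin l, W⁻¹ k n • u n, fun m hm => ?_⟩
  simp only [smul_sum, smul_smul]
  rw [sum_comm]
  have : ∀ n : Fin l, ∑ k, (ω k ^ m * W⁻¹ k n) = (1 : Matrix (Fin l) (Fin l) ℂ) ⟨m, hm⟩ n := by
    intro n
    rw [← Matrix.mul_nonsing_inv W hdet, Matrix.mul_apply]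
    rfl
  simp only [← sum_smul, this, Matrix.one_apply, ite_smul, one_smul, zero_smul, sum_ite_eq,
    mem_univ, if_true]

lemma le_of_quadratic {c K₁ K₂ s X : ℝ} (hc : 0 < c) (hK₁ : 0 ≤ K₁) (hK₂ : 0 ≤ K₂) (hs : 0 ≤ s)
    (hX : 0 ≤ X) (h : c * s ^ 2 ≤ K₁ * (X * s) + K₂ * X ^ 2) :
    s ≤ ((K₁ + K₂) / c + 1) * X := by
  by_contra! hlt
  have hq : 0 ≤ (K₁ + K₂) / c := by positivity
  have hXs : X ≤ s := by nlinarith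
  have h1 : K₁ * (X * s) + K₂ * X ^ 2 ≤ (K₁ + K₂) * X * s := by
    linarith [mul_nonneg (mul_nonneg hK₂ hX) (sub_nonneg.2 hXs)]
  have h2 : (K₁ + K₂) * X ≤ c * (s - X) := by
    have : (K₁ + K₂) * X = c * ((K₁ + K₂) / c * X) := by field_simp
    rw [this]
    exact mul_le_mul_of_nonneg_left (by linarith) hc.le
  have hs0 : 0 < s := lt_of_le_of_lt (by positivity) hlt
  have hX0 : c * (X * s) ≤ 0 := by nlinarith
  have hX1 : X = 0 := by
    have : X * s ≤ 0 := by
      by_contra! hh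
      linarith [mul_pos hc hh]
    nlinarith
  subst hX1
  nlinarith [mul_pos hc (mul_pos hs0 hs0)]

variable [CompleteSpace H]

lemma bform_shift_pow_re {l : ℕ} {B : ℕ → (H →L[ℂ] H)} (hB : ∀ j, 2 * l < j → B j = 0)
    {u : ℕ → H} (hu : u ∈ sol (2 * l) B) :
    (bform (2 * l) B ((shift ^ l) u) ((shift ^ l) u)).re = -2 * (∑ b ∈ range l,
      ∑ j ∈ range (2 * l + 1), heav (2 * b + 1 - j) *
        inner ℂ (u (l + b)) (B j (u (j + (l - 1 - b))))).re := by
  set v := (shift ^ l) u with hv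
  set F := wform (2 * l) (fun a b => heav (a - b) • B (a + b + 1)) v v with hF
  have h1 : bform (2 * l) B v v = F + (starRingEnd ℂ) F := by
    rw [bform, hF, wform_apply, wform_apply, map_sum]
    simp only [map_sum]
    rw [sum_comm (γ := ℕ) (f := fun a b => (starRingEnd ℂ) _), ← sum_add_distrib]
    refine sum_congr rfl fun a _ => ?_
    rw [← sum_add_distrib]
    refine sum_congr rfl fun b _ => ?_
    rw [inner_conj_symm, _root_.add_apply, inner_add_right]
    congr 1
    rw [_root_.smul_apply, _root_.smul_apply, inner_smul_right, inner_smul_left, conj_heav,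
      ContinuousLinearMap.adjoint_inner_right, add_comm b a]
  have h2 : F = -∑ b ∈ range l, ∑ j ∈ range (2 * l + 1), heav (2 * b + 1 - j) *
        inner ℂ (u (l + b)) (B j (u (j + (l - 1 - b)))) := by
    have e1 : F = ∑ b ∈ range l, ∑ a ∈ range (2 * l), heav (a - b) *
        inner ℂ (u (l + b)) (B (a + b + 1) (u (l + a))) := by
      rw [hF, wform_apply, sum_comm]
      symm
      have e0 : ∀ a b : ℕ, inner ℂ (v b) ((heav (a - b) • B (a + b + 1)) (v a)) =
          heav (a - b) * inner ℂ (u (l + b)) (B (a + b + 1) (u (l + a))) := by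
        intro a b
        rw [hv, shift_pow_apply, shift_pow_apply, _root_.smul_apply, inner_smul_right,
          add_comm b l, add_comm a l]
      simp only [e0]
      refine sum_subset_zero_on_sdiff (range_mono (by omega)) ?_ (fun _ _ => rfl)
      intro b hb
      simp only [Finset.mem_sdiff, mem_range, not_lt] at hb
      refine sum_eq_zero fun a _ => ?_
      rcases Nat.lt_or_ge a b with h | h
      · rw [heav_neg (by omega), zero_mul]
      · rw [hB _ (by omega)]; simp
    rw [e1, ← sum_neg_distrib]
    refine sum_congr rfl fun b hb => ?_
    rw [mem_range] at hb
    have e2 : ∑ a ∈ range (2 * l), heav (a - b) *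
        inner ℂ (u (l + b)) (B (a + b + 1) (u (l + a))) = ∑ j ∈ range (2 * l + 1),
        heav (j - 1 - 2 * b) * inner ℂ (u (l + b)) (B j (u (j + (l - 1 - b)))) := by
      have e3 : ∑ j ∈ range (2 * l + (b + 1)),
          heav (j - 1 - 2 * b) * inner ℂ (u (l + b)) (B j (u (j + (l - 1 - b)))) =
          ∑ j ∈ range (2 * l + 1),
          heav (j - 1 - 2 * b) * inner ℂ (u (l + b)) (B j (u (j + (l - 1 - b)))) := by
        symm
        refine sum_subset_zero_on_sdiff (range_mono (by omega)) ?_ (fun _ _ => rfl)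
        intro j hj
        simp only [Finset.mem_sdiff, mem_range, not_lt] at hj
        rw [hB _ (by omega)]; simp
      rw [← e3, add_comm (2 * l) (b + 1), sum_range_add]
      have e4 : ∑ j ∈ range (b + 1),
          heav (j - 1 - 2 * b) * inner ℂ (u (l + b)) (B j (u (j + (l - 1 - b)))) = 0 :=
        sum_eq_zero fun j hj => by
          rw [mem_range] at hj
          rw [heav_neg (by omega), zero_mul]
      rw [e4, zero_add]
      refine sum_congr rfl fun a _ => ?_
      rw [show b + 1 + a = a + b + 1 by omega, show a + b + 1 + (l - 1 - b) = l + a by omega]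
      congr 2
      push_cast; ring
    have e5 : ∑ j ∈ range (2 * l + 1), inner ℂ (u (l + b)) (B j (u (j + (l - 1 - b)))) = 0 := by
      rw [← inner_sum, hu, inner_zero_right]
    rw [e2, ← zero_sub, ← e5, ← sum_sub_distrib]
    refine sum_congr rfl fun j _ => ?_
    have := heav_add_heav_neg ((j : ℤ) - 1 - 2 * b)
    rw [show -((j : ℤ) - 1 - 2 * b) = 2 * b + 1 - j by ring] at this
    linear_combination (inner ℂ (u (l + b)) (B j (u (j + (l - 1 - b))))) * this
  rw [h1, h2]
  simp only [map_neg, Complex.add_re, Complex.neg_re, Complex.conj_re]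
  ring

open Polynomial in
/-- If the higher coefficients are small, then the data of a solution with a nonnegative boundary
form are estimated by half of the data of its image under `∏ₖ (S - ωₖ)`. -/
lemma exists_data_bound {l : ℕ} {ω : Fin l → ℂ} (hinj : Function.Injective ω)
    (hω : ∀ k, (ω k).im < 0) {θ : ℝ}
    (hroot : ∀ k, ω k ^ (2 * l) = -Complex.I * Complex.exp (-(θ * Complex.I)))
    {T : H →L[ℂ] H} (hT : ∀ u, (inner ℂ u (T u)).im ≤ 0) {δ : ℝ} (hδ : 0 < δ)
    (hθ : ∀ u, δ * ‖u‖ ^ 2 ≤ (Complex.exp (θ * Complex.I) * inner ℂ u (T u)).re) :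
    ∃ η : ℝ, 0 < η ∧ ∃ C₀ : ℝ, 0 ≤ C₀ ∧ ∀ B : ℕ → (H →L[ℂ] H), B 0 = T →
      (∀ j, 2 * l < j → B j = 0) → (∀ j, 1 ≤ j → ‖B j‖ ≤ η) → ∀ u ∈ sol (2 * l) B,
      0 ≤ (bform (2 * l) B ((shift ^ l) u) ((shift ^ l) u)).re →
      ∀ k < 2 * l, ‖u k‖ ≤ C₀ * ∑ a ∈ range l, ‖(aeval shift (∏ k, (X - C (ω k)))) u a‖ := by
  obtain ⟨c, hc, hcg⟩ := exists_model_bound (H := H) hinj hω hroot hT hδ hθ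
  set P : ℂ[X] := ∏ k, (X - C (ω k)) with hPdef
  have hPm : P.Monic := monic_prod_X_sub_C _ _
  have hPd : P.natDegree = l := by
    rw [hPdef, natDegree_finsetProd_X_sub_C_eq_card]; simp
  obtain ⟨C₁, hC₁, hrec⟩ := exists_recurrence_bound (H := H) hPm
  rw [hPd] at hrec
  set C₂ : ℝ := ∑ m ∈ range (2 * l), ∑ k, ‖ω k ^ m‖ with hC₂def
  have hC₂ : 0 ≤ C₂ := by positivity
  set η : ℝ := c / (16 * l ^ 3 * C₂ ^ 2 + 1) with hη
  have hη0 : 0 < η := by positivity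
  set K₁ : ℝ := l * (C₁ * (‖T‖ * C₂)) with hK₁
  set K₂ : ℝ := 8 * l ^ 3 * η * C₁ ^ 2 with hK₂
  refine ⟨η, hη0, C₂ * ((K₁ + K₂) / (c / 2) + 1) + C₁, by positivity, ?_⟩
  intro B hB0 hB hBη u hu hpos
  set x := (aeval shift P) u with hx
  set X' := ∑ a ∈ range l, ‖x a‖ with hX'
  have hX0 : 0 ≤ X' := by positivity
  obtain ⟨g, hg⟩ := exists_interpolation hinj u
  set s : ℝ := √(∑ k, ‖g k‖ ^ 2) with hs
  have hs0 : 0 ≤ s := Real.sqrt_nonneg _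
  have hss : s ^ 2 = ∑ k, ‖g k‖ ^ 2 := Real.sq_sqrt (by positivity)
  have hgs : ∀ k, ‖g k‖ ≤ s := fun k => Real.le_sqrt_of_sq_le
    (single_le_sum (f := fun k => ‖g k‖ ^ 2) (fun _ _ => by positivity) (mem_univ k))
  set U : ℕ → H := fun m => ∑ k, ω k ^ m • g k with hU
  have hUs : ∀ m < 2 * l, ‖U m‖ ≤ C₂ * s := by
    intro m hm
    have h1 : ‖U m‖ ≤ (∑ k, ‖ω k ^ m‖) * s := by
      rw [sum_mul]
      refine norm_sum_le_of_le _ fun k _ => ?_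
      rw [norm_smul]
      exact mul_le_mul_of_nonneg_left (hgs k) (norm_nonneg _)
    refine h1.trans (mul_le_mul_of_nonneg_right ?_ hs0)
    exact single_le_sum (f := fun m => ∑ k, ‖ω k ^ m‖) (fun _ _ => by positivity)
      (mem_range.2 hm)
  have hPU : (aeval shift P) U = 0 := by
    ext a
    rw [aeval_shift_apply]
    simp only [hU, smul_sum, Pi.zero_apply]
    rw [sum_comm]
    refine sum_eq_zero fun k _ => ?_
    have h0 : P.eval (ω k) = 0 := by
      rw [hPdef, eval_prod]
      exact prod_eq_zero (mem_univ k) (by simp)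
    have : ∑ i ∈ range (P.natDegree + 1), P.coeff i • ω k ^ (a + i) • g k =
        (ω k ^ a * P.eval (ω k)) • g k := by
      rw [eval_eq_sum_range, mul_sum, sum_smul]
      refine sum_congr rfl fun i _ => ?_
      rw [smul_smul]; congr 1; ring
    rw [this, h0, mul_zero, zero_smul]
  have hd : ∀ m < 2 * l, ‖u m - U m‖ ≤ C₁ * X' := by
    have := hrec (u - U) (fun m hm => by simp [hU, hg m hm])
    rw [map_sub, hPU, sub_zero] at this
    exact this
  have hud : ∀ m < 2 * l, ‖u m‖ ≤ C₂ * s + C₁ * X' := by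
    intro m hm
    have : u m = U m + (u m - U m) := by abel
    rw [this]
    exact (norm_add_le _ _).trans (add_le_add (hUs m hm) (hd m hm))
  have hE := bform_shift_pow_re hB hu
  rw [hE] at hpos
  set N := C₂ * s + C₁ * X' with hN
  have hN0 : 0 ≤ N := by positivity
  have hN2 : N ^ 2 ≤ 2 * (C₂ ^ 2 * s ^ 2 + C₁ ^ 2 * X' ^ 2) := by
    nlinarith [sq_nonneg (C₂ * s - C₁ * X')]
  -- the terms with the higher coefficients
  have hb : ∀ b ∈ range l, (inner ℂ (u (l + b)) (T (u (l - 1 - b)))).re - 2 * l * (η * N ^ 2) ≤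
      (∑ j ∈ range (2 * l + 1), heav (2 * b + 1 - j) *
        inner ℂ (u (l + b)) (B j (u (j + (l - 1 - b))))).re := by
    intro b hb
    rw [mem_range] at hb
    rw [sum_range_succ', Complex.add_re, heav_pos (by push_cast; omega), hB0, one_mul, zero_add]
    have : ‖∑ j ∈ range (2 * l), heav (2 * b + 1 - (j + 1 : ℕ)) *
        inner ℂ (u (l + b)) (B (j + 1) (u (j + 1 + (l - 1 - b))))‖ ≤
        ∑ j ∈ range (2 * l), η * N ^ 2 := by
      refine norm_sum_le_of_le _ fun j hj => ?_
      rcases Nat.lt_or_ge (2 * b) j with h | h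
      · rw [heav_neg (by push_cast; omega), zero_mul, norm_zero]; positivity
      rw [norm_mul]
      have h1 : ‖heav (2 * b + 1 - (j + 1 : ℕ))‖ ≤ 1 := by
        unfold heav; split_ifs <;> norm_num
      have h2 : ‖inner ℂ (u (l + b)) (B (j + 1) (u (j + 1 + (l - 1 - b))))‖ ≤ N * (η * N) :=
        (norm_inner_le_norm _ _).trans (mul_le_mul (hud _ (by omega))
          ((ContinuousLinearMap.le_opNorm _ _).trans (mul_le_mul (hBη _ (by omega))
            (hud _ (by omega)) (norm_nonneg _) hη0.le)) (norm_nonneg _) hN0)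
      calc _ ≤ 1 * (N * (η * N)) := mul_le_mul h1 h2 (norm_nonneg _) zero_le_one
        _ = η * N ^ 2 := by ring
    rw [sum_const, card_range, nsmul_eq_mul] at this
    have h3 := (abs_le.1 (Complex.abs_re_le_norm (∑ j ∈ range (2 * l),
      heav (2 * b + 1 - (j + 1 : ℕ)) *
        inner ℂ (u (l + b)) (B (j + 1) (u (j + 1 + (l - 1 - b))))))).1
    push_cast at this h3 ⊢
    linarith
  have hsum := sum_le_sum hb
  rw [← Complex.re_sum, sum_sub_distrib, sum_const, card_range, nsmul_eq_mul] at hsum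
  -- the leading terms
  have hlead : ∀ b ∈ range l, (inner ℂ (U (l + b)) (T (U (l - 1 - b)))).re -
      C₁ * (‖T‖ * C₂) * (X' * s) ≤ (inner ℂ (u (l + b)) (T (u (l - 1 - b)))).re := by
    intro b hb
    rw [mem_range] at hb
    have e1 : u (l - 1 - b) = U (l - 1 - b) := (hg _ (by omega)).symm
    have e2 : u (l + b) = U (l + b) + (u (l + b) - U (l + b)) := by abel
    rw [e1, e2, inner_add_left, Complex.add_re]
    have h2 : ‖inner ℂ (u (l + b) - U (l + b)) (T (U (l - 1 - b)))‖ ≤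
        C₁ * X' * (‖T‖ * (C₂ * s)) :=
      (norm_inner_le_norm _ _).trans (mul_le_mul (hd _ (by omega))
          ((ContinuousLinearMap.le_opNorm _ _).trans (mul_le_mul_of_nonneg_left
            (hUs _ (by omega)) (norm_nonneg _))) (norm_nonneg _) (by positivity))
    have h3 := (abs_le.1 (Complex.abs_re_le_norm
      (inner ℂ (u (l + b) - U (l + b)) (T (U (l - 1 - b)))))).1
    linarith
  have hsum2 := sum_le_sum hlead
  rw [sum_sub_distrib, sum_const, card_range, nsmul_eq_mul, ← Complex.re_sum] at hsum2
  have hmodel := hcg g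
  rw [← hss] at hmodel
  have hη1 : 8 * l ^ 3 * η * C₂ ^ 2 ≤ c / 2 := by
    rw [hη]
    have : 0 < 16 * (l : ℝ) ^ 3 * C₂ ^ 2 + 1 := by positivity
    rw [mul_div_assoc', div_mul_eq_mul_div, div_le_div_iff₀ this two_pos]
    linarith
  have hquad : c / 2 * s ^ 2 ≤ K₁ * (X' * s) + K₂ * X' ^ 2 := by
    have h1 : (l : ℝ) * (2 * l * (η * N ^ 2)) ≤ c / 2 * s ^ 2 + K₂ * X' ^ 2 := by
      rcases Nat.eq_zero_or_pos l with h0 | h0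
      · have : (l : ℝ) = 0 := by exact_mod_cast h0
        rw [this, zero_mul]; positivity
      have hl1 : (1 : ℝ) ≤ l := by exact_mod_cast h0
      calc (l : ℝ) * (2 * l * (η * N ^ 2)) = 2 * l ^ 2 * η * N ^ 2 := by ring
        _ ≤ 2 * l ^ 2 * η * (2 * (C₂ ^ 2 * s ^ 2 + C₁ ^ 2 * X' ^ 2)) := by gcongr
        _ = 4 * l ^ 2 * η * C₂ ^ 2 * s ^ 2 + 4 * l ^ 2 * η * C₁ ^ 2 * X' ^ 2 := by ring
        _ ≤ 8 * l ^ 3 * η * C₂ ^ 2 * s ^ 2 + 8 * l ^ 3 * η * C₁ ^ 2 * X' ^ 2 := by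
          have : 4 * (l : ℝ) ^ 2 ≤ 8 * l ^ 3 := by
            linarith [pow_le_pow_right₀ hl1 (show 2 ≤ 3 by norm_num),
              pow_nonneg (zero_le_one.trans hl1) 3]
          gcongr
        _ ≤ _ := by
          have := mul_le_mul_of_nonneg_right hη1 (sq_nonneg s)
          linarith
    have h2 : K₁ * (X' * s) = l * (C₁ * (‖T‖ * C₂) * (X' * s)) := by rw [hK₁]; ring
    linarith
  have hfin := le_of_quadratic (half_pos hc) (by positivity) (by positivity) hs0 hX0 hquad
  intro k hk
  calc ‖u k‖ ≤ C₂ * s + C₁ * X' := hud k hk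
    _ ≤ C₂ * (((K₁ + K₂) / (c / 2) + 1) * X') + C₁ * X' := by gcongr
    _ = _ := by ring

end DataBound

section HalfData

variable {H : Type*} [NormedAddCommGroup H] [InnerProductSpace ℂ H]

open Polynomial in
lemma aeval_prod_scale {ι : Type*} (s : Finset ι) (ω : ι → ℂ) {σ : ℂ} {u v : ℕ → H}
    (huv : ∀ k, u k = σ ^ k • v k) (a : ℕ) :
    (aeval shift (∏ k ∈ s, (X - C (σ * ω k)))) u a =
      σ ^ (s.card + a) • (aeval shift (∏ k ∈ s, (X - C (ω k)))) v a := by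
  classical
  induction s using Finset.induction_on generalizing a with
  | empty => simp [huv]
  | insert k s hk ih =>
    have e : ∀ (z : ℂ) (p : ℂ[X]) (w : ℕ → H), (aeval shift ((X - C z) * p)) w a =
        (aeval shift p) w (a + 1) - z • (aeval shift p) w a := by
      intro z p w
      rw [map_mul, Module.End.mul_apply]
      simp
    rw [prod_insert hk, prod_insert hk, e, e, ih, ih, card_insert_of_notMem hk, smul_sub, smul_smul,
      smul_smul]
    congr 2 <;> ring

variable [CompleteSpace H]

open Polynomial in
/-- The data of a solution with a boundary form of the right sign are estimated by half of the data
of its image under a polynomial of the shift with zeros in a given half-plane. -/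
lemma exists_half_data_bound {l : ℕ} {B : ℕ → (H →L[ℂ] H)} (hB : ∀ j, 2 * l < j → B j = 0)
    (hT : ∀ u, (inner ℂ u (B 0 u)).im ≤ 0) (h0 : (0 : ℂ) ∉ closure (numericalRange (B 0)))
    {s : ℝ} (hs : |s| = 1) :
    ∃ ω : Fin l → ℂ, (∀ k, s * (ω k).im < 0) ∧ ∃ C₀ : ℝ, 0 ≤ C₀ ∧ ∀ u ∈ sol (2 * l) B,
      0 ≤ s * (bform (2 * l) B ((shift ^ l) u) ((shift ^ l) u)).re →
      ∀ k < 2 * l, ‖u k‖ ≤ C₀ * ∑ a ∈ range l, ‖(aeval shift (∏ k, (X - C (ω k)))) u a‖ := by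
  obtain ⟨θ, hθ0, hθπ, δ, hδ, hθ⟩ := exists_rotation_accretive (B 0) hT h0
  obtain ⟨ω, hinj, hω, hroot⟩ := exists_roots (l := l) hθ0 hθπ
  obtain ⟨η, hη, C₀, hC₀, hmain⟩ := exists_data_bound hinj hω hroot hT hδ hθ
  set K : ℝ := ∑ j ∈ range (2 * l + 1), ‖B j‖ with hK
  have hK0 : 0 ≤ K := by positivity
  set τ : ℝ := min 1 (η / (1 + K)) with hτdef
  have hτ : 0 < τ := lt_min one_pos (by positivity)
  have hτ1 : τ ≤ 1 := min_le_left _ _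
  have hτη : τ * K ≤ η := by
    calc τ * K ≤ η / (1 + K) * (1 + K) :=
          mul_le_mul (min_le_right _ _) (by linarith) hK0 (by positivity)
      _ = η := by field_simp
  set σ : ℝ := s * τ with hσ
  have hσa : |σ| = τ := by rw [hσ, abs_mul, hs, one_mul, abs_of_pos hτ]
  have hσ0 : σ ≠ 0 := by rw [← abs_pos, hσa]; exact hτ
  have hσc : (σ : ℂ) ≠ 0 := by exact_mod_cast hσ0
  have hss : s * s = 1 := by rw [← abs_mul_abs_self, hs, one_mul]
  refine ⟨fun k => σ * ω k, fun k => ?_, C₀ * τ⁻¹ ^ (2 * l), by positivity, ?_⟩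
  · rw [Complex.im_ofReal_mul, hσ]
    have : s * (s * τ * (ω k).im) = τ * (ω k).im := by linear_combination τ * (ω k).im * hss
    rw [this]
    exact mul_neg_of_pos_of_neg hτ (hω k)
  intro u hu hpos k hk
  set v : ℕ → H := fun k => ((σ : ℂ) ^ k)⁻¹ • u k with hv
  have huv : ∀ k, u k = (σ : ℂ) ^ k • v k := fun k => by
    rw [hv]; simp only
    rw [smul_smul, mul_inv_cancel₀ (pow_ne_zero k hσc), one_smul]
  set B' : ℕ → (H →L[ℂ] H) := fun j => (σ : ℂ) ^ j • B j with hB'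
  have hv_mem : v ∈ sol (2 * l) B' := by
    intro m
    have : ∀ j, B' j (v (j + m)) = ((σ : ℂ) ^ m)⁻¹ • B j (u (j + m)) := by
      intro j
      simp only [hB', hv, _root_.smul_apply, map_smul, smul_smul]
      congr 1
      have := pow_ne_zero j hσc
      have := pow_ne_zero m hσc
      rw [pow_add]; field_simp
    simp only [this]
    rw [← smul_sum, hu m, smul_zero]
  have hform : bform (2 * l) B' ((shift ^ l) v) ((shift ^ l) v) =
      ((σ * (σ ^ (2 * l))⁻¹ : ℝ) : ℂ) * bform (2 * l) B ((shift ^ l) u) ((shift ^ l) u) := by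
    rw [bform, bform, wform_apply, wform_apply, mul_sum]
    refine sum_congr rfl fun a _ => ?_
    rw [mul_sum]
    refine sum_congr rfl fun b _ => ?_
    simp only [shift_pow_apply, hv, hB', _root_.add_apply, _root_.smul_apply, map_smul,
      inner_add_right, inner_smul_right, inner_smul_left, map_inv₀, map_pow, Complex.conj_ofReal,
      ContinuousLinearMap.adjoint_inner_right]
    have h1 := pow_ne_zero a hσc
    have h2 := pow_ne_zero b hσc
    have h3 := pow_ne_zero l hσc
    push_cast
    simp only [pow_add, pow_one, two_mul]
    field_simp
  have hpos' : 0 ≤ (bform (2 * l) B' ((shift ^ l) v) ((shift ^ l) v)).re := by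
    rw [hform, Complex.re_ofReal_mul]
    have : σ * (σ ^ (2 * l))⁻¹ * (bform (2 * l) B ((shift ^ l) u) ((shift ^ l) u)).re =
      τ * (σ ^ (2 * l))⁻¹ * (s * (bform (2 * l) B ((shift ^ l) u) ((shift ^ l) u)).re) := by
      rw [hσ]; ring
    rw [this]
    have : 0 ≤ (σ ^ (2 * l))⁻¹ := by rw [pow_mul]; positivity
    positivity
  have hsmall : ∀ j, 1 ≤ j → ‖B' j‖ ≤ η := by
    intro j hj
    rcases Nat.lt_or_ge (2 * l) j with h | h
    · simp only [hB', hB j h, smul_zero, norm_zero]; exact hη.le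
    · have h1 : ‖B j‖ ≤ K := single_le_sum (f := fun j => ‖B j‖) (fun _ _ => norm_nonneg _)
        (mem_range.2 (by omega))
      rw [hB', norm_smul, norm_pow, Complex.norm_real, Real.norm_eq_abs, hσa]
      calc τ ^ j * ‖B j‖ ≤ τ ^ 1 * K :=
            mul_le_mul (pow_le_pow_of_le_one hτ.le hτ1 hj) h1 (norm_nonneg _) (by positivity)
        _ ≤ η := by rw [pow_one]; exact hτη
  have h1 := hmain B' (by simp [hB']) (fun j hj => by simp [hB', hB j hj]) hsmall v hv_mem hpos' k hk
  have hτi : 1 ≤ τ⁻¹ := (one_le_inv₀ hτ).2 hτ1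
  have h2 : ∀ a ∈ range l, ‖(aeval shift (∏ k, (X - C (ω k)))) v a‖ ≤
      τ⁻¹ ^ (2 * l) * ‖(aeval shift (∏ k, (X - C (σ * ω k)))) u a‖ := by
    intro a ha
    rw [mem_range] at ha
    rw [aeval_prod_scale univ ω huv, norm_smul, norm_pow, Complex.norm_real, Real.norm_eq_abs, hσa,
      card_univ, Fintype.card_fin, ← mul_assoc]
    refine le_mul_of_one_le_left (norm_nonneg _) ?_
    calc (1 : ℝ) = τ⁻¹ ^ (l + a) * τ ^ (l + a) := by
          rw [← mul_pow, inv_mul_cancel₀ hτ.ne', one_pow]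
      _ ≤ τ⁻¹ ^ (2 * l) * τ ^ (l + a) := by
          refine mul_le_mul_of_nonneg_right (pow_le_pow_right₀ hτi (by omega)) (by positivity)
  calc ‖u k‖ = τ ^ k * ‖v k‖ := by
        rw [huv k, norm_smul, norm_pow, Complex.norm_real, Real.norm_eq_abs, hσa]
    _ ≤ ‖v k‖ := mul_le_of_le_one_left (norm_nonneg _) (pow_le_one₀ hτ.le hτ1)
    _ ≤ C₀ * ∑ a ∈ range l, ‖(aeval shift (∏ k, (X - C (ω k)))) v a‖ := h1
    _ ≤ C₀ * ∑ a ∈ range l, τ⁻¹ ^ (2 * l) *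
          ‖(aeval shift (∏ k, (X - C (σ * ω k)))) u a‖ :=
        mul_le_mul_of_nonneg_left (sum_le_sum h2) hC₀
    _ = _ := by rw [← mul_sum, mul_assoc]

end HalfData

section Laplace

lemma sum_sub_telescope {G : Type*} [AddCommGroup G] (M : ℕ) (g : ℕ → ℕ → G)
    (hg : ∀ a b, M < a + b → g a b = 0) :
    ∑ a ∈ range M, ∑ b ∈ range M, (g a (b + 1) - g (a + 1) b) =
      ∑ b ∈ range (M + 1), g 0 b - ∑ a ∈ range (M + 1), g a 0 := by
  have h0 : ∑ a ∈ range M, ∑ b ∈ range M, (g a (b + 1) - g (a + 1) b) =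
      ∑ a ∈ range (M + 1), ∑ b ∈ range (M + 1), (g a (b + 1) - g (a + 1) b) := by
    rw [sum_range_succ, sum_eq_zero (s := range (M + 1)) (f := fun b => g M (b + 1) - g (M + 1) b)
      (fun b _ => by rw [hg _ _ (by omega), hg _ _ (by omega), sub_zero]), add_zero]
    refine sum_congr rfl fun a _ => ?_
    rw [sum_range_succ, hg _ _ (by omega), hg _ _ (by omega), sub_zero, add_zero]
  have h1 : ∀ a, ∑ b ∈ range (M + 1), g a (b + 1) = ∑ b ∈ range (M + 1), g a b - g a 0 := by
    intro a
    rw [eq_sub_iff_add_eq, ← sum_range_succ' (g a), sum_range_succ, hg _ _ (by omega), add_zero]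
  have h2 : ∀ b, ∑ a ∈ range (M + 1), g (a + 1) b = ∑ a ∈ range (M + 1), g a b - g 0 b := by
    intro b
    rw [eq_sub_iff_add_eq, ← sum_range_succ' (fun a => g a b), sum_range_succ,
      hg _ _ (by omega), add_zero]
  rw [h0]
  simp only [sum_sub_distrib, h1]
  rw [sum_comm (f := fun a b => g (a + 1) b)]
  simp only [sum_sub_distrib, h2]
  rw [sum_comm (f := fun a b => g b a)]
  abel

variable {H : Type*} [NormedAddCommGroup H] [InnerProductSpace ℂ H]

/-- The numerator of the Laplace transform of the solution with the data `u`. -/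
def laplaceNum (n : ℕ) (B : ℕ → (H →L[ℂ] H)) (μ : ℂ) : (ℕ → H) →ₗ[ℂ] H where
  toFun u := ∑ a ∈ range n, ∑ b ∈ range n, μ ^ b • B (a + b + 1) (u a)
  map_add' u v := by simp [sum_add_distrib]
  map_smul' s u := by simp [smul_sum, smul_comm s]

lemma laplaceNum_apply (n : ℕ) (B : ℕ → (H →L[ℂ] H)) (μ : ℂ) (u : ℕ → H) :
    laplaceNum n B μ u = ∑ a ∈ range n, ∑ b ∈ range n, μ ^ b • B (a + b + 1) (u a) := rfl

variable {n : ℕ} (A : Fin (n + 1) → (H →L[ℂ] H))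

lemma laplaceNum_sub {u : ℕ → H} (hu : u ∈ sol n (coeffs A)) (μ : ℂ) :
    μ • laplaceNum n (coeffs A) μ u - laplaceNum n (coeffs A) μ (shift u) =
      pencil A μ (u 0) := by
  have h := sum_sub_telescope n (fun a b => μ ^ b • coeffs A (a + b) (u a))
    (fun a b hab => by rw [coeffs_of_lt A hab]; simp)
  have h0 : ∑ a ∈ range (n + 1), μ ^ 0 • coeffs A (a + 0) (u a) = 0 := by
    simpa using hu 0
  rw [h0, sub_zero] at h
  rw [pencil_eq, _root_.sum_apply]
  simp only [_root_.smul_apply, laplaceNum_apply]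
  simp only [zero_add] at h
  rw [← h, smul_sum, ← sum_sub_distrib]
  refine sum_congr rfl fun a _ => ?_
  rw [smul_sum, ← sum_sub_distrib]
  refine sum_congr rfl fun b _ => ?_
  rw [smul_smul, ← pow_succ', shift_apply, show a + (b + 1) = a + b + 1 by omega,
    show a + 1 + b = a + b + 1 by omega]

lemma inverse_laplaceNum {c : ℂ} {e : ℕ → ℕ → H} (he : IsJordan c e) {h : ℕ}
    (hes : ∀ i ≤ h, e i ∈ sol n (coeffs A)) {μ : ℂ} (hμ : IsUnit (pencil A μ)) (hne : μ ≠ c) :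
    Ring.inverse (pencil A μ) (laplaceNum n (coeffs A) μ (e h)) =
      ∑ q ∈ range (h + 1), ((μ - c) ^ (q + 1))⁻¹ • e (h - q) 0 := by
  have hinv : ∀ x, Ring.inverse (pencil A μ) (pencil A μ x) = x := fun x => by
    rw [← mul_apply_eq_comp, Ring.inverse_mul_cancel _ hμ]; rfl
  have hsub : μ - c ≠ 0 := sub_ne_zero.2 hne
  induction h with
  | zero =>
    have h1 := laplaceNum_sub A (hes 0 le_rfl) μ
    rw [he.zero, map_smul, ← sub_smul] at h1
    have h2 := congrArg (fun x => Ring.inverse (pencil A μ) x) h1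
    simp only [hinv, map_smul] at h2
    simp [← h2, smul_smul, hsub]
  | succ h ih =>
    have h1 := laplaceNum_sub A (hes (h + 1) le_rfl) μ
    rw [he.succ, map_add, map_smul, ← sub_sub, ← sub_smul] at h1
    have h2 := congrArg (fun x => Ring.inverse (pencil A μ) x) h1
    simp only [hinv, map_sub, map_smul] at h2
    rw [ih fun i hi => hes i (by omega), sub_eq_iff_eq_add] at h2
    have h3 : Ring.inverse (pencil A μ) (laplaceNum n (coeffs A) μ (e (h + 1))) =
        (μ - c)⁻¹ • (e (h + 1) 0 + ∑ q ∈ range (h + 1), ((μ - c) ^ (q + 1))⁻¹ • e (h - q) 0) := by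
      rw [← h2, smul_smul, inv_mul_cancel₀ hsub, one_smul]
    rw [h3, sum_range_succ' _ (h + 1), smul_add, smul_sum, add_comm]
    congr 1
    · refine sum_congr rfl fun q _ => ?_
      rw [smul_smul, show h + 1 - (q + 1) = h - q by omega, ← mul_inv, ← pow_succ']
    · simp

variable [CompleteSpace H]

lemma circleIntegral_sum_zpow {ι : Type*} (c : ℂ) {R : ℝ} (hR : 0 < R) (s : Finset ι) (m : ι → ℤ)
    (x : ι → H) : (2 * Real.pi * Complex.I : ℂ)⁻¹ •
      (∮ z in C(c, R), ∑ i ∈ s, (z - c) ^ m i • x i) = ∑ i ∈ s, if m i = -1 then x i else 0 := by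
  have hpi := Complex.two_pi_I_ne_zero
  rw [circleIntegral.integral_fun_sum, smul_sum]
  · refine sum_congr rfl fun i _ => ?_
    rw [circleIntegral.integral_smul_const]
    split_ifs with h
    · simp only [h, zpow_neg_one]
      rw [circleIntegral.integral_sub_center_inv c hR.ne', smul_smul, inv_mul_cancel₀ hpi, one_smul]
    · rw [circleIntegral.integral_sub_zpow_of_ne h, zero_smul, smul_zero]
  · intro i _
    refine ContinuousOn.circleIntegrable hR.le ?_
    refine ContinuousOn.smul ?_ continuousOn_const
    refine ContinuousOn.zpow₀ (by fun_prop) _ fun z hz => Or.inl ?_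
    intro h
    rw [mem_sphere_iff_norm, h, norm_zero] at hz
    exact hR.ne hz

/-- The operators extracting the coefficients of the Laplace transform at `c`. -/
noncomputable def laplaceCoeff (c : ℂ) (R : ℝ) (q : ℕ) : (ℕ → H) →ₗ[ℂ] H :=
  ∑ a ∈ range n, ((2 * Real.pi * Complex.I : ℂ)⁻¹ • (∮ μ in C(c, R),
    (μ - c) ^ q • (Ring.inverse (pencil A μ) * ∑ b ∈ range n, μ ^ b • coeffs A (a + b + 1)) :
      H →L[ℂ] H)).toLinearMap ∘ₗ LinearMap.proj a

lemma exists_laplaceCoeff_bound (c : ℂ) (R : ℝ) (q : ℕ) :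
    ∃ C : ℝ, 0 ≤ C ∧ ∀ u, ‖laplaceCoeff A c R q u‖ ≤ C * ∑ k ∈ range n, ‖u k‖ := by
  set L : ℕ → (H →L[ℂ] H) := fun a => (2 * Real.pi * Complex.I : ℂ)⁻¹ • (∮ μ in C(c, R),
    (μ - c) ^ q • (Ring.inverse (pencil A μ) * ∑ b ∈ range n, μ ^ b • coeffs A (a + b + 1)) :
      H →L[ℂ] H) with hL
  refine ⟨∑ a ∈ range n, ‖L a‖, by positivity, fun u => ?_⟩
  have : laplaceCoeff A c R q u = ∑ a ∈ range n, L a (u a) := by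
    rw [laplaceCoeff, LinearMap.sum_apply]; rfl
  rw [this, mul_sum]
  refine norm_sum_le_of_le _ fun a ha => ((L a).le_opNorm (u a)).trans ?_
  exact mul_le_mul_of_nonneg_right (single_le_sum (f := fun a => ‖L a‖)
    (fun _ _ => norm_nonneg _) ha) (norm_nonneg _)

lemma continuousOn_inverse_pencil {s : Set ℂ} (hs : ∀ μ ∈ s, IsUnit (pencil A μ)) :
    ContinuousOn (fun μ => Ring.inverse (pencil A μ)) s := by
  intro μ hμ
  have h1 : ContinuousAt (pencil A) μ := by
    have : Continuous (pencil A) := by unfold pencil; fun_prop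
    exact this.continuousAt
  have h2 := NormedRing.inverse_continuousAt (hs μ hμ).unit
  exact (ContinuousAt.comp (f := pencil A) (by simpa using h2) h1).continuousWithinAt

lemma laplaceCoeff_apply {c : ℂ} {R : ℝ} (hR : 0 < R)
    (hu : ∀ μ ∈ Metric.sphere c R, IsUnit (pencil A μ)) (q : ℕ) (u : ℕ → H) :
    laplaceCoeff A c R q u = (2 * Real.pi * Complex.I : ℂ)⁻¹ • (∮ μ in C(c, R),
      (μ - c) ^ q • Ring.inverse (pencil A μ) (laplaceNum n (coeffs A) μ u)) := by
  have hci := continuousOn_inverse_pencil A hu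
  have hcont : ∀ a, ContinuousOn (fun μ => (μ - c) ^ q • (Ring.inverse (pencil A μ) *
      ∑ b ∈ range n, μ ^ b • coeffs A (a + b + 1))) (Metric.sphere c R) := by
    intro a
    have h1 : ContinuousOn (fun μ : ℂ => (μ - c) ^ q) (Metric.sphere c R) := by fun_prop
    have h2 : ContinuousOn (fun μ : ℂ => ∑ b ∈ range n, μ ^ b • coeffs A (a + b + 1))
        (Metric.sphere c R) := by fun_prop
    exact h1.smul (hci.mul h2)
  have h1 : ∀ a x, (∮ μ in C(c, R), (μ - c) ^ q • (Ring.inverse (pencil A μ) *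
      ∑ b ∈ range n, μ ^ b • coeffs A (a + b + 1)) : H →L[ℂ] H) x =
      ∮ μ in C(c, R), ((μ - c) ^ q • (Ring.inverse (pencil A μ) *
      ∑ b ∈ range n, μ ^ b • coeffs A (a + b + 1))) x := by
    intro a x
    have hint := ((hcont a).circleIntegrable hR.le).out
    simp only [circleIntegral]
    rw [ContinuousLinearMap.intervalIntegral_apply hint]
    rfl
  rw [laplaceCoeff, LinearMap.sum_apply]
  simp only [LinearMap.comp_apply, LinearMap.proj_apply, ContinuousLinearMap.coe_coe,
    _root_.smul_apply, ← smul_sum, h1]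
  rw [← circleIntegral.integral_fun_sum]
  · congr 2
    ext μ
    simp only [mul_apply_eq_comp, laplaceNum_apply, map_sum, smul_sum,
      _root_.sum_apply, _root_.smul_apply]
  · intro a _
    exact (ContinuousOn.clm_apply (hcont a) continuousOn_const).circleIntegrable hR.le

lemma laplaceCoeff_jet {c : ℂ} {R : ℝ} (hR : 0 < R)
    (hu : ∀ μ ∈ Metric.sphere c R, IsUnit (pencil A μ)) {p : ℕ} {y : ℕ → H}
    (hy : IsEAVChain A c p y) {h : ℕ} (hh : h ≤ p) (q : ℕ) :
    laplaceCoeff A c R q (jet c y h) = if q ≤ h then y (h - q) else 0 := by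
  rw [laplaceCoeff_apply A hR hu]
  have hs := circleIntegral_sum_zpow c hR (range (h + 1)) (fun i => (q : ℤ) - (i + 1 : ℕ))
    (fun i => y (h - i))
  have e : (∮ μ in C(c, R), (μ - c) ^ q •
      Ring.inverse (pencil A μ) (laplaceNum n (coeffs A) μ (jet c y h))) =
      ∮ z in C(c, R), ∑ i ∈ range (h + 1), (z - c) ^ ((q : ℤ) - (i + 1 : ℕ)) • y (h - i) := by
    refine circleIntegral.integral_congr hR.le fun μ hμ => ?_
    have hne : μ ≠ c := fun h => by
      rw [h] at hμ; simp at hμ; exact hR.ne hμ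
    rw [inverse_laplaceNum A (isJordan_jet c y) (fun i hi => hy.jet_mem_sol (hi.trans hh))
      (hu μ hμ) hne, smul_sum]
    refine sum_congr rfl fun i _ => ?_
    rw [jet_zero_right, smul_smul, zpow_sub₀ (sub_ne_zero.2 hne), zpow_natCast, zpow_natCast,
      div_eq_mul_inv]
  rw [e, hs]
  have e2 : ∀ i : ℕ, ((q : ℤ) - (i + 1 : ℕ) = -1) ↔ i = q := fun i => by push_cast; omega
  simp only [e2, sum_ite_eq', mem_range, Nat.lt_succ_iff]

lemma laplaceCoeff_jet_of_ne {c c' : ℂ} {R : ℝ} (hR : 0 < R)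
    (hu : ∀ μ ∈ Metric.sphere c R, IsUnit (pencil A μ)) (hc' : R < ‖c' - c‖) {p : ℕ} {y : ℕ → H}
    (hy : IsEAVChain A c' p y) {h : ℕ} (hh : h ≤ p) (q : ℕ) :
    laplaceCoeff A c R q (jet c' y h) = 0 := by
  rw [laplaceCoeff_apply A hR hu]
  have hne : ∀ μ ∈ Metric.closedBall c R, μ ≠ c' := fun μ hμ h => by
    rw [h, mem_closedBall_iff_norm] at hμ
    linarith
  have e : (∮ μ in C(c, R), (μ - c) ^ q •
      Ring.inverse (pencil A μ) (laplaceNum n (coeffs A) μ (jet c' y h))) =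
      ∮ μ in C(c, R), (μ - c) ^ q • ∑ i ∈ range (h + 1), ((μ - c') ^ (i + 1))⁻¹ • y (h - i) := by
    refine circleIntegral.integral_congr hR.le fun μ hμ => ?_
    rw [inverse_laplaceNum A (isJordan_jet c' y) (fun i hi => hy.jet_mem_sol (hi.trans hh))
      (hu μ hμ) (hne μ (Metric.sphere_subset_closedBall hμ))]
    simp only [jet_zero_right]
  have hd : DifferentiableOn ℂ (fun μ : ℂ => (μ - c) ^ q •
      ∑ i ∈ range (h + 1), ((μ - c') ^ (i + 1))⁻¹ • y (h - i)) (Metric.closedBall c R) := by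
    refine DifferentiableOn.smul (by fun_prop) (DifferentiableOn.fun_sum fun i _ => ?_)
    refine DifferentiableOn.smul_const (DifferentiableOn.inv (by fun_prop) fun μ hμ => ?_) _
    exact pow_ne_zero _ (sub_ne_zero.2 (hne μ hμ))
  rw [e, DiffContOnCl.circleIntegral_eq_zero hR.le (hd.mono
    Metric.closure_ball_subset_closedBall).diffContOnCl, smul_zero]

end Laplace

section AdjointSystem

variable {H : Type*} [NormedAddCommGroup H] [InnerProductSpace ℂ H]

lemma coefficients_eq_zero {ι : Type*} [Fintype ι] {y : ι → ℕ → H}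
    (hy : LinearIndependent ℂ fun k => y k 0) {P : ℕ} {a : ι → ℕ → ℂ}
    (ha : ∀ k h, P < h → a k h = 0)
    (hsum : ∀ q, ∑ k, ∑ i ∈ range (P + 1), a k (q + i) • y k i = 0) (k : ι) (h : ℕ) :
    a k h = 0 := by
  have key : ∀ d h, P < h + d → ∀ k, a k h = 0 := by
    intro d
    induction d with
    | zero => intro h hh k; exact ha k h hh
    | succ d ih =>
      intro h hh
      have h1 := hsum h
      have h2 : ∀ k, ∑ i ∈ range (P + 1), a k (h + i) • y k i = a k h • y k 0 := by
        intro k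
        rw [sum_range_succ', sum_eq_zero fun i _ => ?_, zero_add, add_zero]
        rw [ih _ (by omega), zero_smul]
      simp only [h2] at h1
      exact Fintype.linearIndependent_iff.1 hy _ h1
  exact key (P + 1) h (by omega) k

variable {n : ℕ} (A : Fin (n + 1) → (H →L[ℂ] H))

/-- The Taylor coefficients at `c` of `laplaceNum`. -/
noncomputable def laplaceNumCoeff (n : ℕ) (B : ℕ → (H →L[ℂ] H)) (c : ℂ) (s : ℕ) (u : ℕ → H) : H :=
  ∑ a ∈ range n, ∑ b ∈ range n, ((b.choose s : ℂ) * c ^ (b - s)) • B (a + b + 1) (u a)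

lemma laplaceNum_eq_sum (B : ℕ → (H →L[ℂ] H)) (c μ : ℂ) (u : ℕ → H) :
    laplaceNum n B μ u = ∑ s ∈ range n, (μ - c) ^ s • laplaceNumCoeff n B c s u := by
  simp only [laplaceNum_apply, laplaceNumCoeff, smul_sum]
  rw [sum_comm (s := range n) (t := range n) (f := fun s a => ∑ b ∈ range n, _)]
  refine sum_congr rfl fun a _ => ?_
  rw [sum_comm]
  refine sum_congr rfl fun b hb => ?_
  rw [mem_range] at hb
  have h1 : μ ^ b = ∑ s ∈ range n, (μ - c) ^ s * ((b.choose s : ℂ) * c ^ (b - s)) := by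
    conv_lhs => rw [← sub_add_cancel μ c, add_pow]
    refine sum_subset_zero_on_sdiff (range_mono (by omega)) ?_ ?_
    · intro s hs
      simp only [Finset.mem_sdiff, mem_range, not_lt] at hs
      rw [Nat.choose_eq_zero_of_lt (by omega)]; simp
    · intro s _; ring
  rw [h1, sum_smul]
  simp only [smul_smul]

lemma pairing_jet (B : ℕ → (H →L[ℂ] H)) {c : ℂ} (hc : c.im = 0) (z : ℕ → H) (h : ℕ) (u : ℕ → H) :
    pairing n B (jet c z h) u = ∑ s ∈ range n,
      if s ≤ h then inner ℂ (z (h - s)) (laplaceNumCoeff n B c s u) else 0 := by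
  have hcc : (starRingEnd ℂ) c = c := Complex.conj_eq_iff_im.2 hc
  have h1 : ∀ (b : ℕ) (x : H), b < n → inner ℂ (jet c z h b) x =
      ∑ s ∈ range n, if s ≤ h then
        ((b.choose s : ℂ) * c ^ (b - s)) * inner ℂ (z (h - s)) x else 0 := by
    intro b x hb
    rw [jet, sum_inner, ← sum_filter]
    have e : ∀ s, inner ℂ (((b.choose s : ℂ) * c ^ (b - s)) • z (h - s)) x =
        ((b.choose s : ℂ) * c ^ (b - s)) * inner ℂ (z (h - s)) x := by
      intro s
      rw [inner_smul_left]; simp [hcc]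
    simp only [e]
    rcases le_total n (h + 1) with hn | hn
    · symm
      refine sum_subset_zero_on_sdiff ?_ ?_ (fun _ _ => rfl)
      · intro s hs; simp only [mem_filter, mem_range] at hs ⊢; omega
      · intro s hs
        simp only [Finset.mem_sdiff, mem_filter, mem_range] at hs
        rw [Nat.choose_eq_zero_of_lt (by omega)]; simp
    · refine sum_congr ?_ fun _ _ => rfl
      ext s; simp only [mem_filter, mem_range]; omega
  rw [pairing, wform_apply]
  have h2 : ∀ s, (if s ≤ h then inner ℂ (z (h - s)) (laplaceNumCoeff n B c s u) else 0) =
      ∑ a ∈ range n, ∑ b ∈ range n, if s ≤ h then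
        ((b.choose s : ℂ) * c ^ (b - s)) * inner ℂ (z (h - s)) (B (a + b + 1) (u a)) else 0 := by
    intro s
    split_ifs with hs
    · simp only [laplaceNumCoeff, inner_sum, inner_smul_right]
    · simp
  simp only [h2]
  conv_rhs => rw [sum_comm]
  refine sum_congr rfl fun a _ => ?_
  conv_rhs => rw [sum_comm]
  exact sum_congr rfl fun b hb => h1 b _ (mem_range.1 hb)

variable [CompleteSpace H]

lemma exists_isUnit_punctured {c : ℂ} {p : ℂ → Prop} (hp : ∀ᶠ μ in 𝓝[≠] c, p μ) {p' : ℂ → Prop}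
    (hp' : ∀ᶠ μ in 𝓝 c, p' μ) : ∃ R : ℝ, 0 < R ∧
    (∀ μ ∈ Metric.closedBall c R, μ ≠ c → p μ) ∧ ∀ μ ∈ Metric.closedBall c R, p' μ := by
  rw [eventually_nhdsWithin_iff] at hp
  obtain ⟨ε, hε, h⟩ := Metric.eventually_nhds_iff_ball.1 (hp.and hp')
  have hsub : Metric.closedBall c (ε / 2) ⊆ Metric.ball c ε :=
    Metric.closedBall_subset_ball (by linarith)
  exact ⟨ε / 2, by positivity, fun μ hμ hne => (h μ (hsub hμ)).1 hne,
    fun μ hμ => (h μ (hsub hμ)).2⟩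

lemma ne_of_mem_sphere {c μ : ℂ} {R : ℝ} (hR : 0 < R) (hμ : μ ∈ Metric.sphere c R) : μ ≠ c := by
  rintro rfl
  simp at hμ
  exact hR.ne hμ

lemma laplaceCoeff_eq_of_adjoint {c : ℂ} {R : ℝ} (hR : 0 < R) {Y : ChainSystem H}
    {z : Fin Y.N → ℕ → H} {g : ℂ → (H →L[ℂ] H)}
    (hg : ∀ μ ∈ Metric.closedBall c R, AnalyticAt ℂ g μ)
    (hu : ∀ μ ∈ Metric.sphere c R, IsUnit (pencil A μ))
    (heq : ∀ μ ∈ Metric.sphere c R, Ring.inverse (pencil A μ) = principalPart c Y z μ + g μ)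
    (q : ℕ) (u : ℕ → H) :
    laplaceCoeff A c R q u = ∑ k, ∑ h ∈ range (Y.p k + 1), ∑ i ∈ range (h + 1), ∑ s ∈ range n,
      if q + s + h = Y.p k then
        inner ℂ (z k (h - i)) (laplaceNumCoeff n (coeffs A) c s u) • Y.y k i else 0 := by
  set D : Finset (Σ _ : Fin Y.N, Σ _ : ℕ, Σ _ : ℕ, ℕ) :=
    univ.sigma fun k => (range (Y.p k + 1)).sigma fun h => (range (h + 1)).sigma fun _ => range n
    with hD
  set m : (Σ _ : Fin Y.N, Σ _ : ℕ, Σ _ : ℕ, ℕ) → ℤ := fun x =>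
    (q + x.2.2.2 : ℕ) - (Y.p x.1 + 1 - x.2.1 : ℕ) with hm
  set X : (Σ _ : Fin Y.N, Σ _ : ℕ, Σ _ : ℕ, ℕ) → H := fun x =>
    inner ℂ (z x.1 (x.2.1 - x.2.2.1)) (laplaceNumCoeff n (coeffs A) c x.2.2.2 u) •
      Y.y x.1 x.2.2.1 with hX
  have hs := circleIntegral_sum_zpow c hR D m X
  have hlap : ContinuousOn (fun μ => laplaceNum n (coeffs A) μ u) (Metric.closedBall c R) := by
    simp only [laplaceNum_apply]; fun_prop
  have hgd : DifferentiableOn ℂ (fun μ => (μ - c) ^ q • g μ (laplaceNum n (coeffs A) μ u))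
      (Metric.closedBall c R) := by
    refine DifferentiableOn.smul (by fun_prop) ?_
    refine DifferentiableOn.clm_apply
      (fun μ hμ => (hg μ hμ).differentiableAt.differentiableWithinAt) ?_
    simp only [laplaceNum_apply]; fun_prop
  have hg0 : (∮ μ in C(c, R), (μ - c) ^ q • g μ (laplaceNum n (coeffs A) μ u)) = 0 :=
    DiffContOnCl.circleIntegral_eq_zero hR.le (hgd.mono
      Metric.closure_ball_subset_closedBall).diffContOnCl
  have e : (∮ μ in C(c, R), (μ - c) ^ q •
      Ring.inverse (pencil A μ) (laplaceNum n (coeffs A) μ u)) =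
      ∮ μ in C(c, R), (∑ x ∈ D, (μ - c) ^ m x • X x +
        (μ - c) ^ q • g μ (laplaceNum n (coeffs A) μ u)) := by
    refine circleIntegral.integral_congr hR.le fun μ hμ => ?_
    have hne := sub_ne_zero.2 (ne_of_mem_sphere hR hμ)
    rw [heq μ hμ, _root_.add_apply, smul_add]
    congr 1
    rw [hD, sum_sigma, principalPart, _root_.sum_apply, smul_sum]
    refine sum_congr rfl fun k _ => ?_
    rw [sum_sigma, _root_.sum_apply, smul_sum]
    refine sum_congr rfl fun h _ => ?_
    rw [sum_sigma, _root_.smul_apply, _root_.sum_apply, smul_sum, smul_sum]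
    refine sum_congr rfl fun i _ => ?_
    rw [InnerProductSpace.rankOne_apply, laplaceNum_eq_sum (coeffs A) c, inner_sum, sum_smul,
      smul_sum, smul_sum]
    refine sum_congr rfl fun s _ => ?_
    simp only [hm, hX, inner_smul_right, smul_smul]
    congr 1
    rw [zpow_sub₀ hne, zpow_natCast, zpow_natCast, pow_add]
    ring
  rw [laplaceCoeff_apply A hR hu, e, circleIntegral.integral_add, hg0, add_zero, hs, hD]
  · simp only [sum_sigma]
    refine sum_congr rfl fun k _ => sum_congr rfl fun h hh => sum_congr rfl fun i _ =>
      sum_congr rfl fun s _ => ?_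
    rw [mem_range] at hh
    have : m ⟨k, h, i, s⟩ = -1 ↔ q + s + h = Y.p k := by
      simp only [hm]; omega
    simp only [this, hX]
  · refine ContinuousOn.circleIntegrable hR.le (continuousOn_finsetSum _ fun x _ => ?_)
    refine ContinuousOn.smul (ContinuousOn.zpow₀ (by fun_prop) _ fun μ hμ => Or.inl ?_)
      continuousOn_const
    exact sub_ne_zero.2 (ne_of_mem_sphere hR hμ)
  · exact (hgd.continuousOn.mono Metric.sphere_subset_closedBall).circleIntegrable hR.le

/-- The biorthogonality of a canonical system and its adjoint system. -/
lemma pairing_adjoint {c : ℂ} (hc : c.im = 0) {Y : ChainSystem H}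
    (hunit : ∀ᶠ μ in 𝓝[≠] c, IsUnit (pencil A μ)) (hY : IsKernelChainSystem A c Y)
    {z : Fin Y.N → ℕ → H} (hz : IsAdjointSystem A c Y z) {j : Fin Y.N} {g : ℕ} (hgp : g ≤ Y.p j)
    (k : Fin Y.N) {h : ℕ} (hh : h ≤ Y.p k) :
    pairing n (coeffs A) (jet c (z k) (Y.p k - h)) (jet c (Y.y j) g) =
      if k = j ∧ h = g then 1 else 0 := by
  obtain ⟨G, hG, hGeq⟩ := hz
  obtain ⟨R, hR, h1, h2⟩ := exists_isUnit_punctured (hunit.and hGeq) hG.eventually_analyticAt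
  have hu : ∀ μ ∈ Metric.sphere c R, IsUnit (pencil A μ) := fun μ hμ =>
    (h1 μ (Metric.sphere_subset_closedBall hμ) (ne_of_mem_sphere hR hμ)).1
  set u := jet c (Y.y j) g with hu_def
  set P := ∑ k, Y.p k with hP
  have hPk : ∀ k, Y.p k ≤ P := fun k => single_le_sum (fun _ _ => Nat.zero_le _) (mem_univ k)
  set a : Fin Y.N → ℕ → ℂ := fun k h =>
    if h ≤ Y.p k then pairing n (coeffs A) (jet c (z k) (Y.p k - h)) u else 0 with ha
  have hL : ∀ q, laplaceCoeff A c R q u = ∑ k, ∑ i ∈ range (P + 1), a k (q + i) • Y.y k i := by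
    intro q
    rw [laplaceCoeff_eq_of_adjoint A hR h2 hu (fun μ hμ =>
      (h1 μ (Metric.sphere_subset_closedBall hμ) (ne_of_mem_sphere hR hμ)).2)]
    refine sum_congr rfl fun k _ => ?_
    have e1 : ∀ h ∈ range (Y.p k + 1), ∑ i ∈ range (h + 1), ∑ s ∈ range n,
        (if q + s + h = Y.p k then
          inner ℂ (z k (h - i)) (laplaceNumCoeff n (coeffs A) c s u) • Y.y k i else 0) =
        ∑ i ∈ range (P + 1), if i ≤ h then ∑ s ∈ range n,
        (if q + s + h = Y.p k then
          inner ℂ (z k (h - i)) (laplaceNumCoeff n (coeffs A) c s u) • Y.y k i else 0) else 0 := by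
      intro h hh
      rw [mem_range] at hh
      have := hPk k
      rw [← sum_filter]
      refine sum_congr ?_ fun _ _ => rfl
      ext i; simp only [mem_filter, mem_range]; omega
    rw [sum_congr rfl e1, sum_comm]
    refine sum_congr rfl fun i _ => ?_
    have e2 : ∀ h, (if i ≤ h then ∑ s ∈ range n,
        (if q + s + h = Y.p k then
          inner ℂ (z k (h - i)) (laplaceNumCoeff n (coeffs A) c s u) • Y.y k i else 0) else 0) =
        ∑ s ∈ range n, if h + (q + s) = Y.p k ∧ i ≤ h then
          inner ℂ (z k (h - i)) (laplaceNumCoeff n (coeffs A) c s u) • Y.y k i else 0 := by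
      intro h
      split_ifs with hi
      · refine sum_congr rfl fun s _ => ?_
        simp only [hi, and_true]
        rw [add_comm h]
      · simp [hi]
    simp only [e2]
    rw [sum_comm]
    simp only [ha]
    split_ifs with hq
    · rw [pairing_jet (coeffs A) hc, sum_smul]
      refine sum_congr rfl fun s _ => ?_
      split_ifs with hs
      · rw [sum_eq_single (Y.p k - (q + s))]
        · rw [if_pos (by omega)]
          congr 3; omega
        · intro b _ hb
          rw [if_neg (by omega)]
        · intro hb
          simp only [mem_range] at hb; omega
      · rw [zero_smul]
        exact sum_eq_zero fun h _ => if_neg (by omega)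
    · rw [zero_smul]
      exact sum_eq_zero fun s _ => sum_eq_zero fun h _ => if_neg (by omega)
  have hL2 : ∀ q, laplaceCoeff A c R q u =
      ∑ k, ∑ i ∈ range (P + 1), (if k = j ∧ q + i = g then (1 : ℂ) else 0) • Y.y k i := by
    intro q
    rw [laplaceCoeff_jet A hR hu (hY.1 j) hgp, sum_eq_single j]
    · have := hPk j
      split_ifs with hq
      · rw [sum_eq_single (g - q)]
        · rw [if_pos ⟨rfl, by omega⟩, one_smul]
        · intro i _ hi
          rw [if_neg (by omega), zero_smul]
        · intro hi; simp only [mem_range] at hi; omega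
      · symm
        exact sum_eq_zero fun i _ => by rw [if_neg (by omega), zero_smul]
    · intro k _ hk
      exact sum_eq_zero fun i _ => by rw [if_neg (fun h => hk h.1), zero_smul]
    · simp
  have hfin := coefficients_eq_zero hY.2.1 (P := P)
    (a := fun k h => a k h - if k = j ∧ h = g then 1 else 0) (fun k h hPh => by
      have h3 := hPk k
      have h4 := hPk j
      simp only [ha]
      rw [if_neg (by omega), if_neg (by omega), sub_zero]) (fun q => by
      simp only [sub_smul, sum_sub_distrib]
      rw [← hL, ← hL2, sub_self]) k h
  have := sub_eq_zero.1 hfin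
  simpa only [ha, if_pos hh] using this

end AdjointSystem

section Signs

variable {H : Type*} [NormedAddCommGroup H] [InnerProductSpace ℂ H]

section Sesquilinear

variable {V : Type*} [AddCommGroup V] [Module ℂ V] (b : V →ₗ⋆[ℂ] V →ₗ[ℂ] ℂ)

lemma sesq_eq_zero_of_mem_span {S T : Set V} (h : ∀ x ∈ S, ∀ y ∈ T, b x y = 0) {x y : V}
    (hx : x ∈ Submodule.span ℂ S) (hy : y ∈ Submodule.span ℂ T) : b x y = 0 := by
  induction hx using Submodule.span_induction with
  | mem x hx =>
    induction hy using Submodule.span_induction with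
    | mem y hy => exact h x hx y hy
    | zero => simp
    | add y z _ _ hy hz => simp [hy, hz]
    | smul a y _ hy => simp [hy]
  | zero => simp
  | add x z _ _ hx hz => simp [hx, hz]
  | smul a x _ hx => simp [hx]

lemma sesq_nonneg_of_mem_span {ι : Type*} {e : ι → V} {s : ℝ}
    (h : ∀ i j, i ≠ j → b (e i) (e j) = 0) (hd : ∀ i, 0 ≤ s * (b (e i) (e i)).re) {x : V}
    (hx : x ∈ Submodule.span ℂ (Set.range e)) : 0 ≤ s * (b x x).re := by
  obtain ⟨a, rfl⟩ := Finsupp.mem_span_range_iff_exists_finsupp.1 hx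
  have h1 : b (a.sum fun i r => r • e i) (a.sum fun i r => r • e i) =
      ∑ i ∈ a.support, ((‖a i‖ ^ 2 : ℝ) : ℂ) * b (e i) (e i) := by
    simp only [Finsupp.sum, map_sum, LinearMap.sum_apply]
    refine sum_congr rfl fun i hi => ?_
    rw [sum_eq_single i]
    · rw [LinearMap.map_smulₛₗ₂, map_smul, smul_eq_mul, smul_eq_mul, ← mul_assoc,
        mul_comm ((starRingEnd ℂ) (a i)), Complex.mul_conj']
      push_cast; rfl
    · intro j _ hj
      rw [LinearMap.map_smulₛₗ₂, map_smul]
      rw [h j i hj]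
      simp
    · intro hi'; exact absurd hi hi'
  rw [h1, Complex.re_sum, mul_sum]
  refine sum_nonneg fun i _ => ?_
  rw [Complex.re_ofReal_mul, mul_left_comm]
  exact mul_nonneg (by positivity) (hd i)

end Sesquilinear

variable {n : ℕ} {A : Fin (n + 1) → (H →L[ℂ] H)}

lemma pairing_congr (B : ℕ → (H →L[ℂ] H)) {w w' : ℕ → H} (h : ∀ k < n, w k = w' k) (v : ℕ → H) :
    pairing n B w v = pairing n B w' v := by
  rw [pairing, wform_apply, wform_apply]
  refine sum_congr rfl fun a _ => sum_congr rfl fun b hb => ?_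
  rw [h b (mem_range.1 hb)]

variable (H) in
/-- Extension of a vector of `H^m` by zero. -/
def extendZero (m : ℕ) : PiLp 2 (fun _ : Fin m => H) →ₗ[ℂ] (ℕ → H) where
  toFun w k := if h : k < m then w ⟨k, h⟩ else 0
  map_add' v w := by ext k; by_cases h : k < m <;> simp [h]
  map_smul' a w := by ext k; by_cases h : k < m <;> simp [h]

lemma pairing_extendZero_keldysh (B : ℕ → (H →L[ℂ] H)) (c : ℂ) (y : ℕ → H) (h : ℕ) (v : ℕ → H) :
    pairing n B (extendZero H n (keldysh n c y h)) v = pairing n B (jet c y h) v := by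
  refine pairing_congr B (fun k hk => ?_) v
  simp [extendZero, hk, keldysh_apply]

section Half

variable (Y : discreteSpectrum A → ChainSystem H) (ε : ∀ c, Fin (Y c).N → ℤ)

/-- The sequences of derivatives belonging to the vectors `y_k^h`. -/
def jets (i : Σ c : discreteSpectrum A, Fin (Y c).N × ℕ) : ℕ → H :=
  jet (i.1 : ℂ) ((Y i.1).y i.2.1) i.2.2

/-- The index sets of the two halves, with `s = ±1`. -/
structure IsHalf (s : ℝ) (E : Set (Σ c : discreteSpectrum A, Fin (Y c).N × ℕ)) : Prop where
  cases : ∀ i ∈ E, (0 < s * (i.1 : ℂ).im ∧ i.2.2 ≤ (Y i.1).p i.2.1) ∨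
    ((i.1 : ℂ).im = 0 ∧ 2 * i.2.2 ≤ (Y i.1).p i.2.1 ∧
      (2 * i.2.2 = (Y i.1).p i.2.1 → (ε i.1 i.2.1 : ℝ) = s))
  down : ∀ c k h, ⟨c, k, h + 1⟩ ∈ E → ⟨c, k, h⟩ ∈ E

variable {Y ε} {s : ℝ} {E : Set (Σ c : discreteSpectrum A, Fin (Y c).N × ℕ)}

lemma IsHalf.le (hE : IsHalf Y ε s E) {i} (hi : i ∈ E) : i.2.2 ≤ (Y i.1).p i.2.1 := by
  rcases hE.cases i hi with h | h
  · exact h.2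
  · omega

lemma isHalf_EPlus
    (hε : ∀ c : discreteSpectrum A, (c : ℂ).im = 0 → IsRegular A (c : ℂ) (Y c) (ε c)) :
    IsHalf Y ε 1 (EPlus Y ε) := by
  constructor
  · rintro ⟨c, k, h⟩ hi
    rcases hi with hi | ⟨h0, hle⟩
    · exact Or.inl (by simpa using hi)
    · obtain ⟨-, z, -, hreg⟩ := hε c h0
      refine Or.inr ⟨h0, ?_⟩
      simp only at h0 hle ⊢
      rcases Nat.even_or_odd ((Y c).p k) with hp | hp
      · rcases ((hreg k).2 hp).1 with h1 | h1
        · rw [h1] at hle ⊢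
          obtain ⟨m, hm⟩ := hp
          exact ⟨by omega, by simp⟩
        · rw [h1] at hle
          exact ⟨by omega, by omega⟩
      · rw [(hreg k).1 hp] at hle
        obtain ⟨m, hm⟩ := hp
        exact ⟨by omega, by omega⟩
  · intro c k h hi
    rcases hi with hi | ⟨h0, hle⟩
    · exact Or.inl ⟨hi.1, (Nat.le_succ h).trans hi.2⟩
    · refine Or.inr ⟨h0, le_trans ?_ hle⟩
      push_cast; omega

lemma isHalf_EMinus
    (hε : ∀ c : discreteSpectrum A, (c : ℂ).im = 0 → IsRegular A (c : ℂ) (Y c) (ε c)) :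
    IsHalf Y ε (-1) (EMinus Y ε) := by
  constructor
  · rintro ⟨c, k, h⟩ hi
    rcases hi with hi | ⟨h0, hle⟩
    · exact Or.inl (by simpa using hi)
    · obtain ⟨-, z, -, hreg⟩ := hε c h0
      refine Or.inr ⟨h0, ?_⟩
      simp only at h0 hle ⊢
      rcases Nat.even_or_odd ((Y c).p k) with hp | hp
      · rcases ((hreg k).2 hp).1 with h1 | h1
        · rw [h1] at hle
          exact ⟨by omega, by omega⟩
        · rw [h1] at hle ⊢
          obtain ⟨m, hm⟩ := hp
          exact ⟨by omega, by simp⟩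
      · rw [(hreg k).1 hp] at hle
        obtain ⟨m, hm⟩ := hp
        exact ⟨by omega, by omega⟩
  · intro c k h hi
    rcases hi with hi | ⟨h0, hle⟩
    · exact Or.inl ⟨hi.1, (Nat.le_succ h).trans hi.2⟩
    · refine Or.inr ⟨h0, le_trans ?_ hle⟩
      push_cast; omega

end Half

variable [CompleteSpace H]

lemma isNull_jet (hV : ∀ v, (dform n (coeffs A) v v).re ≤ 0) {c : ℂ} (hc : c.im = 0) {p : ℕ}
    {y : ℕ → H} (hy : IsEAVChain A c p y) {h : ℕ} (hh : 2 * h ≤ p) :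
    IsNull n (coeffs A) (jet c y h) :=
  isNull_of_two_mul_le (fun _ => coeffs_of_lt A) hV hc (isJordan_jet c y)
    (fun _ hi => hy.jet_mem_sol hi) hh

/-- The Gram matrix of the lower halves of the chains of a regular canonical system. -/
lemma bform_jet_regular (hV : ∀ v, (dform n (coeffs A) v v).re ≤ 0) {c : ℂ} (hc : c.im = 0)
    {Y : ChainSystem H} {ε : Fin Y.N → ℤ} (hunit : ∀ᶠ μ in 𝓝[≠] c, IsUnit (pencil A μ))
    (hY : IsRegular A c Y ε) {k j : Fin Y.N} {h g : ℕ} (hh : 2 * h ≤ Y.p k) (hg : 2 * g ≤ Y.p j) :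
    bform n (coeffs A) (jet c (Y.y k) h) (jet c (Y.y j) g) =
      if k = j ∧ h = g ∧ 2 * h = Y.p k then (ε k : ℂ) else 0 := by
  obtain ⟨⟨hK, -, -⟩, z, hz, hreg⟩ := hY
  have hnull : ∀ k h, 2 * h ≤ Y.p k → IsNull n (coeffs A) (jet c (Y.y k) h) := fun k h hh =>
    isNull_jet hV hc (hK.1 k) hh
  have hzero : ∀ {k j h g}, 2 * h ≤ Y.p k → 2 * g ≤ Y.p j → h + g + 1 ≤ Y.p j →
      bform n (coeffs A) (jet c (Y.y k) h) (jet c (Y.y j) g) = 0 := fun {k j h g} hh hg hp =>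
    bform_eq_zero_of_add_lt (fun _ => coeffs_of_lt A) hc (isJordan_jet c (Y.y j))
      (isJordan_jet c (Y.y k)) (fun i hi => (hK.1 j).jet_mem_sol hi)
      (fun i hi => (hK.1 k).jet_mem_sol (by omega)) (fun i hi => hnull k i (by omega)) (by omega)
  have hzero' : ∀ {k j h g}, 2 * h ≤ Y.p k → 2 * g ≤ Y.p j → h + g + 1 ≤ Y.p k →
      bform n (coeffs A) (jet c (Y.y k) h) (jet c (Y.y j) g) = 0 := fun {k j h g} hh hg hp => by
    rw [← conj_bform, hzero hg hh (by omega), map_zero]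
  by_cases h1 : h + g + 1 ≤ Y.p j
  · rw [hzero hh hg h1, if_neg]
    rintro ⟨rfl, rfl, h2⟩; omega
  by_cases h2 : h + g + 1 ≤ Y.p k
  · rw [hzero' hh hg h2, if_neg]
    rintro ⟨rfl, rfl, h2⟩; omega
  have hgh : g = h := by omega
  have hpk : Y.p k = 2 * h := by omega
  subst hgh
  have hpair : ∀ k g, 2 * g ≤ Y.p k → ∀ v, bform n (coeffs A) (jet c (Y.y k) g) v =
      pairing n (coeffs A) (jet c (Y.y k) g) v := fun k g hh v =>
    bform_eq_pairing (fun _ => coeffs_of_lt A)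
      (fun m => isNull_shift_pow (isJordan_jet c (Y.y k)) m fun i hi => hnull k i (by omega)) v
  obtain ⟨hε, hmem⟩ := (hreg k).2 ⟨g, by omega⟩
  rw [show Y.p k / 2 = g by omega] at hmem
  have hlow : ∀ w ∈ Submodule.span ℂ {v | ∃ (j : Fin Y.N) (h : ℕ), 2 * h + 1 ≤ Y.p j ∧
      v = keldysh n c (Y.y j) h},
      pairing n (coeffs A) (extendZero H n w) (jet c (Y.y j) g) = 0 := by
    intro w hw
    induction hw using Submodule.span_induction with
    | mem w hw =>
      obtain ⟨i, m, hm, rfl⟩ := hw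
      rw [pairing_extendZero_keldysh, ← hpair i m (by omega)]
      by_cases h3 : m + g + 1 ≤ Y.p i
      · exact hzero' (by omega) hg h3
      · exact hzero (by omega) hg (by omega)
    | zero => simp
    | add x y _ _ hx hy => simp [hx, hy]
    | smul a x _ hx => simp [hx]
  have h3 := hlow _ hmem
  have h4 := pairing_adjoint A hc hunit hK hz (j := j) (g := g) (by omega) k (h := g) (by omega)
  rw [show Y.p k - g = g by omega] at h4
  rw [map_sub, map_sub, LinearMap.sub_apply, map_smul, LinearMap.map_smulₛₗ₂,
    pairing_extendZero_keldysh, pairing_extendZero_keldysh, ← hpair k g hh, h4,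
    smul_eq_mul] at h3
  simp only [and_true] at h3
  have h5 : (ε k : ℂ) * ε k = 1 := by rcases hε with h | h <;> simp [h]
  simp only [hpk, and_true]
  have h6 : (starRingEnd ℂ) (ε k : ℂ) = ε k := by simp
  rw [h6] at h3
  split_ifs at h3 ⊢ <;>
    linear_combination (-(ε k : ℂ)) * h3 - bform n (coeffs A) (jet c (Y.y k) g) (jet c (Y.y j) g) * h5

variable {Y : discreteSpectrum A → ChainSystem H} {ε : ∀ c, Fin (Y c).N → ℤ} {s : ℝ}
  {E : Set (Σ c : discreteSpectrum A, Fin (Y c).N × ℕ)}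

lemma IsHalf.bform_nonneg (hE : IsHalf Y ε s E) (hV : ∀ v, (dform n (coeffs A) v v).re ≤ 0)
    (hY : ∀ c : discreteSpectrum A, IsCanonical A (c : ℂ) (Y c))
    (hε : ∀ c : discreteSpectrum A, (c : ℂ).im = 0 → IsRegular A (c : ℂ) (Y c) (ε c))
    {x : ℕ → H} (hx : x ∈ Submodule.span ℂ (jets Y '' E)) :
    0 ≤ s * (bform n (coeffs A) x x).re := by
  have hB : ∀ j, n < j → coeffs A j = 0 := fun _ => coeffs_of_lt A
  set Er : Set (Σ c : discreteSpectrum A, Fin (Y c).N × ℕ) := {i | i ∈ E ∧ (i.1 : ℂ).im = 0}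
    with hEr
  set En : Set (Σ c : discreteSpectrum A, Fin (Y c).N × ℕ) := {i | i ∈ E ∧ (i.1 : ℂ).im ≠ 0}
    with hEn
  have hU : E = Er ∪ En := by
    ext i
    simp only [hEr, hEn, Set.mem_union, Set.mem_ofPred_eq]
    tauto
  rw [hU, Set.image_union, Submodule.span_union, Submodule.mem_sup] at hx
  obtain ⟨r, hr, w, hw, rfl⟩ := hx
  have hhalf : ∀ i ∈ Er, 2 * i.2.2 ≤ (Y i.1).p i.2.1 := by
    rintro i ⟨hi, h0⟩
    rcases hE.cases i hi with h | h
    · simp [h0] at h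
    · exact h.2.1
  have hne : ∀ {i j : Σ c : discreteSpectrum A, Fin (Y c).N × ℕ}, i ∈ Er → j ∈ E →
      (j.1 : ℂ) ≠ i.1 → bform n (coeffs A) (jets Y i) (jets Y j) = 0 := by
    intro i j hi hj hij
    have h1 := hhalf i hi
    have h2 := hE.le hj
    exact bform_eq_zero_of_ne hB hi.2 hij (isJordan_jet _ _) (isJordan_jet _ _)
      (fun m hm => ((hY j.1).1.1 j.2.1).jet_mem_sol (by omega))
      (fun m hm => ((hY i.1).1.1 i.2.1).jet_mem_sol (by omega))
      (fun m hm => isNull_jet hV hi.2 ((hY i.1).1.1 i.2.1) (by omega))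
  have hrw : bform n (coeffs A) r w = 0 := by
    refine sesq_eq_zero_of_mem_span _ ?_ hr hw
    rintro _ ⟨i, hi, rfl⟩ _ ⟨j, hj, rfl⟩
    refine hne hi hj.1 fun h => hj.2 ?_
    rw [h]; exact hi.2
  have hwr : bform n (coeffs A) w r = 0 := by rw [← conj_bform, hrw, map_zero]
  have hww : 0 ≤ s * (bform n (coeffs A) w w).re := by
    refine bform_nonneg_of_decaying hB hV ?_
    refine Submodule.span_le.2 ?_ hw
    rintro _ ⟨i, ⟨hi, h0⟩, rfl⟩
    have h1 : 0 < s * (i.1 : ℂ).im := ((hE.cases i hi).resolve_right fun h => h0 h.1).1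
    exact (isJordan_jet _ _).mem_decaying h1 fun m hm =>
      ((hY i.1).1.1 i.2.1).jet_mem_sol (hm.trans (hE.le hi))
  have hrr : 0 ≤ s * (bform n (coeffs A) r r).re := by
    rw [Set.image_eq_range] at hr
    refine sesq_nonneg_of_mem_span (bform n (coeffs A)) ?_ ?_ hr
    · rintro ⟨i, hi⟩ ⟨j, hj⟩ hij
      by_cases hc : (j.1 : ℂ) = i.1
      · obtain ⟨c, k, h⟩ := i
        obtain ⟨c', k', h'⟩ := j
        obtain rfl : c' = c := Subtype.ext hc
        refine (bform_jet_regular hV hi.2 c'.2.2.2.2.1 (hε c' hi.2) (hhalf _ hi)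
          (hhalf _ hj)).trans (if_neg ?_)
        rintro ⟨rfl, rfl, -⟩
        exact hij rfl
      · exact hne hi hj.1 hc
    · rintro ⟨⟨c, k, h⟩, hi⟩
      have h1 : bform n (coeffs A) (jets Y ⟨c, k, h⟩) (jets Y ⟨c, k, h⟩) = _ :=
        bform_jet_regular hV hi.2 c.2.2.2.2.1 (hε c hi.2) (hhalf _ hi) (hhalf _ hi)
      rw [h1]
      split_ifs with h2
      · rcases hE.cases _ hi.1 with h3 | h3
        · have h4 : s * (c : ℂ).im = 0 := by rw [show (c : ℂ).im = 0 from hi.2, mul_zero]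
          exact absurd h3.1 h4.not_gt
        · have h4 := h3.2.2 h2.2.2
          simp only at h4
          rw [← h4]
          simp [mul_self_nonneg]
      · simp
  rw [LinearMap.map_add₂, map_add, map_add, hrw, hwr, add_zero, zero_add, Complex.add_re,
    mul_add]
  exact add_nonneg hrr hww

end Signs

section CoefficientBound

open Polynomial (aeval X C)

lemma isMinimalSystem_of_bound {ι K : Type*} [NormedAddCommGroup K] [InnerProductSpace ℂ K]
    [CompleteSpace K] (v : ι → K)
    (h : ∀ j, ∃ D : ℝ, ∀ a : ι →₀ ℂ, a j = 1 → 1 ≤ D * ‖Finsupp.linearCombination ℂ v a‖) :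
    IsMinimalSystem v := by
  classical
  have key : ∀ j, ∃ z : K, ∀ i, inner ℂ z (v i) = if i = j then (1 : ℂ) else 0 := by
    intro j
    obtain ⟨D, hD⟩ := h j
    set S : Submodule ℂ K := (Submodule.span ℂ (v '' {i | i ≠ j})).topologicalClosure with hS
    have hmem : v j ∉ S := by
      intro hj
      have hcl : v j ∈ closure (Submodule.span ℂ (v '' {i | i ≠ j}) : Set K) := by
        rw [← Submodule.topologicalClosure_coe]; exact hj
      have hD0 : 0 < D := by
        have h1 := hD (Finsupp.single j 1) (by simp)
        by_contra! h2
        have := mul_nonpos_of_nonpos_of_nonneg h2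
          (norm_nonneg (Finsupp.linearCombination ℂ v (Finsupp.single j 1)))
        linarith
      obtain ⟨x, hx, hlt⟩ := Metric.mem_closure_iff.1 hcl D⁻¹ (by positivity)
      obtain ⟨a, ha, rfl⟩ := (Finsupp.mem_span_image_iff_linearCombination ℂ).1 hx
      have haj : a j = 0 := by
        by_contra h0
        exact ((Finsupp.mem_supported ℂ a).1 ha (by simpa using h0)) rfl
      have h1 := hD (Finsupp.single j 1 - a) (by simp [haj])
      rw [map_sub, Finsupp.linearCombination_single, one_smul, ← dist_eq_norm] at h1
      have h2 := mul_lt_mul_of_pos_left hlt hD0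
      rw [mul_inv_cancel₀ hD0.ne'] at h2
      linarith
    have : CompleteSpace S := (Submodule.isClosed_topologicalClosure _).completeSpace_coe
    set w : K := v j - S.starProjection (v j) with hw
    have hwS : w ∈ Sᗮ := Submodule.sub_starProjection_mem_orthogonal (v j)
    have hP : S.starProjection (v j) ∈ S := Submodule.starProjection_apply_mem _ _
    have hw0 : w ≠ 0 := by
      intro h0
      rw [hw, sub_eq_zero] at h0
      rw [h0] at hmem
      exact hmem hP
    have h1 : inner ℂ w (v j) = inner ℂ w w := by
      conv_lhs => rw [← sub_add_cancel (v j) (S.starProjection (v j))]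
      rw [inner_add_right, Submodule.inner_left_of_mem_orthogonal hP hwS, add_zero]
    have hww : (inner ℂ w w : ℂ) ≠ 0 := inner_self_ne_zero.2 hw0
    refine ⟨(starRingEnd ℂ) (inner ℂ w w)⁻¹ • w, fun i => ?_⟩
    rw [inner_smul_left, Complex.conj_conj]
    split_ifs with hi
    · rw [hi, h1, inv_mul_cancel₀ hww]
    · rw [Submodule.inner_left_of_mem_orthogonal (Submodule.le_topologicalClosure _
        (Submodule.subset_span (Set.mem_image_of_mem v (show i ∈ {i | i ≠ j} from hi)))) hwS, mul_zero]
  choose z hz using key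
  refine ⟨z, fun i j => ?_⟩
  rw [hz]

variable {H : Type*} [NormedAddCommGroup H] [InnerProductSpace ℂ H]

variable {n : ℕ} {A : Fin (n + 1) → (H →L[ℂ] H)} {Y : discreteSpectrum A → ChainSystem H}
  {ε : ∀ c, Fin (Y c).N → ℤ} {s : ℝ} {E : Set (Σ c : discreteSpectrum A, Fin (Y c).N × ℕ)}

lemma shift_jets_zero (c : discreteSpectrum A) (k : Fin (Y c).N) :
    shift (jets Y ⟨c, k, 0⟩) = (c : ℂ) • jets Y ⟨c, k, 0⟩ := shift_jet_zero _ _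

lemma shift_jets_succ (c : discreteSpectrum A) (k : Fin (Y c).N) (h : ℕ) :
    shift (jets Y ⟨c, k, h + 1⟩) = (c : ℂ) • jets Y ⟨c, k, h + 1⟩ + jets Y ⟨c, k, h⟩ :=
  shift_jet_succ _ _ _

lemma jets_mem_sol (hY : ∀ c : discreteSpectrum A, IsCanonical A (c : ℂ) (Y c))
    (i : Σ c : discreteSpectrum A, Fin (Y c).N × ℕ) (hi : i.2.2 ≤ (Y i.1).p i.2.1) :
    jets Y i ∈ sol n (coeffs A) := ((hY i.1).1.1 i.2.1).jet_mem_sol hi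

lemma IsHalf.span_le_sol (hE : IsHalf Y ε s E)
    (hY : ∀ c : discreteSpectrum A, IsCanonical A (c : ℂ) (Y c)) :
    Submodule.span ℂ (jets Y '' E) ≤ sol n (coeffs A) := by
  refine Submodule.span_le.2 ?_
  rintro _ ⟨i, hi, rfl⟩
  exact jets_mem_sol hY i (hE.le hi)

lemma IsHalf.shift_mem_span (hE : IsHalf Y ε s E) {x : ℕ → H}
    (hx : x ∈ Submodule.span ℂ (jets Y '' E)) : shift x ∈ Submodule.span ℂ (jets Y '' E) := by
  have : Submodule.span ℂ (jets Y '' E) ≤ (Submodule.span ℂ (jets Y '' E)).comap shift := by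
    refine Submodule.span_le.2 ?_
    rintro _ ⟨⟨c, k, h⟩, hi, rfl⟩
    have h1 := Submodule.subset_span (R := ℂ) (Set.mem_image_of_mem (jets Y) hi)
    rcases h with _ | h
    · rw [SetLike.mem_coe, Submodule.mem_comap, shift_jets_zero]
      exact Submodule.smul_mem _ _ h1
    · rw [SetLike.mem_coe, Submodule.mem_comap, shift_jets_succ]
      exact add_mem (Submodule.smul_mem _ _ h1)
        (Submodule.subset_span (Set.mem_image_of_mem (jets Y) (hE.down _ _ _ hi)))
  exact this hx

lemma IsHalf.aeval_mem_span (hE : IsHalf Y ε s E) (f : Polynomial ℂ) {x : ℕ → H}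
    (hx : x ∈ Submodule.span ℂ (jets Y '' E)) :
    aeval shift f x ∈ Submodule.span ℂ (jets Y '' E) := by
  induction f using Polynomial.induction_on generalizing x with
  | C a => simpa using Submodule.smul_mem _ a hx
  | add f g hf hg => simpa using add_mem (hf hx) (hg hx)
  | monomial m a ih =>
    rw [pow_succ, ← mul_assoc, map_mul, Polynomial.aeval_X, Module.End.mul_apply]
    exact ih (hE.shift_mem_span hx)

lemma IsHalf.le_map_aeval (hE : IsHalf Y ε s E) {ω : ℂ} (hω : s * ω.im < 0) :
    Submodule.span ℂ (jets Y '' E) ≤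
      (Submodule.span ℂ (jets Y '' E)).map (aeval shift (X - C ω)) := by
  refine Submodule.span_le.2 ?_
  rintro _ ⟨⟨c, k, h⟩, hi, rfl⟩
  have hne : (c : ℂ) - ω ≠ 0 := by
    intro h0
    rw [sub_eq_zero] at h0
    rw [← h0] at hω
    rcases hE.cases _ hi with h1 | h1
    · exact absurd h1.1 hω.not_gt
    · have h2 : (c : ℂ).im = 0 := h1.1
      rw [h2, mul_zero] at hω
      exact lt_irrefl _ hω
  have ha : ∀ x : ℕ → H, aeval shift (X - C ω) x = shift x - ω • x := fun x => by simp
  induction h with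
  | zero =>
    refine ⟨((c : ℂ) - ω)⁻¹ • jets Y ⟨c, k, 0⟩, Submodule.smul_mem _ _
      (Submodule.subset_span (Set.mem_image_of_mem _ hi)), ?_⟩
    rw [map_smul, ha, shift_jets_zero, ← sub_smul, smul_smul, inv_mul_cancel₀ hne, one_smul]
  | succ h ih =>
    obtain ⟨x, hx, hxe⟩ := ih (hE.down _ _ _ hi)
    refine ⟨((c : ℂ) - ω)⁻¹ • (jets Y ⟨c, k, h + 1⟩ - x), Submodule.smul_mem _ _
      (sub_mem (Submodule.subset_span (Set.mem_image_of_mem _ hi)) hx), ?_⟩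
    rw [map_smul, map_sub, hxe, ha, shift_jets_succ, add_sub_right_comm, add_sub_cancel_right,
      ← sub_smul, smul_smul, inv_mul_cancel₀ hne, one_smul]

lemma IsHalf.le_map_aeval_prod (hE : IsHalf Y ε s E) {l : ℕ} {ω : Fin l → ℂ}
    (hω : ∀ k, s * (ω k).im < 0) : Submodule.span ℂ (jets Y '' E) ≤
      (Submodule.span ℂ (jets Y '' E)).map (aeval shift (∏ k, (X - C (ω k)))) := by
  refine Finset.prod_induction _ (fun f : Polynomial ℂ => Submodule.span ℂ (jets Y '' E) ≤
    (Submodule.span ℂ (jets Y '' E)).map (aeval shift f)) ?_ ?_ ?_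
  · intro f g hf hg
    rw [map_mul, Module.End.mul_eq_comp, Submodule.map_comp]
    exact hf.trans (Submodule.map_mono hg)
  · rw [map_one, Module.End.one_eq_id, Submodule.map_id]
  · exact fun k _ => hE.le_map_aeval (hω k)

variable [CompleteSpace H]

lemma laplaceCoeff_jets {c : discreteSpectrum A}
    (hY : ∀ c : discreteSpectrum A, IsCanonical A (c : ℂ) (Y c)) {R : ℝ} (hR : 0 < R)
    (hu : ∀ μ ∈ Metric.closedBall (c : ℂ) R, μ ≠ c → IsUnit (pencil A μ))
    (i : Σ c : discreteSpectrum A, Fin (Y c).N × ℕ) (hi : i.2.2 ≤ (Y i.1).p i.2.1) (q : ℕ) :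
    laplaceCoeff A c R q (jets Y i) =
      if i.1 = c ∧ q ≤ i.2.2 then (Y i.1).y i.2.1 (i.2.2 - q) else 0 := by
  have hu' : ∀ μ ∈ Metric.sphere (c : ℂ) R, IsUnit (pencil A μ) := fun μ hμ =>
    hu μ (Metric.sphere_subset_closedBall hμ) (ne_of_mem_sphere hR hμ)
  by_cases hc : i.1 = c
  · obtain ⟨c', k, h⟩ := i
    simp only at hc
    subst hc
    simp only [true_and]
    exact laplaceCoeff_jet A hR hu' ((hY c').1.1 k) hi q
  · rw [if_neg fun h => hc h.1, jets]
    refine laplaceCoeff_jet_of_ne A hR hu' ?_ ((hY i.1).1.1 i.2.1) hi q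
    by_contra! hle
    have h2 := hu i.1 (by rwa [mem_closedBall_iff_norm]) fun h => hc (Subtype.ext h)
    refine i.1.2.1 (LinearMap.ker_eq_bot'.2 fun x hx => ?_)
    have h3 : Ring.inverse (pencil A i.1) (pencil A i.1 x) = x := by
      rw [← mul_apply_eq_comp, Ring.inverse_mul_cancel _ h2]; rfl
    rw [← h3]
    exact (congrArg _ hx).trans (map_zero _)

lemma IsHalf.laplaceCoeff_shift (hE : IsHalf Y ε s E) {c : discreteSpectrum A}
    (hY : ∀ c : discreteSpectrum A, IsCanonical A (c : ℂ) (Y c)) {R : ℝ} (hR : 0 < R)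
    (hu : ∀ μ ∈ Metric.closedBall (c : ℂ) R, μ ≠ c → IsUnit (pencil A μ)) (q : ℕ) {x : ℕ → H}
    (hx : x ∈ Submodule.span ℂ (jets Y '' E)) :
    laplaceCoeff A c R q (shift x) =
      (c : ℂ) • laplaceCoeff A c R q x + laplaceCoeff A c R (q + 1) x := by
  induction hx using Submodule.span_induction with
  | mem x hx =>
    obtain ⟨⟨c', k, h⟩, hi, rfl⟩ := hx
    have hp := hE.le hi
    rcases h with _ | h
    · rw [shift_jets_zero, map_smul, laplaceCoeff_jets hY hR hu _ hp,
        laplaceCoeff_jets hY hR hu _ hp]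
      by_cases hc : c' = c
      · subst hc; simp
      · simp [hc]
    · rw [shift_jets_succ, map_add, map_smul, laplaceCoeff_jets hY hR hu _ hp,
        laplaceCoeff_jets hY hR hu _ hp, laplaceCoeff_jets hY hR hu _ (hE.le (hE.down _ _ _ hi))]
      by_cases hc : c' = c
      · subst hc; simp
      · simp [hc]
  | zero => simp
  | add x y _ _ hx hy => simp only [map_add, hx, hy, smul_add]; abel
  | smul a x _ hx => simp only [map_smul, hx, smul_add, smul_comm a (c : ℂ)]

lemma IsHalf.exists_laplaceCoeff_aeval_bound (hE : IsHalf Y ε s E) {c : discreteSpectrum A}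
    (hY : ∀ c : discreteSpectrum A, IsCanonical A (c : ℂ) (Y c)) {R : ℝ} (hR : 0 < R)
    (hu : ∀ μ ∈ Metric.closedBall (c : ℂ) R, μ ≠ c → IsUnit (pencil A μ)) (f : Polynomial ℂ) :
    ∀ q, ∃ D : ℝ, 0 ≤ D ∧ ∀ x ∈ Submodule.span ℂ (jets Y '' E),
      ‖laplaceCoeff A c R q (aeval shift f x)‖ ≤ D * ∑ k ∈ range n, ‖x k‖ := by
  induction f using Polynomial.induction_on with
  | C a =>
    intro q
    obtain ⟨D, hD, h⟩ := exists_laplaceCoeff_bound A c R q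
    refine ⟨‖a‖ * D, by positivity, fun x _ => ?_⟩
    rw [Polynomial.aeval_C, Module.algebraMap_end_apply, map_smul, norm_smul, mul_assoc]
    exact mul_le_mul_of_nonneg_left (h x) (norm_nonneg a)
  | add f g hf hg =>
    intro q
    obtain ⟨D, hD, h⟩ := hf q
    obtain ⟨D', hD', h'⟩ := hg q
    refine ⟨D + D', by positivity, fun x hx => ?_⟩
    rw [map_add, LinearMap.add_apply, map_add, add_mul]
    exact norm_add_le_of_le (h x hx) (h' x hx)
  | monomial m a ih =>
    intro q
    obtain ⟨D, hD, h⟩ := ih q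
    obtain ⟨D', hD', h'⟩ := ih (q + 1)
    refine ⟨‖(c : ℂ)‖ * D + D', by positivity, fun x hx => ?_⟩
    rw [pow_succ, ← mul_assoc, mul_comm _ X, map_mul, Polynomial.aeval_X, Module.End.mul_apply,
      hE.laplaceCoeff_shift hY hR hu q (hE.aeval_mem_span _ hx), add_mul, mul_assoc]
    refine norm_add_le_of_le ?_ (h' x hx)
    rw [norm_smul]
    exact mul_le_mul_of_nonneg_left (h x hx) (norm_nonneg _)

lemma IsHalf.laplaceCoeff_linearCombination (hE : IsHalf Y ε s E) {c : discreteSpectrum A}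
    (hY : ∀ c : discreteSpectrum A, IsCanonical A (c : ℂ) (Y c)) {R : ℝ} (hR : 0 < R)
    (hu : ∀ μ ∈ Metric.closedBall (c : ℂ) R, μ ≠ c → IsUnit (pencil A μ)) (q : ℕ)
    {P : ℕ} (hP : ∀ k, (Y c).p k ≤ P) {a : (Σ c : discreteSpectrum A, Fin (Y c).N × ℕ) →₀ ℂ}
    (ha : ↑a.support ⊆ E) : laplaceCoeff A c R q (Finsupp.linearCombination ℂ (jets Y) a) =
      ∑ k, ∑ i ∈ range (P + 1), a ⟨c, k, q + i⟩ • (Y c).y k i := by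
  classical
  have hsupp : ∀ i, a i ≠ 0 → i.2.2 ≤ (Y i.1).p i.2.1 := fun i hi =>
    hE.le (ha (by simpa using hi))
  set g : (Σ c : discreteSpectrum A, Fin (Y c).N × ℕ) → H := fun i =>
    a i • laplaceCoeff A c R q (jets Y i) with hg
  have hinj : Set.InjOn (fun x : Fin (Y c).N × ℕ =>
      (⟨c, x.1, q + x.2⟩ : Σ c : discreteSpectrum A, Fin (Y c).N × ℕ)) ↑(univ ×ˢ range (P + 1) : Finset (Fin (Y c).N × ℕ)) := by
    rintro ⟨k, i⟩ _ ⟨k', i'⟩ _ h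
    simp only [Sigma.mk.injEq, heq_eq_eq, Prod.mk.injEq, true_and, add_right_inj] at h
    rw [h.1, h.2]
  rw [Finsupp.linearCombination_apply, Finsupp.sum, map_sum]
  simp only [map_smul]
  have h1 : ∑ i ∈ a.support, g i = ∑ i ∈ (univ ×ˢ range (P + 1)).image
      (fun x : Fin (Y c).N × ℕ =>
        (⟨c, x.1, q + x.2⟩ : Σ c : discreteSpectrum A, Fin (Y c).N × ℕ)), g i := by
    refine sum_congr_of_eq_on_inter ?_ ?_ fun _ _ _ => rfl
    · rintro ⟨c', k, h⟩ hi hni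
      have hle : h ≤ (Y c').p k := hsupp _ (by simpa using hi)
      simp only [hg]
      rw [laplaceCoeff_jets hY hR hu _ hle, if_neg, smul_zero]
      rintro ⟨h1, h2⟩
      simp only at h1 h2
      subst h1
      refine hni (mem_image.2 ⟨(k, h - q), ?_, ?_⟩)
      · have := hP k
        simp only [mem_product, mem_univ, mem_range, true_and]; omega
      · simp only [Nat.add_sub_cancel' h2]
    · intro i _ hi
      simp only [Finsupp.mem_support_iff, not_not] at hi
      simp only [hg, hi, zero_smul]
  rw [h1, sum_image hinj, sum_product]
  refine sum_congr rfl fun k _ => sum_congr rfl fun i _ => ?_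
  simp only [hg]
  by_cases h0 : a ⟨c, k, q + i⟩ = 0
  · rw [h0, zero_smul, zero_smul]
  · rw [laplaceCoeff_jets hY hR hu _ (hsupp _ h0), if_pos ⟨rfl, Nat.le_add_right q i⟩]
    simp only [Nat.add_sub_cancel_left]

/-- Bounds for all Laurent coefficients imply bounds for the coefficients of a linear combination. -/
lemma IsHalf.exists_coefficient_bound (hE : IsHalf Y ε s E) {c : discreteSpectrum A}
    (hY : ∀ c : discreteSpectrum A, IsCanonical A (c : ℂ) (Y c)) {R : ℝ} (hR : 0 < R)
    (hu : ∀ μ ∈ Metric.closedBall (c : ℂ) R, μ ≠ c → IsUnit (pencil A μ)) {N : (ℕ → H) → ℝ}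
    (hN : ∀ q, ∃ D : ℝ, ∀ x ∈ Submodule.span ℂ (jets Y '' E),
      ‖laplaceCoeff A c R q x‖ ≤ D * N x) (h : ℕ) :
    ∃ D : ℝ, ∀ a : (Σ c : discreteSpectrum A, Fin (Y c).N × ℕ) →₀ ℂ, ↑a.support ⊆ E →
      ∀ k, ‖a ⟨c, k, h⟩‖ ≤ D * N (Finsupp.linearCombination ℂ (jets Y) a) := by
  set P := ∑ k, (Y c).p k with hPdef
  have hP : ∀ k, (Y c).p k ≤ P := fun k => single_le_sum (fun _ _ => Nat.zero_le _) (mem_univ k)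
  set L : (Fin (Y c).N → ℂ) →ₗ[ℂ] H := Fintype.linearCombination ℂ fun k => (Y c).y k 0 with hL
  have hLinj : LinearMap.ker L = ⊥ := LinearMap.ker_eq_bot'.2 fun x hx => funext fun k =>
    Fintype.linearIndependent_iff.1 (hY c).1.2.1 x
      (by rwa [hL, Fintype.linearCombination_apply] at hx) k
  obtain ⟨K, -, hK⟩ := L.exists_antilipschitzWith hLinj
  have key : ∀ d h, P < h + d → ∃ D : ℝ,
      ∀ a : (Σ c : discreteSpectrum A, Fin (Y c).N × ℕ) →₀ ℂ, ↑a.support ⊆ E →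
      ∀ k, ‖a ⟨c, k, h⟩‖ ≤ D * N (Finsupp.linearCombination ℂ (jets Y) a) := by
    intro d
    induction d with
    | zero =>
      intro h hh
      refine ⟨0, fun a ha k => ?_⟩
      have : a ⟨c, k, h⟩ = 0 := by
        by_contra h0
        have h1 : h ≤ (Y c).p k := hE.le (ha (by simpa using h0))
        have := hP k
        omega
      simp [this]
    | succ d ih =>
      intro h hh
      have hih : ∀ i, ∃ D : ℝ, ∀ a : (Σ c : discreteSpectrum A, Fin (Y c).N × ℕ) →₀ ℂ,
          ↑a.support ⊆ E → ∀ k, ‖a ⟨c, k, h + (i + 1)⟩‖ ≤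
            D * N (Finsupp.linearCombination ℂ (jets Y) a) := fun i => ih _ (by omega)
      choose D hD using hih
      obtain ⟨D₀, hD₀⟩ := hN h
      refine ⟨K * (D₀ + ∑ k, ∑ i ∈ range P, D i * ‖(Y c).y k (i + 1)‖), fun a ha k => ?_⟩
      set x := Finsupp.linearCombination ℂ (jets Y) a with hx
      have hxm : x ∈ Submodule.span ℂ (jets Y '' E) :=
        (Finsupp.mem_span_image_iff_linearCombination ℂ).2
          ⟨a, (Finsupp.mem_supported ℂ a).2 ha, rfl⟩
      have h1 := hE.laplaceCoeff_linearCombination hY hR hu h hP ha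
      have h2 : L (fun k => a ⟨c, k, h⟩) = laplaceCoeff A c R h x -
          ∑ k, ∑ i ∈ range P, a ⟨c, k, h + (i + 1)⟩ • (Y c).y k (i + 1) := by
        rw [h1, ← sum_sub_distrib, hL, Fintype.linearCombination_apply]
        refine sum_congr rfl fun k _ => ?_
        rw [sum_range_succ', add_sub_cancel_left, add_zero]
      have h3 : ‖L (fun k => a ⟨c, k, h⟩)‖ ≤
          (D₀ + ∑ k, ∑ i ∈ range P, D i * ‖(Y c).y k (i + 1)‖) * N x := by
        rw [h2, add_mul, sum_mul]
        refine norm_sub_le_of_le (hD₀ x hxm) (norm_sum_le_of_le _ fun k _ => ?_)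
        rw [sum_mul]
        refine norm_sum_le_of_le _ fun i _ => ?_
        rw [norm_smul, mul_right_comm]
        exact mul_le_mul_of_nonneg_right (hD i a ha k) (norm_nonneg _)
      calc ‖a ⟨c, k, h⟩‖ ≤ ‖fun k => a ⟨c, k, h⟩‖ := norm_le_pi_norm (fun k => a ⟨c, k, h⟩) k
        _ ≤ K * ‖L (fun k => a ⟨c, k, h⟩)‖ := by
          simpa using hK.le_mul_dist (fun k => a ⟨c, k, h⟩) 0
        _ ≤ K * ((D₀ + ∑ k, ∑ i ∈ range P, D i * ‖(Y c).y k (i + 1)‖) * N x) := by gcongr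
        _ = _ := by ring
  exact key (P + 1) h (by omega)

end CoefficientBound

section Minimality

open Polynomial (aeval X C)

variable {H : Type*} [NormedAddCommGroup H] [InnerProductSpace ℂ H] [CompleteSpace H]

lemma inner_im_nonpos_of_dform {M : ℕ} {B : ℕ → (H →L[ℂ] H)}
    (hV : ∀ v, (dform M B v v).re ≤ 0) (u : H) : (inner ℂ u (B 0 u)).im ≤ 0 := by
  have h1 := hV (Pi.single 0 u)
  rw [dform_single 0 (Nat.zero_le M), sum_eq_single 0] at h1
  · have h2 := congrArg (inner ℂ u) (sub_adjoint_eq (B 0) u)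
    rw [inner_sub_right, ContinuousLinearMap.adjoint_inner_right, inner_smul_right,
      ← inner_conj_symm (B 0 u) u, Complex.sub_conj] at h2
    have h3 : inner ℂ u ((imaginaryPart (B 0) : H →L[ℂ] H) u) =
        ((inner ℂ u (B 0 u)).im : ℂ) := by
      have : (2 * Complex.I : ℂ) ≠ 0 := by simp
      refine mul_left_cancel₀ this ?_
      rw [← h2]; push_cast; ring
    simp only [Nat.cast_zero, sub_zero, tri_zero, one_mul, Pi.single_eq_same, add_zero] at h1
    rwa [h3, Complex.ofReal_re] at h1
  · intro b _ hb
    rw [Pi.single_eq_of_ne hb, inner_zero_left, mul_zero]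
  · simp

variable {l : ℕ} {A : Fin (2 * l + 1) → (H →L[ℂ] H)} {Y : discreteSpectrum A → ChainSystem H}
  {ε : ∀ c, Fin (Y c).N → ℤ} {s : ℝ} {E : Set (Σ c : discreteSpectrum A, Fin (Y c).N × ℕ)}

lemma IsHalf.isMinimalSystem (hE : IsHalf Y ε s E) (hs : |s| = 1) (hV : IsLinearlyDissipative A)
    (hA0 : (0 : ℂ) ∉ closure (numericalRange (A 0)))
    (hY : ∀ c : discreteSpectrum A, IsCanonical A (c : ℂ) (Y c))
    (hε : ∀ c : discreteSpectrum A, (c : ℂ).im = 0 → IsRegular A (c : ℂ) (Y c) (ε c)) :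
    IsMinimalSystem fun i : E => keldysh l (i.1.1 : ℂ) ((Y i.1.1).y i.1.2.1) i.1.2.2 := by
  classical
  have hV' := dform_re_nonpos hV
  have hB : ∀ j, 2 * l < j → coeffs A j = 0 := fun _ => coeffs_of_lt A
  have hA0' : (0 : ℂ) ∉ closure (numericalRange (coeffs A 0)) := by
    have : coeffs A 0 = A 0 := coeffs_fin A 0
    rwa [this]
  obtain ⟨ω, hω, C₀, hC₀, hbound⟩ :=
    exists_half_data_bound hB (inner_im_nonpos_of_dform hV') hA0' hs
  have hpow : ∀ m : ℕ, ∀ x ∈ Submodule.span ℂ (jets Y '' E),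
      (shift ^ m) x ∈ Submodule.span ℂ (jets Y '' E) := fun m x hx => by
    simpa using hE.aeval_mem_span (X ^ m) hx
  set N : (ℕ → H) → ℝ := fun x => ∑ a ∈ range l, ‖x a‖ with hN
  refine isMinimalSystem_of_bound _ ?_
  rintro ⟨⟨c, k, h⟩, hj⟩
  obtain ⟨R, hR, hu, -⟩ := exists_isUnit_punctured c.2.2.2.2.1
    (Eventually.of_forall fun _ : ℂ => trivial)
  have hcoeff : ∀ q, ∃ D : ℝ, ∀ x ∈ Submodule.span ℂ (jets Y '' E),
      ‖laplaceCoeff A c R q x‖ ≤ D * N x := by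
    intro q
    obtain ⟨D, hD, hq⟩ :=
      hE.exists_laplaceCoeff_aeval_bound hY hR hu (∏ k, (X - C (ω k))) q
    refine ⟨D * ((2 * l : ℕ) * C₀), fun x hx => ?_⟩
    obtain ⟨u, hu', rfl⟩ := hE.le_map_aeval_prod hω hx
    have h1 := hbound u (hE.span_le_sol hY hu') (hE.bform_nonneg hV' hY hε (hpow l u hu'))
    refine (hq u hu').trans ?_
    rw [mul_assoc]
    refine mul_le_mul_of_nonneg_left ?_ hD
    calc ∑ k ∈ range (2 * l), ‖u k‖ ≤ ∑ _k ∈ range (2 * l),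
          C₀ * N (aeval shift (∏ k, (X - C (ω k))) u) :=
          sum_le_sum fun k hk => h1 k (mem_range.1 hk)
      _ = _ := by rw [sum_const, card_range, nsmul_eq_mul, mul_assoc]
  obtain ⟨D, hD⟩ := hE.exists_coefficient_bound hY hR hu hcoeff h
  refine ⟨|D| * l, fun a ha => ?_⟩
  set b : (Σ c : discreteSpectrum A, Fin (Y c).N × ℕ) →₀ ℂ := a.embDomain (.subtype _) with hb
  have hbE : ↑b.support ⊆ E := by
    intro i hi
    rw [hb, Finsupp.support_embDomain] at hi
    simp only [coe_map, Function.Embedding.subtype_apply, Set.mem_image] at hi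
    obtain ⟨i', -, rfl⟩ := hi
    exact i'.2
  have hbj : b ⟨c, k, h⟩ = 1 := by
    rw [← ha]
    exact Finsupp.embDomain_apply_self (.subtype _) a ⟨⟨c, k, h⟩, hj⟩
  have h1 := hD b hbE k
  rw [hbj, norm_one] at h1
  have h2 : ∀ r : Fin l, Finsupp.linearCombination ℂ (jets Y) b r =
      Finsupp.linearCombination ℂ (fun i : E =>
        keldysh l (i.1.1 : ℂ) ((Y i.1.1).y i.1.2.1) i.1.2.2) a r := by
    intro r
    rw [hb, Finsupp.linearCombination_embDomain, Finsupp.linearCombination_apply,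
      Finsupp.linearCombination_apply, Finsupp.sum, Finsupp.sum, Finset.sum_apply,
      WithLp.ofLp_sum, Finset.sum_apply]
    refine sum_congr rfl fun i _ => ?_
    rw [WithLp.ofLp_smul, Pi.smul_apply, Pi.smul_apply, keldysh_apply]
    rfl
  have h3 : N (Finsupp.linearCombination ℂ (jets Y) b) ≤ l * ‖Finsupp.linearCombination ℂ
      (fun i : E => keldysh l (i.1.1 : ℂ) ((Y i.1.1).y i.1.2.1) i.1.2.2) a‖ := by
    rw [hN]
    simp only
    rw [sum_range]
    refine (sum_le_card_nsmul univ _ _ fun r _ => ?_).trans (by rw [card_fin, nsmul_eq_mul])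
    rw [h2]
    exact PiLp.norm_apply_le _ r
  calc (1 : ℝ) ≤ D * N (Finsupp.linearCombination ℂ (jets Y) b) := h1
    _ ≤ |D| * N (Finsupp.linearCombination ℂ (jets Y) b) :=
      mul_le_mul_of_nonneg_right (le_abs_self D) (sum_nonneg fun _ _ => norm_nonneg _)
    _ ≤ |D| * (l * _) := mul_le_mul_of_nonneg_left h3 (abs_nonneg D)
    _ = _ := by rw [mul_assoc]

end Minimality

end OperatorPencil

theorem mainTheorem11 {H : Type*} [NormedAddCommGroup H] [InnerProductSpace ℂ H] [CompleteSpace H]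
    (l : ℕ) (A : Fin (2 * l + 1) → (H →L[ℂ] H))
    (hV : OperatorPencil.IsLinearlyDissipative A)
    (hA0 : (0 : ℂ) ∉ closure (OperatorPencil.numericalRange (A 0)))
    (Y : OperatorPencil.discreteSpectrum A → OperatorPencil.ChainSystem H)
    (hY : ∀ c : OperatorPencil.discreteSpectrum A, OperatorPencil.IsCanonical A (c : ℂ) (Y c))
    (ε : ∀ c, Fin (Y c).N → ℤ)
    (hε : ∀ c : OperatorPencil.discreteSpectrum A, (c : ℂ).im = 0 →
      OperatorPencil.IsRegular A (c : ℂ) (Y c) (ε c)) :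
    OperatorPencil.IsMinimalSystem (OperatorPencil.xiPlus l Y ε) ∧
      OperatorPencil.IsMinimalSystem (OperatorPencil.xiMinus l Y ε) := by
  exact ⟨(OperatorPencil.isHalf_EPlus hε).isMinimalSystem (by simp) hV hA0 hY hε,
    (OperatorPencil.isHalf_EMinus hε).isMinimalSystem (by simp) hV hA0 hY hε⟩
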